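/- Theorem 1. The space $\mathrm{Diff}_+(S^1)/\mathrm{PSL}_2(\mathbb R)$ with Kirillov's symplectic form is, up to a constant multiple of the form, the continuous limit of the space of closed Coxeter frieze patterns with the cluster (pre)symplectic form. Precisely: **Setting.** Fix $T>0$, $c\in\mathbb R\setminus\{0\}$, and write $[u,v]=u_1v_2-u_2v_1$. A projective curve is an orientation preserving diffeomorphism $\gamma:\mathbb R/T\mathbb Z\to\mathbb{RP}^1$; $\mathrm{Diff}_+(S^1)/\mathrm{PSL}_2(\mathbb R)$ is the set of projective curves modulo $\gamma\mapsto A\circ\gamma$, $A\in \mathrm{PSL}_2(\mathbb R)$. Let $\Gamma=(\Gamma_1,\Gamma_2):\mathbb R\to\mathbb R^2$ be the lift of $\gamma$ with $[\Gamma,\Gamma']=1$, $\Gamma(x+T)=-\Gamma(x)$, and $k=2c[\Gamma',\Gamma'']$ the potential of the Hill equation $2c\,y''+ky=0$ satisfied by $\Gamma$. A smooth $T$-periodic vector field $X\frac{d}{dx}$ gives the tangent vector $\mathrm{ad}^*_Xk=Xk'+2X'k+cX'''$ at $k$, represented by the variation $X\Gamma'-\frac12X'\Gamma$ of $\Gamma$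 and by the variation $Xf'$ of $f=\Gamma_1/\Gamma_2$. Kirillov's form is $$\omega_K(\mathrm{ad}^*_Xk,\mathrm{ad}^*_Yk)=\int_0^Tk\,(XY'-X'Y)\,dx-c\int_0^TX'Y''\,dx .$$ A closed continuous frieze is a smooth $F(x,y)$ with $FF_{xy}-F_xF_y=1$, $F(x,x)=0$, $F_y(x,x)=1$, $F>0$ for $x<y<x+T$, and $F(x+T,y)=F(x,y+T)=-F(x,y)$. A closed Coxeter frieze of width $n-3$ is a real array $(v_{i,j})_{i,j\in\mathbb Z}$ with $v_{i,i}=0$, $v_{i,i+1}=1$, $v_{i,j}v_{i+1,j+1}-v_{i,j+1}v_{i+1,j}=1$, with $v_{i,j+1}=c_jv_{i,j}-v_{i,j-1}$ where $c_j=v_{j-1,j+1}$, and with $v_{i+n,j}=v_{i,j+n}=-v_{i,j}$; it is positive if $v_{i,j}>0$ for $i<j<i+n$. Tangent vectors are velocities of paths of closed friezes. In the coordinates $a_i=v_{m,m+1+i}$ of a South-East diagonal, the cluster form is $\omega=\sum_{i=1}^{n-4}\frac{da_i\wedge da_{i+1}}{a_ia_{i+1}}$. With $\varepsilon=T/n$,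 closed friezes $v^{(n)}$ converge to the equation $y''=qy$ if $c^{(n)}_i-2=\varepsilon^2q(i\varepsilon)+o(\varepsilon^2)$, and tangent vectors $w^{(n)}$ at $v^{(n)}$ converge to a variation $r$ of $q$ if $w^{(n)}_{i-1,i+1}=\varepsilon^2r(i\varepsilon)+o(\varepsilon^2)$, both as $n\to\infty$, uniformly in $i\in\mathbb Z$. We say that $v^{(n)}\to\gamma$ if the $v^{(n)}$ converge to $y''=-\frac{k}{2c}y$, and that $w^{(n)}\to X$ if the $w^{(n)}$ converge to $-\frac1{2c}\mathrm{ad}^*_Xk$. **Claims.** 1. $\gamma\mapsto F_\gamma(x,y)=[\Gamma(x),\Gamma(y)]$ induces a bijection from $\mathrm{Diff}_+(S^1)/\mathrm{PSL}_2(\mathbb R)$ onto the set of closed continuous friezes. 2. If positive closed friezes $v^{(n)}$ converge to $y''=qy$ with $q$ smooth, then $q=-\frac{k}{2c}$ for some projective curve $\gamma$. Conversely, for every projective curve $\gamma$ there are closed friezes $v^{(n)}\to\gamma$ such that for every $X$ there are tangent vectors $w^{(n)}$ at $v^{(n)}$ with $w^{(n)}\to X$. 3. Let $v^{(n)}$ be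 any closed friezes with $v^{(n)}\to\gamma$. Then $v^{(n)}$ is positive for all large $n$, and $\varepsilon v^{(n)}_{i,j}-F_\gamma(i\varepsilon,j\varepsilon)\to0$ uniformly in $i,j$. If tangent vectors $w^{(n)}$ at $v^{(n)}$ converge to a smooth variation $r$, then $r=-\frac1{2c}\mathrm{ad}^*_Xk$ for some $X$. If $w^{(n)}\to X$ and $\xi=X\Gamma'-\frac12X'\Gamma$, then $\varepsilon w^{(n)}_{i,j}-[\xi(i\varepsilon),\Gamma(j\varepsilon)]-[\Gamma(i\varepsilon),\xi(j\varepsilon)]\to0$ uniformly in $i,j$. If $w^{(n)}\to X$ and $\tilde w^{(n)}\to Y$, then for every choice of the diagonal $m$ $$\lim_{n\to\infty}\omega(w^{(n)},\tilde w^{(n)})=-\frac1{2c}\,\omega_K(\mathrm{ad}^*_Xk,\mathrm{ad}^*_Yk).$$ 4. Every tangent vector $\mathrm{ad}^*_Xk$ can be represented by an $X$ whose variation $\xi=X\Gamma'-\frac12X'\Gamma$ satisfies $\xi_2=0$ wherever $\Gamma_2=0$. For two such vector fields $X,Y$, with variations $\xi,\eta$ of $\Gamma$, the following integrals converge and $$\int_0^T\frac{\xi_2\eta_2'-\xi_2'\eta_2}{\Gamma_2^2}\,dx=-\frac1{4c}\left(-c\int_0^T\frac{(Xf')'(Yf')''-(Xf')''(Yf')'}{(f')^2}\,dx\right)=-\frac1{2c}\,\omega_K(\mathrm{ad}^*_Xk,\mathrm{ad}^*_Yk),$$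 so that this integral is the limit of the cluster form. -/

import Mathlib

open Filter Matrix
open scoped ContDiff Topology LinearAlgebra.Projectivization

noncomputable section

namespace FriezeLimit

/-- The determinant `[u, v]` of two vectors of the plane. -/
def bracket (u v : Fin 2 → ℝ) : ℝ := u 0 * v 1 - u 1 * v 0

/-! ### Projective curves and the space `Diff₊(S¹)/PSL₂(ℝ)` -/

/-- A projective curve, i.e. an orientation preserving diffeomorphism `γ : ℝ/Tℤ → ℝP¹`, given by
an angle function: `γ(x)` is the line spanned by `(cos (angle x), sin (angle x))`. The angle
function of `γ` is unique up to adding integer multiples of `π`. -/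
structure ProjCurve (T : ℝ) where
  angle : ℝ → ℝ
  smooth : ContDiff ℝ ∞ angle
  deriv_pos : ∀ x, 0 < deriv angle x
  angle_add : ∀ x, angle (x + T) = angle x + Real.pi

namespace ProjCurve

variable {T : ℝ}

/-- The unit vector of the given angle. -/
def dir (γ : ProjCurve T) (x : ℝ) : Fin 2 → ℝ :=
  ![Real.cos (γ.angle x), Real.sin (γ.angle x)]

theorem dir_ne_zero (γ : ProjCurve T) (x : ℝ) : γ.dir x ≠ 0 := by
  intro h
  have h0 : Real.cos (γ.angle x) = 0 := by simpa [dir] using congrFun h 0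
  have h1 : Real.sin (γ.angle x) = 0 := by simpa [dir] using congrFun h 1
  have := Real.sin_sq_add_cos_sq (γ.angle x)
  simp [h0, h1] at this

/-- The point `γ(x)` of the projective line. -/
def point (γ : ProjCurve T) (x : ℝ) : ℙ ℝ (Fin 2 → ℝ) :=
  Projectivization.mk ℝ (γ.dir x) (γ.dir_ne_zero x)

/-- Two projective curves are equivalent if they differ by a projective transformation of
`ℝP¹` induced by an element of `SL₂(ℝ)`. (Curves whose angle functions differ by an integer
multiple of `π` have the same points, so they are equivalent.) -/
instance setoid (T : ℝ) : Setoid (ProjCurve T) where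
  r γ γ' := ∃ A : SpecialLinearGroup (Fin 2) ℝ, ∀ x, γ'.point x = A • γ.point x
  iseqv :=
    { refl := fun γ => ⟨1, fun x => (one_smul _ _).symm⟩
      symm := by
        rintro γ γ' ⟨A, hA⟩
        exact ⟨A⁻¹, fun x => by rw [hA x, inv_smul_smul]⟩
      trans := by
        rintro γ₁ γ₂ γ₃ ⟨A, hA⟩ ⟨B, hB⟩
        exact ⟨B * A, fun x => by rw [hB x, hA x, mul_smul]⟩ }

/-- The canonical lift `Γ` of `γ` to the plane; it satisfies `[Γ, Γ'] = 1` and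
`Γ(x + T) = -Γ(x)`. -/
def lift (γ : ProjCurve T) (x : ℝ) : Fin 2 → ℝ :=
  (Real.sqrt (deriv γ.angle x))⁻¹ • γ.dir x

/-- The function `F(x, y) = [Γ(x), Γ(y)]`. -/
def frieze (γ : ProjCurve T) (x y : ℝ) : ℝ := bracket (γ.lift x) (γ.lift y)

/-- The potential `k = 2c [Γ', Γ'']` of the Hill equation `2c y'' + k y = 0` that the components
of `Γ` satisfy. -/
def potential (c : ℝ) (γ : ProjCurve T) (x : ℝ) : ℝ :=
  2 * c * bracket (deriv γ.lift x) (deriv (deriv γ.lift) x)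

/-- The infinitesimal variation `X Γ' - (1/2) X' Γ` of the lift `Γ` under the vector field
`X d/dx`. These are exactly the antiperiodic curves `ξ` in the plane that satisfy
`[Γ, ξ'] + [ξ, Γ'] = 0`; the vector field is recovered as `X = [Γ, ξ]`. -/
def variation (γ : ProjCurve T) (X : ℝ → ℝ) (x : ℝ) : Fin 2 → ℝ :=
  X x • deriv γ.lift x - (deriv X x / 2) • γ.lift x

/-- The affine coordinate `f = Γ₁ / Γ₂` of the curve (meaningful where `Γ₂ ≠ 0`). -/
def affine (γ : ProjCurve T) (x : ℝ) : ℝ := γ.lift x 0 / γ.lift x 1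

/-- The variation `X f'` of the affine coordinate `f` under the vector field `X d/dx`. -/
def affineVariation (γ : ProjCurve T) (X : ℝ → ℝ) (x : ℝ) : ℝ := X x * deriv γ.affine x

end ProjCurve

/-- The space `Diff₊(S¹)/PSL₂(ℝ)`: projective equivalence classes of projective curves. -/
def VirasoroOrbit (T : ℝ) : Type := Quotient (ProjCurve.setoid T)

/-- Smooth vector fields `X(x) d/dx` on `ℝ/Tℤ`. -/
structure IsVectorField (T : ℝ) (X : ℝ → ℝ) : Prop where
  smooth : ContDiff ℝ ∞ X
  periodic : ∀ x, X (x + T) = X x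

/-! ### Kirillov's form -/

/-- The coadjoint action `X k' + 2 X' k + c X'''` of the vector field `X d/dx` on `(k, c)`. -/
def coadjoint (c : ℝ) (k X : ℝ → ℝ) (x : ℝ) : ℝ :=
  X x * deriv k x + 2 * deriv X x * k x + c * deriv (deriv (deriv X)) x

/-- Kirillov's form at `(k, c)` evaluated on the tangent vectors `coadjoint c k X` and
`coadjoint c k Y`. -/
def kirillov (T c : ℝ) (k X Y : ℝ → ℝ) : ℝ :=
  (∫ x in (0 : ℝ)..T, k x * (X x * deriv Y x - deriv X x * Y x)) -
    c * ∫ x in (0 : ℝ)..T, deriv X x * deriv (deriv Y) x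

/-- The density `(ξ' η'' - ξ'' η') / (f')²` on variations `ξ = X f'`, `η = Y f'` of the affine
coordinate `f` of a projective curve. -/
def curveDensity {T : ℝ} (γ : ProjCurve T) (X Y : ℝ → ℝ) (x : ℝ) : ℝ :=
  (deriv (γ.affineVariation X) x * deriv (deriv (γ.affineVariation Y)) x -
      deriv (deriv (γ.affineVariation X)) x * deriv (γ.affineVariation Y) x) /
    deriv γ.affine x ^ 2

/-- The density `(ξ₂ η₂' - ξ₂' η₂) / Γ₂²` on variations `ξ`, `η` of the lifted curve `Γ`. -/
def liftDensity {T : ℝ} (γ : ProjCurve T) (X Y : ℝ → ℝ) (x : ℝ) : ℝ :=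
  (γ.variation X x 1 * deriv (fun t => γ.variation Y t 1) x -
      deriv (fun t => γ.variation X t 1) x * γ.variation Y x 1) /
    γ.lift x 1 ^ 2

/-! ### Closed continuous friezes -/

/-- Closed continuous frieze patterns. -/
structure IsClosedContFrieze (T : ℝ) (F : ℝ → ℝ → ℝ) : Prop where
  smooth : ContDiff ℝ ∞ (fun p : ℝ × ℝ => F p.1 p.2)
  liouville : ∀ x y,
    F x y * deriv (fun t => deriv (fun s => F s t) x) y -
      deriv (fun s => F s y) x * deriv (fun t => F x t) y = 1
  diag : ∀ x, F x x = 0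
  deriv_diag : ∀ x, deriv (fun t => F x t) x = 1
  pos : ∀ x y, x < y → y < x + T → 0 < F x y
  anti_left : ∀ x y, F (x + T) y = -F x y
  anti_right : ∀ x y, F x (y + T) = -F x y

/-! ### Closed Coxeter friezes and the cluster form -/

/-- Closed Coxeter friezes of width `n - 3`, as arrays `v i j` whose rows are `j - i = const`: the
row `j = i` consists of zeros, the row `j = i + 1` of ones, and the row `j = i + 2` is the
potential `c_{i+1} = v i (i+2)`. Every diagonal solves `V_{j+1} = c_j V_j - V_{j-1}`
(so the lower rows are the polynomials in the `c_j` that the frieze rule generates, also when some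
entries vanish), and all diagonals are `n`-antiperiodic. -/
structure IsClosedFrieze (n : ℕ) (v : ℤ → ℤ → ℝ) : Prop where
  zero_row : ∀ i, v i i = 0
  one_row : ∀ i, v i (i + 1) = 1
  rule : ∀ i j, v i j * v (i + 1) (j + 1) - v i (j + 1) * v (i + 1) j = 1
  recurrence : ∀ i j, v i (j + 1) = v (j - 1) (j + 1) * v i j - v i (j - 1)
  anti_left : ∀ i j, v (i + n) j = -v i j
  anti_right : ∀ i j, v i (j + n) = -v i j

/-- The entries strictly between the two rows of zeros are positive. -/
def IsPositiveFrieze (n : ℕ) (v : ℤ → ℤ → ℝ) : Prop :=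
  ∀ i j : ℤ, i < j → j < i + n → 0 < v i j

/-- Tangent vectors at `v` to the space of closed friezes: velocities of paths of closed
friezes through `v`. -/
def IsFriezeTangent (n : ℕ) (v w : ℤ → ℤ → ℝ) : Prop :=
  ∃ u : ℝ → ℤ → ℤ → ℝ, u 0 = v ∧ (∀ᶠ t in 𝓝 (0 : ℝ), IsClosedFrieze n (u t)) ∧
    ∀ i j, HasDerivAt (fun t => u t i j) (w i j) 0

/-- The cluster form `∑_{1 ≤ i ≤ n - 4} da_i ∧ da_{i+1} / (a_i a_{i+1})` at `v`, evaluated on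
`w` and `w'`, in the coordinates `a_i = v m (m + 1 + i)`, `1 ≤ i ≤ n - 3`, of the South-East
diagonal that starts at position `m`. -/
def clusterForm (n : ℕ) (m : ℤ) (v w w' : ℤ → ℤ → ℝ) : ℝ :=
  ∑ i ∈ Finset.Icc 1 (n - 4),
    (w m (m + 1 + i) * w' m (m + 2 + i) - w m (m + 2 + i) * w' m (m + 1 + i)) /
      (v m (m + 1 + i) * v m (m + 2 + i))

/-! ### The continuous limit, with step `ε = T / n` -/

/-- The sequence `p n i` is `ε² q(iε) + o(ε²)` for `ε = T / n`, uniformly in `i`. -/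
def ScaledLimit (T : ℝ) (p : ℕ → ℤ → ℝ) (q : ℝ → ℝ) : Prop :=
  ∀ δ > 0, ∀ᶠ n : ℕ in atTop, ∀ i : ℤ,
    |p n i - (T / n) ^ 2 * q (i * (T / n))| ≤ δ * (T / n) ^ 2

/-- The friezes `v n` converge to the equation `y'' = q y`: as `V_{i+1} - 2 V_i + V_{i-1}` equals
`(c_i - 2) V_i` on the diagonals of `v n`, this means `(c_i - 2) / ε² → q`, uniformly. -/
def FriezeConverges (T : ℝ) (v : ℕ → ℤ → ℤ → ℝ) (q : ℝ → ℝ) : Prop :=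
  ScaledLimit T (fun n i => v n (i - 1) (i + 1) - 2) q

/-- The tangent vectors `w n` converge to the variation `r` of the potential `q` in
`y'' = q y`. -/
def TangentConverges (T : ℝ) (w : ℕ → ℤ → ℤ → ℝ) (r : ℝ → ℝ) : Prop :=
  ScaledLimit T (fun n i => w n (i - 1) (i + 1)) r

/-- The arrays `ε v n i j` converge to `F (iε) (jε)`, uniformly in `i` and `j`. -/
def EntriesConverge (T : ℝ) (v : ℕ → ℤ → ℤ → ℝ) (F : ℝ → ℝ → ℝ) : Prop :=
  ∀ δ > 0, ∀ᶠ n : ℕ in atTop, ∀ i j : ℤ,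
    |T / n * v n i j - F (i * (T / n)) (j * (T / n))| ≤ δ

end FriezeLimit

end

noncomputable section

namespace FriezeLimit

/-! Everything is expressed through q = -k/(2c), the components (a, b) of Γ as a basis of solutions
of y'' = qy with Wronskian one, and the kernel [Γ(x), Γ(y)] = a(x)b(y) - b(x)a(y). The constant c
returns only in the last section.

Continuous friezes. Differentiating FF_xy - F_xF_y = 1 in y gives ∂_x(F_yy/F) = 0, so all the
functions F(x, ·) solve one Hill equation and F is the kernel of a basis of its solutions.
Positivity of F makes the angle of the plane curve advance by exactly π over a period, which yields
γ (`IsClosedContFrieze.exists_projCurve`). Conversely, the values of F are the coordinates of Γ in a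
fixed basis, so F determines Γ up to SL₂.

Entries. The recurrence of a frieze discretises y'' = qy. Taylor expansion and a discrete Gronwall
inequality give convergence of the scaled entries and of their differences
(`FriezeConverges.entries_local`). The entries control positivity in the middle of the frieze, the
differences control it near the rows of zeros. To approximate a given γ, inscribe polygons in Γ with
equal brackets of consecutive vertices and rescale them (`HillBasis.exists_equidistant`).

Tangent vectors. Let d_j be the velocity of c_j. Variation of constants gives w_{i,j} = ∑ d_l
v_{i,l} v_{l,j}, summed over i ≤ l < j. Antiperiodicity then says that d is orthogonal to all
products of solutions (`IsLinearTangent.closure`), and at friezes with nonzero entries this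
condition is also sufficient (`exists_tangent`). In the limit, functions orthogonal to products of
solutions are exactly the variations `hillVar q X`. To lift such a variation, sample it and restore
exact orthogonality by a small combination of three products, found with a Gram matrix
(`exists_tangents`).

The form. Summation by parts turns the cluster form into the double sum of d_a d'_k v_{k,a}² over 0
≤ k < a < n, which does not depend on the diagonal because of the closure relations
(`clusterForm_eq`). It is a Riemann sum for ∫ r(y) ∫_0^y r'(s) [Γ(s), Γ(y)]² ds dy, where r and r'
are the two limit variations. For r = `hillVar q X` and r' = `hillVar q Y` the inner integral has
the explicit antiderivative `concomitant`; what survives the orthogonality relations is -∫ rY, and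
integration by parts gives Kirillov's form (`HillBasis.integral_integral_hillVar`).

Integral formulas. The square of a solution, taken as a vector field, does not change q; subtracting
a multiple of a² makes X vanish at the zeros of b. For such fields the density (ξ₂η₂' - ξ₂'η₂)/Γ₂²
differs from the integrand q(XY' - X'Y) + X'Y''/2 by derivatives of periodic functions, once b'(XY'
- X'Y)/b is seen to extend continuously over the zeros of b (`HillBasis.integral_density`). -/

/-! ### Pairs of solutions of Hill's equation -/

/-- `a` and `b` are solutions of `y'' = q y` with derivatives `a'`, `b'` and Wronskian one. -/
structure HillBasis (q a b a' b' : ℝ → ℝ) : Prop where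
  smooth : ContDiff ℝ ∞ q
  fst : ∀ x, HasDerivAt a (a' x) x
  fst' : ∀ x, HasDerivAt a' (q x * a x) x
  snd : ∀ x, HasDerivAt b (b' x) x
  snd' : ∀ x, HasDerivAt b' (q x * b x) x
  wronskian : ∀ x, a x * b' x - b x * a' x = 1

/-- A function with `y'' = q y` and `q` smooth is smooth. -/
theorem contDiff_of_hill {q y y' : ℝ → ℝ} (hq : ContDiff ℝ ∞ q)
    (h : ∀ x, HasDerivAt y (y' x) x) (h' : ∀ x, HasDerivAt y' (q x * y x) x) :
    ContDiff ℝ ∞ y ∧ ContDiff ℝ ∞ y' := by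
  have d : deriv y = y' := funext fun x => (h x).deriv
  have d' : deriv y' = fun x => q x * y x := funext fun x => (h' x).deriv
  have key : ∀ n : ℕ, ContDiff ℝ n y ∧ ContDiff ℝ n y' := by
    intro n
    induction n with
    | zero =>
      simp only [Nat.cast_zero, contDiff_zero]
      exact ⟨continuous_iff_continuousAt.2 fun x => (h x).continuousAt,
        continuous_iff_continuousAt.2 fun x => (h' x).continuousAt⟩
    | succ n ih =>
      have e : ((n + 1 : ℕ) : WithTop ℕ∞) = (n : WithTop ℕ∞) + 1 := by push_cast; rfl
      rw [e]
      refine ⟨contDiff_succ_iff_deriv.2 ⟨fun x => (h x).differentiableAt, by simp, ?_⟩,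
        contDiff_succ_iff_deriv.2 ⟨fun x => (h' x).differentiableAt, by simp, ?_⟩⟩
      · rw [d]; exact ih.2
      · rw [d']; exact (hq.of_le (by exact_mod_cast le_top)).mul ih.1
  exact ⟨contDiff_infty.2 fun n => (key n).1, contDiff_infty.2 fun n => (key n).2⟩

/-- The function `[Γ(x), Γ(y)]` for the plane curve `Γ = (a, b)`. -/
def kernel (a b : ℝ → ℝ) (x y : ℝ) : ℝ := a x * b y - b x * a y

namespace HillBasis

variable {q a b a' b' : ℝ → ℝ}

theorem contDiff_fst (h : HillBasis q a b a' b') : ContDiff ℝ ∞ a :=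
  (contDiff_of_hill h.smooth h.fst h.fst').1

theorem contDiff_fst' (h : HillBasis q a b a' b') : ContDiff ℝ ∞ a' :=
  (contDiff_of_hill h.smooth h.fst h.fst').2

theorem contDiff_snd (h : HillBasis q a b a' b') : ContDiff ℝ ∞ b :=
  (contDiff_of_hill h.smooth h.snd h.snd').1

theorem contDiff_snd' (h : HillBasis q a b a' b') : ContDiff ℝ ∞ b' :=
  (contDiff_of_hill h.smooth h.snd h.snd').2

theorem continuous_fst (h : HillBasis q a b a' b') : Continuous a := h.contDiff_fst.continuous

theorem continuous_snd (h : HillBasis q a b a' b') : Continuous b := h.contDiff_snd.continuous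

theorem continuous_fst' (h : HillBasis q a b a' b') : Continuous a' := h.contDiff_fst'.continuous

theorem continuous_snd' (h : HillBasis q a b a' b') : Continuous b' := h.contDiff_snd'.continuous

theorem continuous_kernel (h : HillBasis q a b a' b') :
    Continuous fun p : ℝ × ℝ => kernel a b p.1 p.2 := by
  have := h.continuous_fst
  have := h.continuous_snd
  unfold kernel
  fun_prop

theorem normSq_pos (h : HillBasis q a b a' b') (x : ℝ) : 0 < a x ^ 2 + b x ^ 2 := by
  have w := h.wronskian x
  by_contra hn
  have ha : a x = 0 := by nlinarith [sq_nonneg (a x), sq_nonneg (b x)]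
  have hb : b x = 0 := by nlinarith [sq_nonneg (a x), sq_nonneg (b x)]
  simp [ha, hb] at w

theorem hasDerivAt_kernel_left (h : HillBasis q a b a' b') (x y : ℝ) :
    HasDerivAt (fun s => kernel a b s y) (a' x * b y - b' x * a y) x :=
  ((h.fst x).mul_const (b y)).sub ((h.snd x).mul_const (a y))

theorem hasDerivAt_kernel_right (h : HillBasis q a b a' b') (x y : ℝ) :
    HasDerivAt (fun t => kernel a b x t) (a x * b' y - b x * a' y) y :=
  ((h.snd y).const_mul (a x)).sub ((h.fst y).const_mul (b x))

end HillBasis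

/-! ### The lift of a projective curve -/

namespace ProjCurve

variable {T : ℝ}

/-- The coefficient `q = -[Γ', Γ'']` of the equation `y'' = q y` satisfied by the lift. -/
def hill (γ : ProjCurve T) (x : ℝ) : ℝ :=
  -bracket (deriv γ.lift x) (deriv (deriv γ.lift) x)

theorem contDiff_lift (γ : ProjCurve T) : ContDiff ℝ ∞ γ.lift := by
  have h1 : ContDiff ℝ ∞ (deriv γ.angle) := (contDiff_infty_iff_deriv.1 γ.smooth).2
  have h2 : ContDiff ℝ ∞ fun x => (Real.sqrt (deriv γ.angle x))⁻¹ :=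
    (h1.sqrt fun x => (γ.deriv_pos x).ne').inv fun x => (Real.sqrt_pos.2 (γ.deriv_pos x)).ne'
  unfold lift
  refine h2.smul (contDiff_pi.2 fun i => ?_)
  fin_cases i
  · exact γ.smooth.cos
  · exact γ.smooth.sin

theorem lift_zero_eq (γ : ProjCurve T) (x : ℝ) :
    γ.lift x 0 = (Real.sqrt (deriv γ.angle x))⁻¹ * Real.cos (γ.angle x) := by
  simp [lift, dir]

theorem lift_one_eq (γ : ProjCurve T) (x : ℝ) :
    γ.lift x 1 = (Real.sqrt (deriv γ.angle x))⁻¹ * Real.sin (γ.angle x) := by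
  simp [lift, dir]

theorem deriv_angle_add (γ : ProjCurve T) (x : ℝ) :
    deriv γ.angle (x + T) = deriv γ.angle x := by
  rw [← deriv_comp_add_const]
  have : (fun x => γ.angle (x + T)) = fun x => γ.angle x + Real.pi := funext γ.angle_add
  rw [this, deriv_add_const]

theorem lift_add (γ : ProjCurve T) (x : ℝ) : γ.lift (x + T) = -γ.lift x := by
  ext i
  fin_cases i <;>
    simp [lift, dir, γ.deriv_angle_add, γ.angle_add, Real.cos_add_pi, Real.sin_add_pi]

theorem strictMono_angle (γ : ProjCurve T) : StrictMono γ.angle :=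
  strictMono_of_deriv_pos γ.deriv_pos

theorem frieze_eq (γ : ProjCurve T) (x y : ℝ) :
    γ.frieze x y = (Real.sqrt (deriv γ.angle x))⁻¹ * (Real.sqrt (deriv γ.angle y))⁻¹ *
      Real.sin (γ.angle y - γ.angle x) := by
  rw [Real.sin_sub]
  simp only [frieze, bracket, lift_zero_eq, lift_one_eq]
  ring

theorem frieze_pos (γ : ProjCurve T) {x y : ℝ} (h1 : x < y) (h2 : y < x + T) :
    0 < γ.frieze x y := by
  rw [frieze_eq]
  have p (z : ℝ) : 0 < (Real.sqrt (deriv γ.angle z))⁻¹ :=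
    inv_pos.2 (Real.sqrt_pos.2 (γ.deriv_pos z))
  have := γ.strictMono_angle h1
  have h := γ.strictMono_angle h2
  rw [γ.angle_add] at h
  exact mul_pos (mul_pos (p x) (p y)) (Real.sin_pos_of_pos_of_lt_pi (by linarith) (by linarith))

theorem hasDerivAt_lift (γ : ProjCurve T) (x : ℝ) (i : Fin 2) :
    HasDerivAt (fun t => γ.lift t i) (deriv γ.lift x i) x :=
  hasDerivAt_pi.1 (γ.contDiff_lift.differentiable (by simp) x).hasDerivAt i

theorem hasDerivAt_deriv_lift (γ : ProjCurve T) (x : ℝ) (i : Fin 2) :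
    HasDerivAt (fun t => deriv γ.lift t i) (deriv (deriv γ.lift) x i) x :=
  hasDerivAt_pi.1 ((contDiff_infty_iff_deriv.1 γ.contDiff_lift).2.differentiable
    (by simp) x).hasDerivAt i

/-- For a plane curve r(cos φ, sin φ) the bracket with its derivative is r²φ'; the factor r =
φ'^(-1/2) normalises it. -/
theorem wronskian_lift (γ : ProjCurve T) (x : ℝ) :
    γ.lift x 0 * deriv γ.lift x 1 - γ.lift x 1 * deriv γ.lift x 0 = 1 := by
  have h1 : ContDiff ℝ ∞ (deriv γ.angle) := (contDiff_infty_iff_deriv.1 γ.smooth).2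
  have h2 : ContDiff ℝ ∞ fun x => (Real.sqrt (deriv γ.angle x))⁻¹ :=
    (h1.sqrt fun x => (γ.deriv_pos x).ne').inv fun x => (Real.sqrt_pos.2 (γ.deriv_pos x)).ne'
  have hr := (h2.differentiable (by simp) x).hasDerivAt
  have hφ := (γ.smooth.differentiable (by simp) x).hasDerivAt
  have e0 : deriv γ.lift x 0 = _ := (γ.hasDerivAt_lift x 0).unique
    ((hr.mul hφ.cos).congr_of_eventuallyEq (Eventually.of_forall fun t => γ.lift_zero_eq t))
  have e1 : deriv γ.lift x 1 = _ := (γ.hasDerivAt_lift x 1).unique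
    ((hr.mul hφ.sin).congr_of_eventuallyEq (Eventually.of_forall fun t => γ.lift_one_eq t))
  have hs := Real.sq_sqrt (γ.deriv_pos x).le
  have hs0 := (Real.sqrt_pos.2 (γ.deriv_pos x)).ne'
  rw [e0, e1, lift_zero_eq, lift_one_eq]
  set s := Real.sqrt (deriv γ.angle x)
  rw [← hs]
  have t := Real.sin_sq_add_cos_sq (γ.angle x)
  field_simp
  linear_combination s * t

theorem contDiff_hill (γ : ProjCurve T) : ContDiff ℝ ∞ γ.hill := by
  have h1 : ContDiff ℝ ∞ (deriv γ.lift) := (contDiff_infty_iff_deriv.1 γ.contDiff_lift).2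
  have h2 : ContDiff ℝ ∞ (deriv (deriv γ.lift)) := (contDiff_infty_iff_deriv.1 h1).2
  rw [contDiff_pi] at h1 h2
  unfold hill bracket
  exact (((h1 0).mul (h2 1)).sub ((h1 1).mul (h2 0))).neg

/-- Differentiating [Γ, Γ'] = 1 gives [Γ, Γ''] = 0, so Γ'' is a multiple of Γ; bracketing with Γ'
identifies the factor. -/
theorem hillBasis (γ : ProjCurve T) :
    HillBasis γ.hill (fun x => γ.lift x 0) (fun x => γ.lift x 1)
      (fun x => deriv γ.lift x 0) (fun x => deriv γ.lift x 1) := by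
  have w : ∀ x, γ.lift x 0 * deriv (deriv γ.lift) x 1 -
      γ.lift x 1 * deriv (deriv γ.lift) x 0 = 0 := by
    intro x
    have h := ((γ.hasDerivAt_lift x 0).mul (γ.hasDerivAt_deriv_lift x 1)).sub
      ((γ.hasDerivAt_lift x 1).mul (γ.hasDerivAt_deriv_lift x 0))
    have h0 := h.unique ((hasDerivAt_const x (1 : ℝ)).congr_of_eventuallyEq
      (Eventually.of_forall fun t => γ.wronskian_lift t))
    linarith
  refine ⟨γ.contDiff_hill, fun x => γ.hasDerivAt_lift x 0, fun x => ?_,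
    fun x => γ.hasDerivAt_lift x 1, fun x => ?_, γ.wronskian_lift⟩
  · convert! γ.hasDerivAt_deriv_lift x 0 using 1
    simp only [hill, bracket]
    linear_combination -deriv γ.lift x 0 * w x + deriv (deriv γ.lift) x 0 * γ.wronskian_lift x
  · convert! γ.hasDerivAt_deriv_lift x 1 using 1
    simp only [hill, bracket]
    linear_combination -deriv γ.lift x 1 * w x + deriv (deriv γ.lift) x 1 * γ.wronskian_lift x

theorem lift_zero_add (γ : ProjCurve T) (x : ℝ) : γ.lift (x + T) 0 = -γ.lift x 0 := by
  rw [lift_add]; rfl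

theorem lift_one_add (γ : ProjCurve T) (x : ℝ) : γ.lift (x + T) 1 = -γ.lift x 1 := by
  rw [lift_add]; rfl

theorem potential_eq (γ : ProjCurve T) {c : ℝ} : γ.potential c = fun x => -(2 * c) * γ.hill x := by
  funext x
  simp only [potential, hill]
  ring

end ProjCurve

theorem eq_of_hasDerivAt_zero {f : ℝ → ℝ} (h : ∀ x, HasDerivAt f 0 x) (x y : ℝ) : f x = f y :=
  is_const_of_deriv_eq_zero (fun x => (h x).differentiableAt) (fun x => (h x).deriv) x y

/-! ### Projective curves from antiperiodic plane curves -/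

/-- Wronskian one forces the angular velocity of (a, b) to be 1/(a² + b²), so the angle is obtained
by integrating it from the argument at 0. -/
theorem HillBasis.exists_angle {q a b a' b' : ℝ → ℝ} (h : HillBasis q a b a' b') :
    ∃ φ : ℝ → ℝ, ContDiff ℝ ∞ φ ∧ (∀ x, HasDerivAt φ (1 / (a x ^ 2 + b x ^ 2)) x) ∧
      ∀ x, a x = Real.sqrt (a x ^ 2 + b x ^ 2) * Real.cos (φ x) ∧
        b x = Real.sqrt (a x ^ 2 + b x ^ 2) * Real.sin (φ x) := by
  set N : ℝ → ℝ := fun x => a x ^ 2 + b x ^ 2 with hN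
  have hNp : ∀ x, 0 < N x := h.normSq_pos
  have hNs : ContDiff ℝ ∞ N := (h.contDiff_fst.pow 2).add (h.contDiff_snd.pow 2)
  have hinv : ContDiff ℝ ∞ fun x => 1 / N x := contDiff_const.div hNs fun x => (hNp x).ne'
  set z : ℂ := ⟨a 0, b 0⟩
  set φ : ℝ → ℝ := fun x => Complex.arg z + ∫ t in (0 : ℝ)..x, 1 / N t with hφdef
  have hφ : ∀ x, HasDerivAt φ (1 / N x) x := fun x =>
    (intervalIntegral.integral_hasDerivAt_right (hinv.continuous.intervalIntegrable _ _)
      (hinv.continuous.stronglyMeasurableAtFilter _ _) hinv.continuous.continuousAt).const_add _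
  have hφs : ContDiff ℝ ∞ φ := by
    rw [contDiff_infty_iff_deriv]
    refine ⟨fun x => (hφ x).differentiableAt, ?_⟩
    rw [show deriv φ = fun x => 1 / N x from funext fun x => (hφ x).deriv]
    exact hinv
  refine ⟨φ, hφs, hφ, ?_⟩
  have hNd : ∀ x, HasDerivAt N (2 * (a x * a' x + b x * b' x)) x := fun x => by
    convert! ((h.fst x).pow 2).add ((h.snd x).pow 2) using 1
    norm_num
    ring
  set R : ℝ → ℝ := fun x => Real.sqrt (N x) with hR
  have hRp : ∀ x, 0 < R x := fun x => Real.sqrt_pos.2 (hNp x)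
  have hRR : ∀ x, R x ^ 2 = a x ^ 2 + b x ^ 2 := fun x => Real.sq_sqrt (hNp x).le
  have hRd : ∀ x, HasDerivAt R ((a x * a' x + b x * b' x) / R x) x := fun x => by
    convert! (hNd x).sqrt (hNp x).ne' using 1
    have := (hRp x).ne'
    change _ = _ / (2 * R x)
    field_simp
  have hNR : ∀ x, N x = R x ^ 2 := fun x => (hRR x).symm
  have hz : R 0 = ‖z‖ := by
    rw [Complex.norm_def, Complex.normSq_apply]
    simp only [hR, hN, z]
    congr 1; ring
  have hφ0 : φ 0 = Complex.arg z := by simp [hφdef]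
  -- The inner product of the normalised curve with (cos φ, sin φ) is constant because both turn at
  -- the same rate, and it is 1 at 0. Unit vectors with inner product one coincide.
  have hp : ∀ x, (a x * Real.cos (φ x) + b x * Real.sin (φ x)) / R x = 1 := by
    intro x
    have hd : ∀ x, HasDerivAt
        (fun x => (a x * Real.cos (φ x) + b x * Real.sin (φ x)) / R x) 0 x := by
      intro x
      convert! ((((h.fst x).mul (hφ x).cos).add ((h.snd x).mul (hφ x).sin)).div (hRd x)
        (hRp x).ne') using 1
      have := (hRp x).ne'
      have e := hRR x
      have w := h.wronskian x
      simp only [Pi.add_apply, Pi.mul_apply]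
      rw [hNR]
      field_simp
      rw [eq_comm]
      linear_combination (a' x * Real.cos (φ x) + b' x * Real.sin (φ x)) * e -
        (b x * Real.cos (φ x) - a x * Real.sin (φ x)) * w
    rw [eq_of_hasDerivAt_zero hd x 0, hφ0]
    have h1 : a 0 = R 0 * Real.cos (Complex.arg z) := by rw [hz, Complex.norm_mul_cos_arg]
    have h2 : b 0 = R 0 * Real.sin (Complex.arg z) := by rw [hz, Complex.norm_mul_sin_arg]
    rw [h1, h2]
    have := (hRp 0).ne'
    have := Real.sin_sq_add_cos_sq (Complex.arg z)
    field_simp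
    linarith
  intro x
  have h1 := hp x
  rw [div_eq_one_iff_eq (hRp x).ne'] at h1
  have h2 := hRR x
  have h3 := Real.sin_sq_add_cos_sq (φ x)
  have h4 : -a x * Real.sin (φ x) + b x * Real.cos (φ x) = 0 := by
    have : (-a x * Real.sin (φ x) + b x * Real.cos (φ x)) ^ 2 = 0 := by
      linear_combination (-1 : ℝ) * h2 + (a x ^ 2 + b x ^ 2) * h3 -
        (a x * Real.cos (φ x) + b x * Real.sin (φ x) + R x) * h1
    exact pow_eq_zero_iff (two_ne_zero) |>.1 this
  constructor
  · change a x = R x * _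
    linear_combination Real.cos (φ x) * h1 - Real.sin (φ x) * h4 - a x * h3
  · change b x = R x * _
    linear_combination Real.sin (φ x) * h1 + Real.cos (φ x) * h4 - b x * h3

/-- Antiperiodicity makes the cosine of the angle gained over a period -1. A gain beyond π would
pass a point whose vector is parallel to the initial one, which the nonvanishing kernel excludes. -/
theorem HillBasis.exists_projCurve {T : ℝ} (hT : 0 < T) {q a b a' b' : ℝ → ℝ}
    (h : HillBasis q a b a' b') (ha : ∀ x, a (x + T) = -a x) (hb : ∀ x, b (x + T) = -b x)
    (hpos : ∀ x y, x < y → y < x + T → kernel a b x y ≠ 0) :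
    ∃ γ : ProjCurve T, ∀ x, γ.lift x = ![a x, b x] := by
  obtain ⟨φ, hs, hd, hab⟩ := h.exists_angle
  have hN := h.normSq_pos
  have hpi : ∀ x, φ (x + T) = φ x + Real.pi := by
    intro x
    have mono : StrictMono φ := strictMono_of_deriv_pos fun x => by
      rw [(hd x).deriv]; exact one_div_pos.2 (hN x)
    have hlt := mono (show x < x + T by linarith)
    have hcos : Real.cos (φ (x + T) - φ x) = -1 := by
      have e1 := hab (x + T)
      have e2 := hab x
      rw [ha, hb] at e1
      rw [neg_sq, neg_sq] at e1
      have hR : 0 < Real.sqrt (a x ^ 2 + b x ^ 2) := Real.sqrt_pos.2 (hN x)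
      set R := Real.sqrt (a x ^ 2 + b x ^ 2)
      have c1 : Real.cos (φ (x + T)) = -Real.cos (φ x) := by
        apply mul_left_cancel₀ hR.ne'; linarith
      have c2 : Real.sin (φ (x + T)) = -Real.sin (φ x) := by
        apply mul_left_cancel₀ hR.ne'; linarith
      rw [Real.cos_sub, c1, c2]
      linarith [Real.sin_sq_add_cos_sq (φ x)]
    have hle : φ (x + T) - φ x ≤ Real.pi := by
      by_contra hgt
      push Not at hgt
      obtain ⟨y, hy, hye⟩ := intermediate_value_Ioo (show x ≤ x + T by linarith)
        hs.continuous.continuousOn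
        (show φ x + Real.pi ∈ Set.Ioo (φ x) (φ (x + T)) from
          ⟨by linarith [Real.pi_pos], by linarith⟩)
      apply hpos x y hy.1 hy.2
      obtain ⟨e1, e2⟩ := hab x
      obtain ⟨e3, e4⟩ := hab y
      rw [hye, Real.cos_add_pi] at e3
      rw [hye, Real.sin_add_pi] at e4
      rw [kernel]
      linear_combination e1 * b y + Real.sqrt (a x ^ 2 + b x ^ 2) * Real.cos (φ x) * e4 -
        e2 * a y - Real.sqrt (a x ^ 2 + b x ^ 2) * Real.sin (φ x) * e3
    have := Real.injOn_cos (Set.mem_Icc.2 ⟨by linarith, hle⟩)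
      (Set.mem_Icc.2 ⟨Real.pi_pos.le, le_rfl⟩) (hcos.trans Real.cos_pi.symm)
    linarith
  refine ⟨⟨φ, hs, fun x => by rw [(hd x).deriv]; exact one_div_pos.2 (hN x), hpi⟩, fun x => ?_⟩
  have hr : (Real.sqrt (deriv φ x))⁻¹ = Real.sqrt (a x ^ 2 + b x ^ 2) := by
    rw [(hd x).deriv, one_div, Real.sqrt_inv, inv_inv]
  ext i
  fin_cases i
  · simp [ProjCurve.lift, ProjCurve.dir, hr, ← (hab x).1]
  · simp [ProjCurve.lift, ProjCurve.dir, hr, ← (hab x).2]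

/-! ### Closed continuous friezes -/

theorem ProjCurve.isClosedContFrieze {T : ℝ} (γ : ProjCurve T) :
    IsClosedContFrieze T γ.frieze := by
  have h := γ.hillBasis
  have dx : ∀ x y, deriv (fun s => γ.frieze s y) x =
      deriv γ.lift x 0 * γ.lift y 1 - deriv γ.lift x 1 * γ.lift y 0 := fun x y =>
    (h.hasDerivAt_kernel_left x y).deriv
  have dy : ∀ x y, deriv (fun t => γ.frieze x t) y =
      γ.lift x 0 * deriv γ.lift y 1 - γ.lift x 1 * deriv γ.lift y 0 := fun x y =>
    (h.hasDerivAt_kernel_right x y).deriv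
  refine ⟨?_, fun x y => ?_, fun x => ?_, fun x => ?_, fun x y => γ.frieze_pos, fun x y => ?_,
    fun x y => ?_⟩
  · have h0 := h.contDiff_fst
    have h1 := h.contDiff_snd
    exact ((h0.comp contDiff_fst).mul (h1.comp contDiff_snd)).sub
      ((h1.comp contDiff_fst).mul (h0.comp contDiff_snd))
  · have dxy : deriv (fun t => deriv (fun s => γ.frieze s t) x) y =
        deriv γ.lift x 0 * deriv γ.lift y 1 - deriv γ.lift x 1 * deriv γ.lift y 0 := by
      simp only [dx]
      exact (((h.snd y).const_mul _).sub ((h.fst y).const_mul _)).deriv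
    rw [dxy, dx, dy]
    simp only [frieze, bracket]
    have w1 := γ.wronskian_lift x
    have w2 := γ.wronskian_lift y
    linear_combination (γ.lift y 0 * deriv γ.lift y 1 - γ.lift y 1 * deriv γ.lift y 0) * w1 + w2
  · simp only [frieze, bracket]; ring
  · rw [dy]; exact γ.wronskian_lift x
  · simp only [frieze, lift_add, bracket, Pi.neg_apply]; ring
  · simp only [frieze, lift_add, bracket, Pi.neg_apply]; ring

/-- Every closed continuous frieze comes from a projective curve. -/
theorem IsClosedContFrieze.exists_projCurve {T : ℝ} (hT : 0 < T) {F : ℝ → ℝ → ℝ}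
    (hF : IsClosedContFrieze T F) : ∃ γ : ProjCurve T, γ.frieze = F := by
  set G : ℝ × ℝ → ℝ := fun p => F p.1 p.2 with hG
  have smooth : ContDiff ℝ ∞ G := hF.smooth
  have contDiff_fderiv : ∀ {H : ℝ × ℝ → ℝ} (e : ℝ × ℝ), ContDiff ℝ ∞ H →
      ContDiff ℝ ∞ fun p => fderiv ℝ H p e := fun e hH =>
    (hH.fderiv_right (by simp)).clm_apply contDiff_const
  have lineX : ∀ {H : ℝ × ℝ → ℝ}, ContDiff ℝ ∞ H → ∀ x y,
      HasDerivAt (fun s => H (s, y)) (fderiv ℝ H (x, y) (1, 0)) x := by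
    intro H hH x y
    have h1 := (hH.differentiable (by simp) (x, y)).hasFDerivAt
    exact h1.comp_hasDerivAt x ((hasDerivAt_id x).prodMk (hasDerivAt_const x y))
  have lineY : ∀ {H : ℝ × ℝ → ℝ}, ContDiff ℝ ∞ H → ∀ x y,
      HasDerivAt (fun t => H (x, t)) (fderiv ℝ H (x, y) (0, 1)) y := by
    intro H hH x y
    have h1 := (hH.differentiable (by simp) (x, y)).hasFDerivAt
    exact h1.comp_hasDerivAt y ((hasDerivAt_const y x).prodMk (hasDerivAt_id y))
  set Gx : ℝ × ℝ → ℝ := fun p => fderiv ℝ G p (1, 0) with hGx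
  set Gy : ℝ × ℝ → ℝ := fun p => fderiv ℝ G p (0, 1) with hGy
  have sx : ContDiff ℝ ∞ Gx := contDiff_fderiv _ smooth
  have sy : ContDiff ℝ ∞ Gy := contDiff_fderiv _ smooth
  set Gxy : ℝ × ℝ → ℝ := fun p => fderiv ℝ Gx p (0, 1) with hGxy
  have sxy : ContDiff ℝ ∞ Gxy := contDiff_fderiv _ sx
  set Gyy : ℝ × ℝ → ℝ := fun p => fderiv ℝ Gy p (0, 1) with hGyy
  have syy : ContDiff ℝ ∞ Gyy := contDiff_fderiv _ sy
  set Gxyy : ℝ × ℝ → ℝ := fun p => fderiv ℝ Gxy p (0, 1) with hGxyy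
  have symm : ∀ {H : ℝ × ℝ → ℝ}, ContDiff ℝ ∞ H → ∀ p,
      fderiv ℝ (fun p => fderiv ℝ H p (0, 1)) p (1, 0) =
        fderiv ℝ (fun p => fderiv ℝ H p (1, 0)) p (0, 1) := by
    intro H hH p
    have hd : DifferentiableAt ℝ (fderiv ℝ H) p :=
      (hH.fderiv_right (m := ∞) (by simp)).differentiable (by simp) p
    have h1 := (hH.contDiffAt (x := p)).isSymmSndFDerivAt
      (by simp only [minSmoothness_of_isRCLikeNormedField]; exact WithTop.coe_le_coe.2 (le_top (a := (2 : ℕ∞))))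
    rw [fderiv_clm_apply hd (differentiableAt_const _),
      fderiv_clm_apply hd (differentiableAt_const _)]
    simpa using h1.eq (1, 0) (0, 1)
  -- the partial derivatives in the frieze equations
  have liou : ∀ x y, G (x, y) * Gxy (x, y) - Gx (x, y) * Gy (x, y) = 1 := by
    intro x y
    have h := hF.liouville x y
    have e1 : (fun t => deriv (fun s => F s t) x) = fun t => Gx (x, t) :=
      funext fun t => (lineX smooth x t).deriv
    rw [e1, (lineY sx x y).deriv, (lineX smooth x y).deriv, (lineY smooth x y).deriv] at h
    exact h
  -- Differentiating in y, the terms with G_y G_xy cancel. The result says that G_yy / G does not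
  -- depend on x.
  have liou' : ∀ x y, G (x, y) * Gxyy (x, y) = Gx (x, y) * Gyy (x, y) := by
    intro x y
    have h := ((lineY smooth x y).mul (lineY sxy x y)).sub ((lineY sx x y).mul (lineY sy x y))
    have := h.unique ((hasDerivAt_const y (1 : ℝ)).congr_of_eventuallyEq
      (Eventually.of_forall fun t => liou x t))
    linear_combination this
  have anti_left : ∀ x y, Gyy (x + T, y) = -Gyy (x, y) := by
    intro x y
    have h0 : ∀ t, G (x + T, t) = -G (x, t) := hF.anti_left x
    have h1 : ∀ t, Gy (x + T, t) = -Gy (x, t) := fun t =>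
      (lineY smooth (x + T) t).unique
        (((lineY smooth x t).neg).congr_of_eventuallyEq (Eventually.of_forall h0))
    exact (lineY sy (x + T) y).unique
        (((lineY sy x y).neg).congr_of_eventuallyEq (Eventually.of_forall h1))
  -- the coefficient of Hill's equation
  set q : ℝ → ℝ := fun y => Gyy (y - T / 2, y) / G (y - T / 2, y) with hq
  have Gpos : ∀ x y, x < y → y < x + T → 0 < G (x, y) := hF.pos
  have q_smooth : ContDiff ℝ ∞ q := by
    have hl : ContDiff ℝ ∞ fun y : ℝ => (y - T / 2, y) :=
      (contDiff_id.sub contDiff_const).prodMk contDiff_id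
    exact (syy.comp hl).div (smooth.comp hl) fun y =>
      (Gpos _ _ (by linarith) (by linarith)).ne'
  have hill_Ioo : ∀ y, ∀ x ∈ Set.Ioo (y - T) y, Gyy (x, y) = q y * G (x, y) := by
    intro y x hx
    have hne : ∀ s ∈ Set.Ioo (y - T) y, G (s, y) ≠ 0 := fun s hs =>
      (Gpos s y hs.2 (by linarith [hs.1])).ne'
    have hd : ∀ s ∈ Set.Ioo (y - T) y, HasDerivAt (fun s => Gyy (s, y) / G (s, y)) 0 s := by
      intro s hs
      convert! (lineX syy s y).div (lineX smooth s y) (hne s hs) using 1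
      have e : fderiv ℝ Gyy (s, y) (1, 0) = Gxyy (s, y) := by
        rw [hGyy, symm sy, show (fun p => fderiv ℝ Gy p (1, 0)) = Gxy from
          funext fun p => symm smooth p]
      rw [e, eq_comm, div_eq_zero_iff]
      left
      linear_combination liou' s y
    have hc := (convex_Ioo (y - T) y).is_const_of_fderivWithin_eq_zero (𝕜 := ℝ)
      (f := fun s => Gyy (s, y) / G (s, y))
      (fun s hs => (hd s hs).differentiableAt.differentiableWithinAt)
      (fun s hs => by
        rw [fderivWithin_of_isOpen isOpen_Ioo hs]
        ext
        simp [(hd s hs).deriv])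
      hx (show y - T / 2 ∈ Set.Ioo (y - T) y from ⟨by linarith, by linarith⟩)
    change _ = Gyy (y - T / 2, y) / G (y - T / 2, y) * _
    rw [← hc, div_mul_cancel₀ _ (hne x hx)]
  -- From the open interval the identity passes to its closure by continuity, and then to all x
  -- because both sides are antiperiodic in x.
  have hill : ∀ x y, Gyy (x, y) = q y * G (x, y) := by
    intro x y
    have hIcc : ∀ s ∈ Set.Icc (y - T) y, Gyy (s, y) = q y * G (s, y) := by
      have hcl := closure_Ioo (show y - T ≠ y by linarith)
      rw [← hcl]
      have hl : Continuous fun s : ℝ => (s, y) := by fun_prop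
      have : Set.EqOn (fun s => Gyy (s, y)) (fun s => q y * G (s, y)) (Set.Ioo (y - T) y) :=
        hill_Ioo y
      exact this.closure (syy.continuous.comp hl) (continuous_const.mul (smooth.continuous.comp hl))
    have hper : Function.Antiperiodic (fun s => Gyy (s, y) - q y * G (s, y)) T := by
      intro s
      have : G (s + T, y) = -G (s, y) := hF.anti_left s y
      simp only [anti_left, this]
      ring
    obtain ⟨m, hm, -⟩ := existsUnique_add_zsmul_mem_Ico hT x (y - T)
    have h0 := hIcc _ ⟨hm.1, by linarith [hm.2]⟩
    have h1 : ∀ (k : ℤ) s, Gyy (s, y) - q y * G (s, y) = 0 →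
        Gyy (s + k • T, y) - q y * G (s + k • T, y) = 0 := by
      intro k s hs
      have := hper.add_zsmul_eq (n := k) (x := s)
      rw [this, hs, smul_zero]
    have h2 := h1 (-m) (x + m • T) (by linarith)
    rw [neg_smul, add_neg_cancel_right] at h2
    linarith
  -- If Γ(0) = (1, 0) and Γ'(0) = (0, 1), then F_x(0, y) = -Γ₁(y) and F(0, y) = Γ₂(y).
  set a : ℝ → ℝ := fun y => -Gx (0, y) with ha
  set b : ℝ → ℝ := fun y => G (0, y) with hb
  have basis : HillBasis q a b (fun y => -Gxy (0, y)) (fun y => Gy (0, y)) := by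
    refine ⟨q_smooth, fun y => (lineY sx 0 y).neg, fun y => ?_, fun y => lineY smooth 0 y,
      fun y => ?_, fun y => ?_⟩
    · have h1 := (lineY sxy 0 y).neg
      convert! h1 using 1
      have h2 : Gxyy (0, y) = fderiv ℝ Gyy (0, y) (1, 0) := by
        rw [hGyy, symm sy, show (fun p => fderiv ℝ Gy p (1, 0)) = Gxy from
          funext fun p => symm smooth p]
      have h3 := (lineX syy 0 y).unique (((lineX smooth 0 y).const_mul (q y)).congr_of_eventuallyEq
        (Eventually.of_forall fun s => hill s y))
      rw [h3] at h2
      simp only [ha]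
      change _ = -Gxyy (0, y)
      rw [h2]
      ring
    · rw [← hill]
      exact lineY sy 0 y
    · have := liou 0 y
      simp only [ha, hb]
      linear_combination this
  have key : ∀ x y, kernel a b x y = F x y := by
    intro x y
    have hdy := fun y => lineY smooth x y
    have hdyy : ∀ y, HasDerivAt (fun t => Gy (x, t)) (q y * G (x, y)) y := fun y => by
      rw [← hill]; exact lineY sy x y
    -- The Wronskians of F(x, ·) with b and with a are constant; their values at y = x are the
    -- coordinates of F(x, ·) in the basis.
    have α : ∀ y, G (x, y) * Gy (0, y) - Gy (x, y) * b y = -b x := by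
      intro y
      have hd : ∀ y, HasDerivAt (fun y => G (x, y) * Gy (0, y) - Gy (x, y) * b y) 0 y := by
        intro y
        convert! ((hdy y).mul (basis.snd' y)).sub ((hdyy y).mul (basis.snd y)) using 1
        ring
      rw [eq_of_hasDerivAt_zero hd y x]
      have h0 : G (x, x) = 0 := hF.diag x
      have h1 : Gy (x, x) = 1 := by
        rw [← hF.deriv_diag x]; exact (lineY smooth x x).deriv.symm
      rw [h0, h1]; ring
    have β : ∀ y, a y * Gy (x, y) + Gxy (0, y) * G (x, y) = a x := by
      intro y
      have hd : ∀ y, HasDerivAt (fun y => a y * Gy (x, y) + Gxy (0, y) * G (x, y)) 0 y := by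
        intro y
        have h2 : HasDerivAt (fun y => Gxy (0, y)) (-(q y * a y)) y := by
          convert! (basis.fst' y).neg using 1
          funext y; simp
        convert! ((basis.fst y).mul (hdyy y)).add (h2.mul (hdy y)) using 1
        ring
      rw [eq_of_hasDerivAt_zero hd y x]
      have h0 : G (x, x) = 0 := hF.diag x
      have h1 : Gy (x, x) = 1 := by
        rw [← hF.deriv_diag x]; exact (lineY smooth x x).deriv.symm
      rw [h0, h1]; ring
    have w := basis.wronskian y
    change _ = G (x, y)
    rw [kernel]
    linear_combination -a y * α y - b y * β y + G (x, y) * w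
  have hanti : ∀ x, a (x + T) = -a x := by
    intro x
    have h0 : ∀ s, G (s, x + T) = -G (s, x) := fun s => hF.anti_right s x
    have := (lineX smooth 0 (x + T)).unique
      (((lineX smooth 0 x).neg).congr_of_eventuallyEq (Eventually.of_forall h0))
    exact congrArg Neg.neg this
  obtain ⟨γ, hγ⟩ := basis.exists_projCurve hT hanti (fun x => hF.anti_right 0 x)
    fun x y h1 h2 => by rw [key]; exact (hF.pos x y h1 h2).ne'
  refine ⟨γ, ?_⟩
  funext x y
  rw [← key]
  simp [ProjCurve.frieze, hγ, bracket, kernel]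

/-! ### Projective equivalence and equality of friezes -/

theorem ProjCurve.lift_eq_smul_dir {T : ℝ} (γ : ProjCurve T) (x : ℝ) :
    ∃ r : ℝ, r ≠ 0 ∧ γ.lift x = r • γ.dir x :=
  ⟨_, (inv_pos.2 (Real.sqrt_pos.2 (γ.deriv_pos x))).ne', rfl⟩

theorem ProjCurve.point_eq_smul_iff {T : ℝ} (γ γ' : ProjCurve T)
    (A : SpecialLinearGroup (Fin 2) ℝ) (x : ℝ) :
    γ'.point x = A • γ.point x ↔ ∃ r : ℝ, r • (A.1 *ᵥ γ.lift x) = γ'.lift x := by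
  obtain ⟨r, hr, e⟩ := γ.lift_eq_smul_dir x
  obtain ⟨r', hr', e'⟩ := γ'.lift_eq_smul_dir x
  rw [point, point, Projectivization.smul_mk, Projectivization.mk_eq_mk_iff', e, e',
    show A • γ.dir x = A.1 *ᵥ γ.dir x from rfl, mulVec_smul]
  constructor
  · rintro ⟨s, hs⟩
    refine ⟨r' * s * r⁻¹, ?_⟩
    rw [← hs, smul_smul, smul_smul, inv_mul_cancel_right₀ hr]
  · rintro ⟨s, hs⟩
    refine ⟨r'⁻¹ * s * r, ?_⟩
    have := congrArg (r'⁻¹ • ·) hs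
    simp only [smul_smul, inv_mul_cancel₀ hr', one_smul] at this
    rw [← this, mul_assoc]

/-- The frieze only depends on the projective equivalence class. -/
theorem ProjCurve.frieze_eq_of_equiv {T : ℝ} {γ γ' : ProjCurve T} (h : γ ≈ γ') :
    γ.frieze = γ'.frieze := by
  obtain ⟨A, hA⟩ := h
  have hA' := fun x => (point_eq_smul_iff γ γ' A x).1 (hA x)
  choose l hl using hA'
  have hdet : A.1 0 0 * A.1 1 1 - A.1 0 1 * A.1 1 0 = 1 := by
    have := A.2; rwa [det_fin_two] at this
  have l0 : ∀ x, γ'.lift x 0 = l x * (A.1 0 0 * γ.lift x 0 + A.1 0 1 * γ.lift x 1) := fun x => by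
    rw [← hl]; simp
  have l1 : ∀ x, γ'.lift x 1 = l x * (A.1 1 0 * γ.lift x 0 + A.1 1 1 * γ.lift x 1) := fun x => by
    rw [← hl]; simp
  generalize A.1 0 0 = p, A.1 0 1 = q, A.1 1 0 = r, A.1 1 1 = s at *
  set u : ℝ → ℝ := fun x => p * γ.lift x 0 + q * γ.lift x 1 with hu
  set w : ℝ → ℝ := fun x => r * γ.lift x 0 + s * γ.lift x 1 with hw
  have hud : ∀ x, HasDerivAt u (p * deriv γ.lift x 0 + q * deriv γ.lift x 1) x := fun x =>
    ((γ.hasDerivAt_lift x 0).const_mul p).add ((γ.hasDerivAt_lift x 1).const_mul q)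
  have hwd : ∀ x, HasDerivAt w (r * deriv γ.lift x 0 + s * deriv γ.lift x 1) x := fun x =>
    ((γ.hasDerivAt_lift x 0).const_mul r).add ((γ.hasDerivAt_lift x 1).const_mul s)
  have hW : ∀ x, u x * (r * deriv γ.lift x 0 + s * deriv γ.lift x 1) -
      w x * (p * deriv γ.lift x 0 + q * deriv γ.lift x 1) = 1 := fun x => by
    have := γ.wronskian_lift x
    simp only [hu, hw]
    linear_combination (γ.lift x 0 * deriv γ.lift x 1 - γ.lift x 1 * deriv γ.lift x 0) * hdet + this
  have hne : ∀ x, u x ^ 2 + w x ^ 2 ≠ 0 := by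
    intro x h0
    have hu0 : u x = 0 := by nlinarith [sq_nonneg (u x), sq_nonneg (w x)]
    have hw0 : w x = 0 := by nlinarith [sq_nonneg (u x), sq_nonneg (w x)]
    have := hW x
    simp [hu0, hw0] at this
  -- The factor `l` was chosen point by point; this formula shows that it is differentiable.
  have hle : l = fun x => (γ'.lift x 0 * u x + γ'.lift x 1 * w x) / (u x ^ 2 + w x ^ 2) := by
    funext x
    rw [eq_div_iff (hne x), l0, l1]
    ring
  have hld : ∀ x, DifferentiableAt ℝ l x := by
    intro x
    rw [hle]
    have h1 := (γ'.hasDerivAt_lift x 0).differentiableAt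
    have h2 := (γ'.hasDerivAt_lift x 1).differentiableAt
    have h3 := (hud x).differentiableAt
    have h4 := (hwd x).differentiableAt
    exact ((h1.mul h3).add (h2.mul h4)).div ((h3.pow 2).add (h4.pow 2)) (hne x)
  -- Rescaling a plane curve by `l` multiplies [Γ, Γ'] by l², and both brackets are one. By
  -- connectedness the sign of `l` is then constant, so it cancels in the frieze.
  have hsq : ∀ x, l x ^ 2 = 1 := by
    intro x
    have e0 := (γ'.hasDerivAt_lift x 0).unique
      (((hld x).hasDerivAt.mul (hud x)).congr_of_eventuallyEq (Eventually.of_forall l0))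
    have e1 := (γ'.hasDerivAt_lift x 1).unique
      (((hld x).hasDerivAt.mul (hwd x)).congr_of_eventuallyEq (Eventually.of_forall l1))
    have := γ'.wronskian_lift x
    rw [e0, e1, l0, l1] at this
    linear_combination this - l x ^ 2 * hW x
  have hconst : ∀ x y, l x * l y = 1 := by
    have hc : Continuous l := continuous_iff_continuousAt.2 fun x => (hld x).continuousAt
    rcases isPreconnected_univ.eq_or_eq_neg_of_sq_eq (f := l) (g := fun _ => 1) hc.continuousOn
      continuousOn_const (fun x _ => by simp [hsq]) (fun _ => one_ne_zero) with h | h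
    · intro x y
      rw [h (Set.mem_univ x), h (Set.mem_univ y)]; simp
    · intro x y
      rw [h (Set.mem_univ x), h (Set.mem_univ y)]; simp
  funext x y
  simp only [frieze, bracket, l0, l1]
  linear_combination (-(γ.lift x 0 * γ.lift y 1 - γ.lift x 1 * γ.lift y 0)) *
    ((p * s - q * r) * hconst x y + hdet)

/-- The vectors of γ at 0 and T/2 form a basis because their bracket is positive. The matrix sends
them to the corresponding vectors of γ' and has determinant one since the two brackets agree.
Coordinates in these bases are quotients of frieze values, so the whole curve is sent to the other
one. -/
theorem ProjCurve.equiv_of_frieze_eq {T : ℝ} (hT : 0 < T) {γ γ' : ProjCurve T}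
    (h : γ.frieze = γ'.frieze) : γ ≈ γ' := by
  have hD : 0 < γ.frieze 0 (T / 2) := γ.frieze_pos (by linarith) (by linarith)
  have hF : ∀ x y, γ.frieze x y = γ'.frieze x y := fun x y => by rw [h]
  simp only [frieze, bracket] at hF hD
  have h01 := hF 0 (T / 2)
  set D := γ.lift 0 0 * γ.lift (T / 2) 1 - γ.lift 0 1 * γ.lift (T / 2) 0 with hDdef
  have hD0 := hD.ne'
  refine ⟨⟨!![(γ'.lift 0 0 * γ.lift (T / 2) 1 - γ'.lift (T / 2) 0 * γ.lift 0 1) / D,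
      (γ'.lift (T / 2) 0 * γ.lift 0 0 - γ'.lift 0 0 * γ.lift (T / 2) 0) / D;
      (γ'.lift 0 1 * γ.lift (T / 2) 1 - γ'.lift (T / 2) 1 * γ.lift 0 1) / D,
      (γ'.lift (T / 2) 1 * γ.lift 0 0 - γ'.lift 0 1 * γ.lift (T / 2) 0) / D], ?_⟩, fun x => ?_⟩
  · rw [det_fin_two_of]
    field_simp
    rw [hDdef] at h01 ⊢
    linear_combination (-(γ.lift 0 0 * γ.lift (T / 2) 1 - γ.lift 0 1 * γ.lift (T / 2) 0)) * h01
  · refine (point_eq_smul_iff γ γ' _ x).2 ⟨1, ?_⟩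
    have h0 := hF 0 x
    have h1 := hF x (T / 2)
    ext i
    fin_cases i
    · simp only [one_smul, mulVec, dotProduct, Fin.sum_univ_two, Fin.zero_eta, of_apply, cons_val',
        cons_val_zero, cons_val_one, cons_val_fin_one]
      field_simp
      linear_combination γ'.lift 0 0 * h1 + γ'.lift (T / 2) 0 * h0 - γ'.lift x 0 * h01
    · simp only [one_smul, mulVec, dotProduct, Fin.sum_univ_two, Fin.mk_one, of_apply, cons_val',
        cons_val_zero, cons_val_one, cons_val_fin_one]
      field_simp
      linear_combination γ'.lift 0 1 * h1 + γ'.lift (T / 2) 1 * h0 - γ'.lift x 1 * h01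

/-- `Diff₊(S¹)/PSL₂(ℝ)` is the space of closed continuous friezes. -/
theorem exists_equiv_closedContFrieze {T : ℝ} (hT : 0 < T) :
    ∃ Φ : VirasoroOrbit T ≃ {F : ℝ → ℝ → ℝ // IsClosedContFrieze T F},
      ∀ γ : ProjCurve T, (Φ (Quotient.mk _ γ)).1 = γ.frieze := by
  let f : VirasoroOrbit T → {F : ℝ → ℝ → ℝ // IsClosedContFrieze T F} :=
    Quotient.lift (fun γ => ⟨γ.frieze, γ.isClosedContFrieze⟩)
      fun γ γ' h => Subtype.ext (ProjCurve.frieze_eq_of_equiv h)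
  refine ⟨Equiv.ofBijective f ⟨?_, ?_⟩, fun γ => rfl⟩
  · intro p p'
    induction p using Quotient.inductionOn with | h γ => ?_
    induction p' using Quotient.inductionOn with | h γ' => ?_
    intro h
    exact Quotient.sound (ProjCurve.equiv_of_frieze_eq hT (congrArg Subtype.val h))
  · rintro ⟨F, hF⟩
    obtain ⟨γ, hγ⟩ := hF.exists_projCurve hT
    exact ⟨Quotient.mk _ γ, Subtype.ext hγ⟩

/-! ### Solutions of Hill's equation -/

/-- A locally bounded, locally in time uniformly Lipschitz vector field has global solutions. -/
theorem exists_global_integralCurve {f : ℝ → ℝ → ℝ} (hc : ∀ x, Continuous fun t => f t x)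
    (hf : ∀ N : ℝ, ∃ K : NNReal, ∀ t ∈ Set.Icc (-N) N, LipschitzWith K (f t) ∧ ∀ x, ‖f t x‖ ≤ K)
    (x₀ : ℝ) : ∃ α : ℝ → ℝ, α 0 = x₀ ∧ ∀ t, HasDerivAt α (f t (α t)) t := by
  have hloc : ∀ n : ℕ, ∃ α : ℝ → ℝ, α 0 = x₀ ∧
      ∀ t ∈ Set.Icc (-(n + 1 : ℝ)) (n + 1),
        HasDerivWithinAt α (f t (α t)) (Set.Icc (-(n + 1 : ℝ)) (n + 1)) t := by
    intro n
    have hn : (0 : ℝ) < n + 1 := by positivity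
    obtain ⟨K, hK⟩ := hf (n + 1)
    let t₀ : Set.Icc (-(n + 1 : ℝ)) (n + 1) := ⟨0, by constructor <;> linarith⟩
    have : IsPicardLindelof f t₀ x₀ (K * (n + 1)) 0 K K := by
      refine ⟨fun t ht => (hK t ht).1.lipschitzOnWith, fun x _ => (hc x).continuousOn,
        fun t ht x _ => (hK t ht).2 x, ?_⟩
      simp [t₀]
    obtain ⟨α, h0, hα⟩ := this.exists_eq_forall_mem_Icc_hasDerivWithinAt₀
    exact ⟨α, h0, hα⟩
  choose α h0 hα using hloc
  have hderiv : ∀ n : ℕ, ∀ t ∈ Set.Ioo (-(n + 1 : ℝ)) (n + 1),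
      HasDerivAt (α n) (f t (α n t)) t := fun n t ht =>
    (hα n t ⟨ht.1.le, ht.2.le⟩).hasDerivAt (Icc_mem_nhds ht.1 ht.2)
  have hagree : ∀ m n : ℕ, m ≤ n → ∀ t ∈ Set.Icc (-(m + 1 : ℝ)) (m + 1), α m t = α n t := by
    intro m n hmn
    obtain ⟨K, hK⟩ := hf (m + 1)
    have hle : (m : ℝ) ≤ n := by exact_mod_cast hmn
    have hm : (0 : ℝ) < m + 1 := by positivity
    refine ODE_solution_unique_of_mem_Icc (v := f) (s := fun _ => Set.univ) (K := K) (t₀ := 0)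
      (fun t ht => (hK t ⟨ht.1.le, ht.2.le⟩).1.lipschitzOnWith) (by constructor <;> linarith)
      (fun t ht => (hα m t ht).continuousWithinAt) (hderiv m) (fun _ _ => Set.mem_univ _)
      (fun t ht => ?_) (fun t ht => hderiv n t ?_) (fun _ _ => Set.mem_univ _)
      ((h0 m).trans (h0 n).symm)
    · have ht' : t ∈ Set.Icc (-(n + 1 : ℝ)) (n + 1) := ⟨by linarith [ht.1], by linarith [ht.2]⟩
      exact (hα n t ht').continuousWithinAt.mono
        (Set.Icc_subset_Icc (by linarith) (by linarith))
    · exact ⟨by linarith [ht.1], by linarith [ht.2]⟩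
  -- The solution with index m lives on [-(m + 1), m + 1]. The extra unit keeps t inside the domain
  -- of the solution with index ⌈|t|⌉, and near t the glued function agrees with a single solution.
  refine ⟨fun t => α ⌈|t|⌉₊ t, by simp [h0], fun t => ?_⟩
  set n := ⌈|t|⌉₊ + 1 with hn
  have hmem : t ∈ Set.Ioo (-(n : ℝ)) n := by
    have := Nat.le_ceil |t|
    have h1 : (n : ℝ) = ⌈|t|⌉₊ + 1 := by push_cast [hn]; ring
    exact abs_lt.1 (by linarith)
  have heq : ∀ s ∈ Set.Ioo (-(n : ℝ)) n, α ⌈|s|⌉₊ s = α n s := by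
    intro s hs
    have hsn : |s| ≤ n := (abs_lt.2 hs).le
    have := Nat.le_ceil |s|
    exact hagree _ _ (Nat.ceil_le.2 hsn) s (abs_le.1 (by linarith))
  have hd := hderiv n t ⟨by linarith [hmem.1], by linarith [hmem.2]⟩
  rw [← heq t hmem] at hd
  refine hd.congr_of_eventuallyEq ?_
  filter_upwards [Ioo_mem_nhds hmem.1 hmem.2] with s hs using heq s hs

/-- Global solutions of Hill's equation, by polar coordinates in the phase plane. -/
theorem exists_hill_solution {q : ℝ → ℝ} (hq : Continuous q) (θ₀ : ℝ) :
    ∃ y y' : ℝ → ℝ, y 0 = Real.cos θ₀ ∧ y' 0 = Real.sin θ₀ ∧ (∀ x, HasDerivAt y (y' x) x) ∧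
      ∀ x, HasDerivAt y' (q x * y x) x := by
  -- With y = r cos θ and y' = r sin θ the equation becomes θ' = q cos² θ - sin² θ and r'/r = (1 +
  -- q) sin θ cos θ. The first is bounded and Lipschitz in θ on bounded times; the second is solved
  -- by an integral.
  obtain ⟨θ, hθ0, hθ⟩ := exists_global_integralCurve
    (f := fun t x => q t * Real.cos x ^ 2 - Real.sin x ^ 2) (fun x => by fun_prop) (fun N => by
      obtain ⟨K, hK⟩ := isCompact_Icc.exists_bound_of_continuousOn (s := Set.Icc (-N) N)
        hq.continuousOn
      have hK0 : 0 ≤ |K| := abs_nonneg K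
      have hK1 : 0 ≤ 2 * (|K| + 1) := by positivity
      refine ⟨Real.toNNReal (2 * (|K| + 1)), fun t ht => ?_⟩
      have hqt : |q t| ≤ |K| := (hK t ht).trans (le_abs_self K)
      constructor
      · refine lipschitzWith_of_nnnorm_deriv_le (fun x => by fun_prop) fun x => ?_
        have hd : HasDerivAt (fun x => q t * Real.cos x ^ 2 - Real.sin x ^ 2)
            (-(2 * (q t + 1) * Real.sin x * Real.cos x)) x := by
          convert! (((Real.hasDerivAt_cos x).pow 2).const_mul (q t)).sub
            ((Real.hasDerivAt_sin x).pow 2) using 1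
          norm_num
          ring
        rw [hd.deriv, ← NNReal.coe_le_coe, coe_nnnorm, Real.coe_toNNReal _ hK1, Real.norm_eq_abs, abs_neg, abs_mul, abs_mul,
          abs_mul, abs_two]
        have h1 := Real.abs_sin_le_one x
        have h2 := Real.abs_cos_le_one x
        have h3 : |q t + 1| ≤ |K| + 1 := (abs_add_le _ _).trans (by simpa using hqt)
        calc 2 * |q t + 1| * |Real.sin x| * |Real.cos x| ≤ 2 * (|K| + 1) * 1 * 1 := by gcongr
          _ = 2 * (|K| + 1) := by ring
      · intro x
        have h1 := Real.sin_sq_add_cos_sq x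
        have h2 := sq_nonneg (Real.sin x)
        have h3 := sq_nonneg (Real.cos x)
        have h4 := abs_le.1 hqt
        rw [Real.coe_toNNReal _ hK1, Real.norm_eq_abs, abs_le]
        constructor <;> nlinarith) θ₀
  have hθc : Continuous θ := continuous_iff_continuousAt.2 fun x => (hθ x).continuousAt
  set g : ℝ → ℝ := fun t => (1 + q t) * (Real.sin (θ t) * Real.cos (θ t)) with hg
  have hgc : Continuous g := by fun_prop
  set r : ℝ → ℝ := fun x => Real.exp (∫ t in (0 : ℝ)..x, g t) with hr
  have hrd : ∀ x, HasDerivAt r (r x * g x) x := fun x =>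
    (intervalIntegral.integral_hasDerivAt_right (hgc.intervalIntegrable _ _)
      (hgc.stronglyMeasurableAtFilter _ _) hgc.continuousAt).exp
  have hr0 : r 0 = 1 := by simp [hr]
  refine ⟨fun x => r x * Real.cos (θ x), fun x => r x * Real.sin (θ x), by simp [hr0, hθ0],
    by simp [hr0, hθ0], fun x => ?_, fun x => ?_⟩
  · convert! (hrd x).mul (hθ x).cos using 1
    have := Real.sin_sq_add_cos_sq (θ x)
    simp only [hg]
    linear_combination (- r x * Real.sin (θ x)) * this
  · convert! (hrd x).mul (hθ x).sin using 1
    have := Real.sin_sq_add_cos_sq (θ x)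
    simp only [hg]
    linear_combination (- q x * r x * Real.cos (θ x)) * this

theorem exists_hillBasis {q : ℝ → ℝ} (hq : ContDiff ℝ ∞ q) :
    ∃ a b a' b' : ℝ → ℝ, HillBasis q a b a' b' := by
  obtain ⟨a, a', ha0, ha0', ha, ha'⟩ := exists_hill_solution hq.continuous 0
  obtain ⟨b, b', hb0, hb0', hb, hb'⟩ := exists_hill_solution hq.continuous (Real.pi / 2)
  refine ⟨a, b, a', b', hq, ha, ha', hb, hb', fun x => ?_⟩
  have hd : ∀ x, HasDerivAt (fun x => a x * b' x - b x * a' x) 0 x := fun x => by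
    convert! ((ha x).mul (hb' x)).sub ((hb x).mul (ha' x)) using 1
    ring
  rw [eq_of_hasDerivAt_zero hd x 0, ha0, ha0', hb0, hb0']
  simp

/-! ### Algebra of closed friezes -/

/-- The coefficient of u (j - 1) is a unit, so the recurrence runs in both directions. -/
theorem eq_zero_of_recurrence {c u : ℤ → ℝ} (h : ∀ j, u (j + 1) = c j * u j - u (j - 1)) {i : ℤ}
    (h0 : u i = 0) (h1 : u (i + 1) = 0) (j : ℤ) : u j = 0 := by
  have key : ∀ k : ℤ, u (i + k) = 0 ∧ u (i + k + 1) = 0 := by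
    intro k
    induction k using Int.induction_on with
    | zero => simpa using ⟨h0, h1⟩
    | succ k ih =>
      rw [← add_assoc]
      refine ⟨ih.2, ?_⟩
      rw [h, ih.2, show i + (k : ℤ) + 1 - 1 = i + k by ring, ih.1]
      ring
    | pred k ih =>
      have := h (i + -(k : ℤ))
      rw [ih.1, ih.2] at this
      rw [show i + (-(k : ℤ) - 1) = i + -(k : ℤ) - 1 by ring]
      refine ⟨by linarith, ?_⟩
      rw [sub_add_cancel]
      exact ih.1
  simpa using (key (j - i)).1

namespace IsClosedFrieze

variable {n : ℕ} {v : ℤ → ℤ → ℝ}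

/-- Both sides solve the same recurrence in j and agree at j = i and, by the frieze rule, at j = i +
1. Two adjacent diagonals are thus the coordinates of a plane polygon whose brackets are all the
entries. -/
theorem eq_det (hv : IsClosedFrieze n v) (m i j : ℤ) :
    v i j = v m i * v (m + 1) j - v (m + 1) i * v m j := by
  have := eq_zero_of_recurrence (c := fun j => v (j - 1) (j + 1))
    (u := fun j => v i j - (v m i * v (m + 1) j - v (m + 1) i * v m j)) (i := i)
    (fun j => by
      rw [hv.recurrence i j, hv.recurrence m j, hv.recurrence (m + 1) j]
      ring)
    (by rw [hv.zero_row]; ring)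
    (by rw [hv.one_row]; linarith [hv.rule m i]) j
  linarith

theorem skew (hv : IsClosedFrieze n v) (i j : ℤ) : v j i = -v i j := by
  rw [hv.eq_det 0 i j, hv.eq_det 0 j i]; ring

theorem glide (hv : IsClosedFrieze n v) (i j : ℤ) : v j (i + n) = v i j := by
  rw [hv.anti_right, hv.skew]; ring

theorem periodic (hv : IsClosedFrieze n v) (i j : ℤ) : v (i + n) (j + n) = v i j := by
  rw [hv.anti_right, hv.anti_left]; ring

end IsClosedFrieze

/-- A closed polygon in the plane with unit brackets of consecutive vertices is a frieze. -/
theorem isClosedFrieze_of_polygon {n : ℕ} {p s : ℤ → ℝ} (hp : ∀ j, p (j + n) = -p j)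
    (hs : ∀ j, s (j + n) = -s j) (h : ∀ j, p j * s (j + 1) - s j * p (j + 1) = 1) :
    IsClosedFrieze n fun i j => p i * s j - s i * p j := by
  refine ⟨fun i => by ring, h, fun i j => ?_, fun i j => ?_, fun i j => by rw [hp, hs]; ring,
    fun i j => by rw [hp, hs]; ring⟩
  · linear_combination (p j * s (j + 1) - s j * p (j + 1)) * h i + h j
  · have h1 := h (j - 1)
    rw [sub_add_cancel] at h1
    have h2 := h j
    linear_combination (-(p i * s (j + 1) - s i * p (j + 1))) * h1 -
      (p i * s (j - 1) - s i * p (j - 1)) * h2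

/-! ### Tangent vectors -/

theorem IsFriezeTangent.isClosedFrieze {n : ℕ} {v w : ℤ → ℤ → ℝ} (h : IsFriezeTangent n v w) :
    IsClosedFrieze n v := by
  obtain ⟨u, rfl, hu, -⟩ := h
  exact hu.self_of_nhds

/-- The linearized frieze equations. -/
structure IsLinearTangent (n : ℕ) (v w : ℤ → ℤ → ℝ) : Prop where
  frieze : IsClosedFrieze n v
  zero_row : ∀ i, w i i = 0
  one_row : ∀ i, w i (i + 1) = 0
  recurrence : ∀ i j, w i (j + 1) =
    w (j - 1) (j + 1) * v i j + v (j - 1) (j + 1) * w i j - w i (j - 1)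
  anti_left : ∀ i j, w (i + n) j = -w i j
  anti_right : ∀ i j, w i (j + n) = -w i j

theorem IsFriezeTangent.isLinearTangent {n : ℕ} {v w : ℤ → ℤ → ℝ} (h : IsFriezeTangent n v w) :
    IsLinearTangent n v w := by
  have hv := h.isClosedFrieze
  obtain ⟨u, rfl, hu, hd⟩ := h
  refine ⟨hv, fun i => ?_, fun i => ?_, fun i j => ?_, fun i j => ?_, fun i j => ?_⟩
  · exact (hd i i).unique ((hasDerivAt_const 0 (0 : ℝ)).congr_of_eventuallyEq
      (hu.mono fun t ht => ht.zero_row i))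
  · exact (hd i (i + 1)).unique ((hasDerivAt_const 0 (1 : ℝ)).congr_of_eventuallyEq
      (hu.mono fun t ht => ht.one_row i))
  · exact (hd i (j + 1)).unique ((((hd (j - 1) (j + 1)).mul (hd i j)).sub
      (hd i (j - 1))).congr_of_eventuallyEq (hu.mono fun t ht => ht.recurrence i j))
  · exact (hd (i + n) j).unique ((hd i j).neg.congr_of_eventuallyEq
      (hu.mono fun t ht => ht.anti_left i j))
  · exact (hd i (j + n)).unique ((hd i j).neg.congr_of_eventuallyEq
      (hu.mono fun t ht => ht.anti_right i j))

/-- The solution of the linearized recurrence by variation of constants. -/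
theorem IsClosedFrieze.duhamel_recurrence {n : ℕ} {v : ℤ → ℤ → ℝ} (hv : IsClosedFrieze n v)
    (d : ℤ → ℝ) (i : ℤ) (k : ℕ) :
    ∑ l ∈ Finset.range (k + 2), d (i + l) * v i (i + l) * v (i + l) (i + k + 2) =
      d (i + k + 1) * v i (i + k + 1) + v (i + k) (i + k + 2) *
        ∑ l ∈ Finset.range (k + 1), d (i + l) * v i (i + l) * v (i + l) (i + k + 1) -
        ∑ l ∈ Finset.range k, d (i + l) * v i (i + l) * v (i + l) (i + k) := by
  have hr : ∀ a, v a (i + k + 2) = v (i + k) (i + k + 2) * v a (i + k + 1) - v a (i + k) := by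
    intro a
    have := hv.recurrence a (i + k + 1)
    rwa [add_sub_cancel_right, show i + (k : ℤ) + 1 + 1 = i + k + 2 by ring] at this
  have e : ∑ l ∈ Finset.range (k + 1), d (i + l) * v i (i + l) * v (i + l) (i + k) =
      ∑ l ∈ Finset.range k, d (i + l) * v i (i + l) * v (i + l) (i + k) := by
    rw [Finset.sum_range_succ, hv.zero_row]; ring
  have e1 : v (i + ((k + 1 : ℕ) : ℤ)) (i + k + 2) = 1 := by
    have := hv.one_row (i + k + 1)
    rw [← this]; congr 1 <;> push_cast <;> ring
  rw [Finset.sum_range_succ, e1, ← e, Finset.mul_sum, add_sub_assoc, ← Finset.sum_sub_distrib,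
    add_comm]
  congr 1
  · push_cast; rw [mul_one, ← add_assoc]
  · refine Finset.sum_congr rfl fun l _ => ?_
    rw [hr]; ring

/-- Both sides satisfy the inhomogeneous recurrence with source d_j v_{i,j}, for which the frieze
itself is the Green function, and both vanish at the first two indices. -/
theorem IsLinearTangent.eq_sum {n : ℕ} {v w : ℤ → ℤ → ℝ} (h : IsLinearTangent n v w) (i : ℤ)
    (k : ℕ) : w i (i + k) = ∑ l ∈ Finset.range k,
      w (i + l - 1) (i + l + 1) * v i (i + l) * v (i + l) (i + k) := by
  induction k using Nat.twoStepInduction with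
  | zero => simp [h.zero_row]
  | one => simp [h.one_row, h.frieze.zero_row]
  | more k ih0 ih1 =>
    have h1 := h.recurrence i (i + k + 1)
    have h2 := h.frieze.duhamel_recurrence (fun j => w (j - 1) (j + 1)) i k
    push_cast at ih1 h2 ⊢
    rw [← add_assoc] at ih1
    rw [show i + ((k : ℤ) + 2) = i + k + 2 by ring, h2, ← ih0, ← ih1]
    rw [add_sub_cancel_right, show i + (k : ℤ) + 1 + 1 = i + k + 2 by ring] at h1
    rw [h1, add_sub_cancel_right, show i + (k : ℤ) + 1 + 1 = i + k + 2 by ring]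

theorem sum_range_shift_of_periodic {n : ℕ} {f : ℤ → ℝ} {m : ℤ} (hf : f (m + n) = f m) :
    ∑ l ∈ Finset.range n, f (m + 1 + l) = ∑ l ∈ Finset.range n, f (m + l) := by
  have h1 := Finset.sum_range_succ (fun l : ℕ => f (m + l)) n
  have h2 := Finset.sum_range_succ' (fun l : ℕ => f (m + l)) n
  rw [h1] at h2
  simp only [hf, Nat.cast_zero, add_zero, add_left_inj] at h2
  rw [h2]
  refine Finset.sum_congr rfl fun l _ => ?_
  push_cast
  congr 1
  ring

theorem IsLinearTangent.periodic {n : ℕ} {v w : ℤ → ℤ → ℝ} (h : IsLinearTangent n v w)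
    (i j : ℤ) : w (i + n) (j + n) = w i j := by
  rw [h.anti_right, h.anti_left]; ring

/-- The velocity of the potential is orthogonal to the products of solutions. -/
theorem IsLinearTangent.closure {n : ℕ} {v w : ℤ → ℤ → ℝ} (h : IsLinearTangent n v w)
    (m i j : ℤ) : ∑ l ∈ Finset.range n,
      w (m + l - 1) (m + l + 1) * v i (m + l) * v j (m + l) = 0 := by
  have hv := h.frieze
  -- Antiperiodicity gives w m (m + n) = 0. In the variation of constants formula for this entry the
  -- glide symmetry turns the second factor into the first.
  have hP : ∀ m : ℤ, ∑ l ∈ Finset.range n,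
      w (m + l - 1) (m + l + 1) * (v m (m + l) * v m (m + l)) = 0 := by
    intro m
    have := h.eq_sum m n
    rw [h.anti_right, h.zero_row, neg_zero] at this
    rw [this]
    refine Finset.sum_congr rfl fun l _ => ?_
    rw [hv.glide m]; ring
  -- The same for w m (m + 1 + n) = 0; the extra summand l = n drops out because v m (m + n) = 0.
  have hQ : ∑ l ∈ Finset.range n,
      w (m + l - 1) (m + l + 1) * (v m (m + l) * v (m + 1) (m + l)) = 0 := by
    have := h.eq_sum m (n + 1)
    rw [show m + ((n + 1 : ℕ) : ℤ) = m + 1 + n by push_cast; ring, h.anti_right, h.one_row,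
      neg_zero, Finset.sum_range_succ, hv.anti_right m m, hv.zero_row, neg_zero, mul_zero,
      zero_mul, add_zero] at this
    rw [this]
    refine Finset.sum_congr rfl fun l _ => ?_
    rw [hv.glide (m + 1)]; ring
  have hS : ∑ l ∈ Finset.range n,
      w (m + l - 1) (m + l + 1) * (v (m + 1) (m + l) * v (m + 1) (m + l)) = 0 := by
    rw [← sum_range_shift_of_periodic
      (f := fun k => w (k - 1) (k + 1) * (v (m + 1) k * v (m + 1) k))]
    · exact hP (m + 1)
    · rw [hv.anti_right, show m + (n : ℤ) - 1 = m - 1 + n by ring,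
        show m + (n : ℤ) + 1 = m + 1 + n by ring, h.periodic]
      ring
  -- Diagonals m and m + 1 span all diagonals, so the three relations above suffice.
  have e : ∀ l : ℕ, w (m + l - 1) (m + l + 1) * v i (m + l) * v j (m + l) =
      v m i * v m j *
        (w (m + l - 1) (m + l + 1) * (v (m + 1) (m + l) * v (m + 1) (m + l))) -
      (v m i * v (m + 1) j + v (m + 1) i * v m j) *
        (w (m + l - 1) (m + l + 1) * (v m (m + l) * v (m + 1) (m + l))) +
      v (m + 1) i * v (m + 1) j *
        (w (m + l - 1) (m + l + 1) * (v m (m + l) * v m (m + l))) := by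
    intro l
    rw [hv.eq_det m i, hv.eq_det m j]; ring
  simp only [e, Finset.sum_add_distrib, Finset.sum_sub_distrib, ← Finset.mul_sum, hP, hQ, hS]
  ring

/-! ### The cluster form as a double sum -/

section DoubleSum

variable (v s d d' : ℕ → ℝ)

/-- Summation by parts for the cluster form. -/
theorem sum_cluster_terms {n : ℕ} (hv0 : v 0 = 0) (hv : ∀ i, 0 < i → i < n → v i ≠ 0)
    (hn : 2 ≤ n)
    (hP : ∑ k ∈ Finset.range n, d k * v k ^ 2 = 0)
    (hP' : ∑ k ∈ Finset.range n, d' k * v k ^ 2 = 0)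
    (hQ : ∑ k ∈ Finset.range n, d k * (v k * s k) = 0)
    (w w' : ℕ → ℝ)
    (hw : ∀ i, w i = s i * ∑ k ∈ Finset.range i, d k * v k ^ 2 -
      v i * ∑ k ∈ Finset.range i, d k * (v k * s k))
    (hw' : ∀ i, w' i = s i * ∑ k ∈ Finset.range i, d' k * v k ^ 2 -
      v i * ∑ k ∈ Finset.range i, d' k * (v k * s k)) :
    ∑ i ∈ Finset.Ico 1 (n - 1), (w i * w' (i + 1) - w (i + 1) * w' i) / (v i * v (i + 1)) =
      ∑ a ∈ Finset.range n, d a * ∑ k ∈ Finset.range a, d' k * (v k * s a - s k * v a) ^ 2 := by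
  set P : ℕ → ℝ := fun i => ∑ k ∈ Finset.range i, d k * v k ^ 2 with hPd
  set Q : ℕ → ℝ := fun i => ∑ k ∈ Finset.range i, d k * (v k * s k) with hQd
  set P' : ℕ → ℝ := fun i => ∑ k ∈ Finset.range i, d' k * v k ^ 2 with hPd'
  set Q' : ℕ → ℝ := fun i => ∑ k ∈ Finset.range i, d' k * (v k * s k) with hQd'
  set S' : ℕ → ℝ := fun i => ∑ k ∈ Finset.range i, d' k * s k ^ 2 with hSd'
  have sP : ∀ i, P (i + 1) = P i + d i * v i ^ 2 := fun i => Finset.sum_range_succ _ _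
  have sQ : ∀ i, Q (i + 1) = Q i + d i * (v i * s i) := fun i => Finset.sum_range_succ _ _
  have sP' : ∀ i, P' (i + 1) = P' i + d' i * v i ^ 2 := fun i => Finset.sum_range_succ _ _
  have sQ' : ∀ i, Q' (i + 1) = Q' i + d' i * (v i * s i) := fun i => Finset.sum_range_succ _ _
  have sS' : ∀ i, S' (i + 1) = S' i + d' i * s i ^ 2 := fun i => Finset.sum_range_succ _ _
  change ∀ i, w i = s i * P i - v i * Q i at hw
  change ∀ i, w' i = s i * P' i - v i * Q' i at hw'
  set E : ℕ → ℝ := fun i => d i * (v i * s i * Q' i - s i ^ 2 * P' i) -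
    d' i * (v i * s i * Q i - s i ^ 2 * P i) with hE
  have inner : ∀ a, ∑ k ∈ Finset.range a, d' k * (v k * s a - s k * v a) ^ 2 =
      s a ^ 2 * P' a - 2 * (v a * s a) * Q' a + v a ^ 2 * S' a := by
    intro a
    simp only [hPd', hQd', hSd', Finset.mul_sum]
    rw [← Finset.sum_sub_distrib, ← Finset.sum_add_distrib]
    exact Finset.sum_congr rfl fun k _ => by ring
  -- With z = w/v = (s/v)P - Q the summand is z_i z'_{i+1} - z_{i+1} z'_i. Summation by parts leaves
  -- a boundary term at N and the terms `E`; nothing remains at the lower end since v 0 = 0.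
  have part : ∀ N, 1 ≤ N → N < n →
      ∑ i ∈ Finset.Ico 1 N, (w i * w' (i + 1) - w (i + 1) * w' i) / (v i * v (i + 1)) =
        s N / v N * (Q' N * P N - Q N * P' N) - ∑ i ∈ Finset.range N, E i := by
    intro N hN
    induction N, hN using Nat.le_induction with
    | base => intro _; simp [hPd, hQd, hPd', hQd', hE, hv0]
    | succ N hN ih =>
      intro hlt
      have h1 := hv N (by omega) (by omega)
      have h2 := hv (N + 1) (by omega) (by omega)
      rw [Finset.sum_Ico_succ_top hN, ih (by omega), Finset.sum_range_succ, hw, hw', hw, hw', sP, sQ,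
        sP', sQ']
      simp only [hE]
      field_simp
      ring
  -- A second telescoping compares `E` with the expanded double sum; its right side vanishes at n
  -- because P and Q do.
  have tele : ∀ N, ∑ i ∈ Finset.range N, E i + ∑ a ∈ Finset.range N, d a *
      (s a ^ 2 * P' a - 2 * (v a * s a) * Q' a + v a ^ 2 * S' a) = P N * S' N - Q N * Q' N := by
    intro N
    induction N with
    | zero => simp [hPd, hQd, hPd', hQd', hSd']
    | succ N ih =>
      rw [Finset.sum_range_succ, Finset.sum_range_succ, sP, sQ, sQ', sS']
      simp only [hE] at ih ⊢
      linear_combination ih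
  obtain ⟨N, rfl⟩ : ∃ N, n = N + 1 := ⟨n - 1, by omega⟩
  -- Since P and P' vanish at n = N + 1, the boundary term at n - 1 is exactly the missing last
  -- summand of the sum of `E`.
  have hlast : s N / v N * (Q' N * P N - Q N * P' N) = -E N := by
    have h1 := hv N (by omega) (by omega)
    change P (N + 1) = 0 at hP
    change P' (N + 1) = 0 at hP'
    rw [sP] at hP
    rw [sP'] at hP'
    simp only [hE]
    field_simp
    linear_combination (s N * Q' N + v N * s N ^ 2 * d' N) * hP -
      (s N * Q N + v N * s N ^ 2 * d N) * hP'
  have hfull := tele (N + 1)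
  rw [show P (N + 1) = 0 from hP, show Q (N + 1) = 0 from hQ, Finset.sum_range_succ] at hfull
  rw [show N + 1 - 1 = N from rfl, part N (by omega) (by omega), hlast]
  simp only [inner]
  linarith

end DoubleSum

/-- Splitting v (m + k) (m + i) by diagonals m and m + 1 puts the variation of constants formula
into the separated form needed for `sum_cluster_terms`. That sum has one term more at each end than
the cluster form; these vanish because the entries of the diagonal at distances 1 and n - 1 do not
move. -/
theorem clusterForm_eq_double_sum {n : ℕ} {v w w' : ℤ → ℤ → ℝ} (h : IsLinearTangent n v w)
    (h' : IsLinearTangent n v w') (m : ℤ) (hn : 4 ≤ n)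
    (hv : ∀ l : ℕ, 0 < l → l < n → v m (m + l) ≠ 0) :
    clusterForm n m v w w' = ∑ a ∈ Finset.range n, w (m + a - 1) (m + a + 1) *
      ∑ k ∈ Finset.range a, w' (m + k - 1) (m + k + 1) * v (m + k) (m + a) ^ 2 := by
  have hf := h.frieze
  have hsum : ∀ {w : ℤ → ℤ → ℝ}, IsLinearTangent n v w → ∀ i : ℕ, w m (m + i) =
      v (m + 1) (m + i) * ∑ k ∈ Finset.range i,
        w (m + k - 1) (m + k + 1) * v m (m + k) ^ 2 -
      v m (m + i) * ∑ k ∈ Finset.range i,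
        w (m + k - 1) (m + k + 1) * (v m (m + k) * v (m + 1) (m + k)) := by
    intro w h i
    rw [h.eq_sum, Finset.mul_sum, Finset.mul_sum, ← Finset.sum_sub_distrib]
    refine Finset.sum_congr rfl fun k _ => ?_
    rw [hf.eq_det m (m + k) (m + i)]
    ring
  have key := sum_cluster_terms (fun i => v m (m + i)) (fun i => v (m + 1) (m + i))
    (fun i => w (m + i - 1) (m + i + 1)) (fun i => w' (m + i - 1) (m + i + 1)) (n := n)
    (by simp [hf.zero_row]) hv (by omega)
    (by rw [← h.closure m m m]; exact Finset.sum_congr rfl fun k _ => by ring)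
    (by rw [← h'.closure m m m]; exact Finset.sum_congr rfl fun k _ => by ring)
    (by rw [← h.closure m m (m + 1)]; exact Finset.sum_congr rfl fun k _ => by ring)
    (fun i => w m (m + i)) (fun i => w' m (m + i)) (hsum h) (hsum h')
  have hr : ∑ a ∈ Finset.range n, w (m + a - 1) (m + a + 1) *
      ∑ k ∈ Finset.range a, w' (m + k - 1) (m + k + 1) * v (m + k) (m + a) ^ 2 =
      ∑ a ∈ Finset.range n, w (m + a - 1) (m + a + 1) *
      ∑ k ∈ Finset.range a, w' (m + k - 1) (m + k + 1) *
        (v m (m + k) * v (m + 1) (m + a) - v (m + 1) (m + k) * v m (m + a)) ^ 2 := by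
    refine Finset.sum_congr rfl fun a _ => ?_
    congr 1
    exact Finset.sum_congr rfl fun k _ => by rw [← hf.eq_det]
  rw [hr, ← key]
  obtain ⟨N, rfl⟩ : ∃ N, n = N + 4 := ⟨n - 4, by omega⟩
  have hlast : ∀ {w : ℤ → ℤ → ℝ}, IsLinearTangent (N + 4) v w →
      w m (m + ((N + 3 : ℕ) : ℤ)) = 0 := by
    intro w h
    rw [show m + ((N + 3 : ℕ) : ℤ) = m - 1 + ((N + 4 : ℕ) : ℤ) by push_cast; ring, h.anti_right]
    have := h.recurrence m m
    rw [h.one_row, h.frieze.zero_row, h.zero_row] at this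
    linarith
  rw [show N + 4 - 1 = N + 2 + 1 by omega, Finset.sum_Ico_succ_top (by omega),
    Finset.sum_eq_sum_Ico_succ_bot (by omega)]
  have e1 : ∀ {w : ℤ → ℤ → ℝ}, IsLinearTangent (N + 4) v w → w m (m + ((1 : ℕ) : ℤ)) = 0 :=
    fun h => by simpa using h.one_row m
  simp only [e1 h, e1 h', show N + 2 + 1 = N + 3 from rfl, hlast h, hlast h']
  simp only [zero_mul, mul_zero, sub_zero, zero_div, zero_add, add_zero]
  rw [clusterForm, show N + 4 - 4 = N by omega, Finset.sum_Ico_eq_sum_range,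
    ← Finset.Ico_add_one_right_eq_Icc, Finset.sum_Ico_eq_sum_range]
  refine Finset.sum_congr (by congr 1) fun i _ => ?_
  have c1 : m + 1 + ((1 + i : ℕ) : ℤ) = m + ((1 + 1 + i : ℕ) : ℤ) := by push_cast; ring
  have c2 : m + 2 + ((1 + i : ℕ) : ℤ) = m + ((1 + 1 + i + 1 : ℕ) : ℤ) := by push_cast; ring
  rw [c1, c2]

/-- The double sum does not depend on the base point. -/
theorem double_sum_shift {n : ℕ} {v w w' : ℤ → ℤ → ℝ} (h : IsLinearTangent n v w)
    (h' : IsLinearTangent n v w') (m : ℤ) :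
    ∑ a ∈ Finset.range n, w (m + 1 + a - 1) (m + 1 + a + 1) *
      ∑ k ∈ Finset.range a, w' (m + 1 + k - 1) (m + 1 + k + 1) * v (m + 1 + k) (m + 1 + a) ^ 2 =
    ∑ a ∈ Finset.range n, w (m + a - 1) (m + a + 1) *
      ∑ k ∈ Finset.range a, w' (m + k - 1) (m + k + 1) * v (m + k) (m + a) ^ 2 := by
  have hf := h.frieze
  rcases n with _ | N
  · simp
  set f : ℤ → ℤ → ℝ := fun k a =>
    w (m + a - 1) (m + a + 1) * (w' (m + k - 1) (m + k + 1) * v (m + k) (m + a) ^ 2) with hfd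
  have hL : ∑ a ∈ Finset.range (N + 1), w (m + 1 + a - 1) (m + 1 + a + 1) *
      ∑ k ∈ Finset.range a, w' (m + 1 + k - 1) (m + 1 + k + 1) *
        v (m + 1 + k) (m + 1 + a) ^ 2 =
      ∑ a ∈ Finset.range (N + 1), ∑ k ∈ Finset.range a, f (k + 1) (a + 1) := by
    refine Finset.sum_congr rfl fun a _ => ?_
    rw [Finset.mul_sum]
    refine Finset.sum_congr rfl fun k _ => ?_
    simp only [hfd, show m + ((a : ℤ) + 1) = m + 1 + a by ring,
      show m + ((k : ℤ) + 1) = m + 1 + k by ring]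
  have hR : ∑ a ∈ Finset.range (N + 1), w (m + a - 1) (m + a + 1) *
      ∑ k ∈ Finset.range a, w' (m + k - 1) (m + k + 1) * v (m + k) (m + a) ^ 2 =
      ∑ a ∈ Finset.range (N + 1), ∑ k ∈ Finset.range a, f k a := by
    refine Finset.sum_congr rfl fun a _ => ?_
    rw [Finset.mul_sum]
  -- Moving the base point by one removes the pairs containing 0 and adds those containing N + 1.
  -- Both groups sum to zero by the closure relations.
  have z1 : ∑ a ∈ Finset.range (N + 1), f 0 a = 0 := by
    have := h.closure m m m
    simp only [hfd, add_zero]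
    calc _ = w' (m - 1) (m + 1) * ∑ l ∈ Finset.range (N + 1),
          w (m + l - 1) (m + l + 1) * v m (m + l) * v m (m + l) := by
            rw [Finset.mul_sum]; exact Finset.sum_congr rfl fun l _ => by ring
      _ = 0 := by rw [this, mul_zero]
  have z2 : ∑ k ∈ Finset.range (N + 1), f (k + 1) (N + 1) = 0 := by
    have := h'.closure (m + 1) (m + N + 1) (m + N + 1)
    simp only [hfd]
    calc _ = w (m + (N + 1) - 1) (m + (N + 1) + 1) * ∑ l ∈ Finset.range (N + 1),
          w' (m + 1 + l - 1) (m + 1 + l + 1) * v (m + N + 1) (m + 1 + l) *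
            v (m + N + 1) (m + 1 + l) := by
            rw [Finset.mul_sum]
            refine Finset.sum_congr rfl fun l _ => ?_
            rw [show m + ((l : ℤ) + 1) = m + 1 + l by ring, ← add_assoc m (N : ℤ) 1,
              hf.skew (m + N + 1) (m + 1 + l)]
            ring
      _ = 0 := by rw [this, mul_zero]
  have f0 : ∀ a : ℤ, f a a = 0 := fun a => by simp [hfd, hf.zero_row]
  rw [hL, hR, Finset.sum_range_succ, Finset.sum_range_succ']
  rw [Finset.sum_range_succ, f0, add_zero] at z2
  simp only [Finset.range_zero, Finset.sum_empty, add_zero]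
  have : ∑ a ∈ Finset.range N, ∑ k ∈ Finset.range (a + 1), f k ((a + 1 : ℕ) : ℤ) =
      ∑ a ∈ Finset.range N, ∑ k ∈ Finset.range a, f (k + 1) (a + 1) +
        ∑ a ∈ Finset.range N, f 0 ((a + 1 : ℕ) : ℤ) := by
    rw [← Finset.sum_add_distrib]
    refine Finset.sum_congr rfl fun a _ => ?_
    rw [Finset.sum_range_succ']
    push_cast
    rfl
  rw [this]
  rw [Finset.sum_range_succ'] at z1
  simp only [Nat.cast_zero, f0, add_zero] at z1
  linarith

theorem clusterForm_eq {n : ℕ} {v w w' : ℤ → ℤ → ℝ} (h : IsLinearTangent n v w)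
    (h' : IsLinearTangent n v w') (m : ℤ) (hn : 4 ≤ n)
    (hv : ∀ l : ℕ, 0 < l → l < n → v m (m + l) ≠ 0) :
    clusterForm n m v w w' = ∑ a ∈ Finset.range n, w (a - 1) (a + 1) *
      ∑ k ∈ Finset.range a, w' (k - 1) (k + 1) * v k a ^ 2 := by
  rw [clusterForm_eq_double_sum h h' m hn hv]
  clear hv
  induction m using Int.induction_on with
  | zero => simp
  | succ m ih => rw [double_sum_shift h h', ih]
  | pred m ih =>
    have := double_sum_shift h h' (-(m : ℤ) - 1)
    rw [sub_add_cancel] at this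
    rw [← this, ih]

/-! ### Antiperiodic extensions -/

/-- The `n`-antiperiodic extension of the values `p 0, …, p (n - 1)`. -/
def antiExt (n : ℕ) (p : ℕ → ℝ) (j : ℤ) : ℝ := (-1 : ℝ) ^ (j / n) * p (j % n).toNat

theorem antiExt_apply {n : ℕ} (p : ℕ → ℝ) (k : ℤ) {r : ℕ} (hr : r < n) :
    antiExt n p (n * k + r) = (-1 : ℝ) ^ k * p r := by
  have hn : (n : ℤ) ≠ 0 := by omega
  have h0 : (r : ℤ) / n = 0 := Int.ediv_eq_zero_of_lt (by omega) (by omega)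
  have h1 : (r : ℤ) % n = r := Int.emod_eq_of_lt (by omega) (by omega)
  rw [antiExt, add_comm, Int.add_mul_ediv_left _ _ hn, Int.add_mul_emod_self_left, h0, h1, zero_add,
    Int.toNat_natCast]

theorem exists_int_decomp {n : ℕ} (hn : 0 < n) (j : ℤ) : ∃ (k : ℤ) (r : ℕ), r < n ∧ j = n * k + r := by
  have hn' : (0 : ℤ) < n := by exact_mod_cast hn
  have h0 := Int.emod_nonneg j hn'.ne'
  have h1 := Int.emod_lt_of_pos j hn'
  refine ⟨j / n, (j % n).toNat, by omega, ?_⟩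
  rw [Int.toNat_of_nonneg h0]
  exact (Int.mul_ediv_add_emod j n).symm

theorem antiExt_natCast {n : ℕ} (p : ℕ → ℝ) {r : ℕ} (hr : r < n) : antiExt n p r = p r := by
  have := antiExt_apply p 0 hr
  simpa using this

theorem antiExt_add {n : ℕ} (hn : 0 < n) (p : ℕ → ℝ) (j : ℤ) :
    antiExt n p (j + n) = -antiExt n p j := by
  obtain ⟨k, r, hr, rfl⟩ := exists_int_decomp hn j
  rw [show (n : ℤ) * k + r + n = n * (k + 1) + r by ring, antiExt_apply p _ hr, antiExt_apply p _ hr,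
    zpow_add_one₀ (by norm_num)]
  ring

/-- The condition `hlast` is the bracket across the seam from n - 1 to n, where the extensions take
the values -p 0 and -s 0. -/
theorem antiExt_wronskian {n : ℕ} (hn : 0 < n) {p s : ℕ → ℝ}
    (h : ∀ r, r + 1 < n → p r * s (r + 1) - s r * p (r + 1) = 1)
    (hlast : s (n - 1) * p 0 - p (n - 1) * s 0 = 1) (j : ℤ) :
    antiExt n p j * antiExt n s (j + 1) - antiExt n s j * antiExt n p (j + 1) = 1 := by
  obtain ⟨k, r, hr, rfl⟩ := exists_int_decomp hn j
  have hk : ((-1 : ℝ) ^ k) * (-1 : ℝ) ^ k = 1 := by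
    rw [← mul_zpow]; norm_num
  rw [antiExt_apply p _ hr, antiExt_apply s _ hr]
  by_cases h1 : r + 1 < n
  · rw [show (n : ℤ) * k + r + 1 = n * k + ((r + 1 : ℕ) : ℤ) by push_cast; ring,
      antiExt_apply p _ h1, antiExt_apply s _ h1]
    linear_combination (p r * s (r + 1) - s r * p (r + 1)) * hk + h r h1
  · obtain rfl : n = r + 1 := by omega
    rw [show ((r + 1 : ℕ) : ℤ) * k + r + 1 = ((r + 1 : ℕ) : ℤ) * (k + 1) + ((0 : ℕ) : ℤ) by
      push_cast; ring, antiExt_apply p _ hn, antiExt_apply s _ hn, zpow_add_one₀ (by norm_num)]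
    rw [Nat.add_sub_cancel] at hlast
    linear_combination (s r * p 0 - p r * s 0) * hk + hlast

theorem eq_antiExt {n : ℕ} (hn : 0 < n) {f : ℤ → ℝ} (hf : ∀ j, f (j + n) = -f j) (j : ℤ) :
    f j = antiExt n (fun r => f r) j := by
  obtain ⟨k, r, hr, rfl⟩ := exists_int_decomp hn j
  rw [antiExt_apply _ _ hr]
  induction k using Int.induction_on with
  | zero => simp
  | succ k ih =>
    rw [show (n : ℤ) * (k + 1) + r = n * k + r + n by ring, hf, ih, zpow_add_one₀ (by norm_num)]
    ring
  | pred k ih =>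
    have := hf (n * (-(k : ℤ) - 1) + r)
    rw [show (n : ℤ) * (-(k : ℤ) - 1) + r + n = n * -(k : ℤ) + r by ring, ih] at this
    rw [zpow_sub_one₀ (by norm_num)]
    linarith

/-! ### Construction of tangent vectors -/

/-- The second coordinate of the polygon with first coordinates `p` and unit brackets. -/
def secondCoord (p : ℕ → ℝ) : ℕ → ℝ
  -- These initial values are the entries v 1 0 and v 1 1 of a closed frieze, so row 1 is recovered
  -- from row 0.
  | 0 => -1
  | 1 => 0
  | k + 2 => (1 + secondCoord p (k + 1) * p (k + 2)) / p (k + 1)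

theorem secondCoord_wronskian {p : ℕ → ℝ} (h1 : p 1 = 1) {r : ℕ}
    (h : 0 < r → p r ≠ 0) : p r * secondCoord p (r + 1) - secondCoord p r * p (r + 1) = 1 := by
  rcases r with _ | r
  · simp [secondCoord, h1]
  · have := h (by omega)
    rw [secondCoord]
    field_simp
    ring

theorem secondCoord_differentiableAt {p : ℝ → ℕ → ℝ} {t : ℝ}
    (hp : ∀ k, DifferentiableAt ℝ (fun t => p t k) t) {n : ℕ}
    (hne : ∀ k, 0 < k → k < n → p t k ≠ 0) :
    ∀ k, k ≤ n → DifferentiableAt ℝ (fun t => secondCoord (p t) k) t := by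
  intro k
  induction k using Nat.twoStepInduction with
  | zero => intro _; simp only [secondCoord]; exact differentiableAt_const _
  | one => intro _; simp only [secondCoord]; exact differentiableAt_const _
  | more k _ ih =>
    intro hk
    simp only [secondCoord]
    exact (((ih (by omega)).mul (hp _)).const_add 1).div (hp _) (hne _ (by omega) (by omega))

/-- At a frieze with nonzero entries, every infinitesimal change of the potential that is orthogonal
to the products of solutions comes from a tangent vector. -/
theorem exists_tangent {n : ℕ} {v : ℤ → ℤ → ℝ} (hv : IsClosedFrieze n v) (hn : 2 ≤ n)
    (hne : ∀ k : ℕ, 0 < k → k < n → v 0 k ≠ 0) {d : ℤ → ℝ} (hd : ∀ j, d (j + n) = d j)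
    (hP : ∑ l ∈ Finset.range n, d l * v 0 l * v 0 l = 0)
    (hQ : ∑ l ∈ Finset.range n, d l * v 0 l * v 1 l = 0)
    (hS : ∑ l ∈ Finset.range n, d l * v 1 l * v 1 l = 0) :
    ∃ w, IsFriezeTangent n v w ∧ ∀ j, w (j - 1) (j + 1) = d j := by
  have hn0 : 0 < n := by omega
  set W : ℕ → ℝ := fun k => ∑ l ∈ Finset.range k, d l * v 0 l * v l k with hW
  have W0 : W 0 = 0 := by simp [hW]
  have W1 : W 1 = 0 := by simp [hW, hv.zero_row]
  have hWrec : ∀ k : ℕ, W (k + 2) = d (k + 1) * v 0 (k + 1) + v k (k + 2) * W (k + 1) - W k := by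
    intro k
    have := hv.duhamel_recurrence d 0 k
    simp only [zero_add] at this
    simp only [hW]
    push_cast
    exact this
  have v01 : v 0 1 = 1 := hv.one_row 0
  have v10 : v 1 0 = -1 := by rw [hv.skew 0 1, v01]
  have v0n : v 0 n = 0 := by simpa [hv.zero_row] using hv.anti_right 0 0
  have Wn : W n = 0 := by
    rw [← hP]
    refine Finset.sum_congr rfl fun l _ => ?_
    have := hv.glide 0 l
    rw [zero_add] at this
    rw [this]
  have Wn1 : W (n + 1) = 0 := by
    simp only [hW]
    rw [Finset.sum_range_succ, v0n, mul_zero, zero_mul, add_zero, ← hQ]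
    refine Finset.sum_congr rfl fun l _ => ?_
    have := hv.glide 1 l
    rw [add_comm] at this
    push_cast
    rw [this]
  have Wp : W (n - 1) = 0 := by
    obtain ⟨N, rfl⟩ : ∃ N, n = N + 1 := ⟨n - 1, by omega⟩
    have := hWrec N
    rw [Wn, show N + 2 = N + 1 + 1 from rfl, Wn1] at this
    rw [show (N : ℤ) + 1 = ((N + 1 : ℕ) : ℤ) by push_cast; rfl, v0n] at this
    rw [Nat.add_sub_cancel]
    linarith
  -- Row 0 moves along a straight line and row 1 is recovered from unit brackets. As `W` vanishes at
  -- 0, 1 and n - 1, the polygon still closes up antiperiodically, so every small t gives a closed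
  -- frieze.
  set p : ℝ → ℕ → ℝ := fun t k => v 0 k + t * W k with hp
  have p0 : ∀ t, p t 0 = 0 := fun t => by simp [hp, W0, hv.zero_row]
  have p1 : ∀ t, p t 1 = 1 := fun t => by simp [hp, W1, v01]
  have plast : ∀ t, p t (n - 1) = 1 := fun t => by
    have h1 := hv.glide (-1) 0
    have h2 := hv.one_row (-1)
    rw [neg_add_cancel] at h2
    simp only [hp, Wp, mul_zero, add_zero]
    push_cast [Nat.cast_sub hn0]
    rw [show (n : ℤ) - 1 = -1 + n by ring, h1, h2]
  have pd : ∀ k, HasDerivAt (fun t => p t k) (W k) 0 := fun k => by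
    convert! ((hasDerivAt_id (0 : ℝ)).mul_const (W k)).const_add (v 0 k) using 1
    simp
  have pne : ∀ k, 0 < k → k < n → p 0 k ≠ 0 := fun k h1 h2 => by
    simpa [hp] using hne k h1 h2
  have pe : ∀ᶠ t in 𝓝 (0 : ℝ), ∀ k ∈ Finset.Ioo 0 n, p t k ≠ 0 := by
    rw [eventually_all_finset]
    intro k hk
    rw [Finset.mem_Ioo] at hk
    exact (pd k).continuousAt.eventually_ne (pne k hk.1 hk.2)
  set s : ℝ → ℕ → ℝ := fun t => secondCoord (p t) with hs
  have s0 : ∀ t, s t 0 = -1 := fun t => by simp only [hs, secondCoord]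
  have s1 : ∀ t, s t 1 = 0 := fun t => by simp only [hs, secondCoord]
  have swr : ∀ t, (∀ k ∈ Finset.Ioo 0 n, p t k ≠ 0) → ∀ j : ℤ,
      antiExt n (p t) j * antiExt n (s t) (j + 1) -
        antiExt n (s t) j * antiExt n (p t) (j + 1) = 1 := by
    intro t ht
    refine antiExt_wronskian hn0 (fun r hr => secondCoord_wronskian (p1 t) fun h =>
      ht r (Finset.mem_Ioo.2 ⟨h, by omega⟩)) ?_
    rw [p0, s0, plast]
    ring
  have sd : ∀ k, k ≤ n → DifferentiableAt ℝ (fun t => s t k) 0 :=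
    secondCoord_differentiableAt (fun k => (pd k).differentiableAt) pne
  set u : ℝ → ℤ → ℤ → ℝ := fun t i j =>
    antiExt n (p t) i * antiExt n (s t) j - antiExt n (s t) i * antiExt n (p t) j with hu
  have extp : ∀ j, DifferentiableAt ℝ (fun t => antiExt n (p t) j) 0 := fun j => by
    simp only [antiExt]
    exact (pd _).differentiableAt.const_mul _
  have exts : ∀ j, DifferentiableAt ℝ (fun t => antiExt n (s t) j) 0 := fun j => by
    simp only [antiExt]
    refine (sd _ ?_).const_mul _
    have := Int.emod_lt_of_pos j (show (0 : ℤ) < n by omega)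
    omega
  have u0 : u 0 = v := by
    have hp0 : ∀ j, antiExt n (p 0) j = v 0 j := fun j => by
      rw [eq_antiExt hn0 (fun j => hv.anti_right 0 j) j]
      congr 1
      funext r
      simp [hp]
    have hs0 : ∀ j, antiExt n (s 0) j = v 1 j := fun j => by
      rw [eq_antiExt hn0 (fun j => hv.anti_right 1 j) j]
      have : ∀ r : ℕ, r < n → s 0 r = v 1 r := by
        intro r
        induction r using Nat.twoStepInduction with
        | zero => intro _; rw [s0, Nat.cast_zero, v10]
        | one => intro _; rw [s1, Nat.cast_one, hv.zero_row]
        | more r _ ih =>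
          intro hr
          have h1 := ih (by omega)
          have h2 := hv.rule 0 (r + 1)
          have h3 := pne (r + 1) (by omega) (by omega)
          have h4 : p 0 (r + 1) * s 0 (r + 2) - s 0 (r + 1) * p 0 (r + 2) = 1 :=
            secondCoord_wronskian (p1 0) fun _ => h3
          rw [h1] at h4
          simp only [hp, zero_mul, add_zero] at h3 h4
          push_cast at h3 h4 ⊢
          rw [zero_add, add_assoc (r : ℤ) 1 1, one_add_one_eq_two] at h2
          apply mul_left_cancel₀ h3
          linarith
      obtain ⟨k, r, hr, rfl⟩ := exists_int_decomp hn0 j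
      rw [antiExt_apply _ _ hr, antiExt_apply _ _ hr, this r hr]
    funext i j
    simp only [hu, hp0, hs0]
    have := hv.eq_det 0 i j
    rw [zero_add] at this
    exact this.symm
  set w : ℤ → ℤ → ℝ := fun i j => deriv (fun t => u t i j) 0 with hw
  have hwt : IsFriezeTangent n v w := by
    refine ⟨u, u0, pe.mono fun t ht => ?_, fun i j => ?_⟩
    · exact isClosedFrieze_of_polygon (antiExt_add hn0 _) (antiExt_add hn0 _) (swr t ht)
    · exact (((extp i).mul (exts j)).sub ((exts i).mul (extp j))).hasDerivAt
  have hl := hwt.isLinearTangent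
  refine ⟨w, hwt, ?_⟩
  have w0 : ∀ k : ℕ, k ≤ n → w 0 k = W k := by
    intro k hk
    rcases hk.lt_or_eq with hk | rfl
    · have e : (fun t => u t 0 k) = fun t => p t k := by
        funext t
        have e0 : ∀ f : ℕ → ℝ, antiExt n f 0 = f 0 := fun f => by
          have := antiExt_natCast f hn0
          simpa using this
        simp only [hu]
        rw [e0, e0, p0, s0, antiExt_natCast _ hk, antiExt_natCast _ hk]
        ring
      simp only [hw]
      rw [e, (pd k).deriv]
    · have := hl.anti_right 0 0
      rw [zero_add, hl.zero_row] at this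
      rw [this, Wn, neg_zero]
  -- The linearised recurrence along row 0 determines the velocity of the potential wherever the
  -- entry of row 0 is nonzero.
  have hmid : ∀ k : ℕ, k + 1 < n → w ((k + 1 : ℕ) - 1) ((k + 1 : ℕ) + 1) = d (k + 1 : ℕ) := by
    intro k hk
    have h1 := hl.recurrence 0 (k + 1)
    have h2 := hWrec k
    have h3 := w0 (k + 2) (by omega)
    have h4 := w0 (k + 1) (by omega)
    have h5 := w0 k (by omega)
    have h6 := hne (k + 1) (by omega) hk
    push_cast at h3 h4 h6 ⊢
    rw [add_sub_cancel_right, add_assoc (k : ℤ) 1 1, one_add_one_eq_two] at h1 ⊢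
    rw [h3, h4, h5, h2] at h1
    apply mul_right_cancel₀ h6
    linarith
  -- Row 0 says nothing at index 0, where its entry vanishes. The orthogonality to the square of row
  -- 1, which holds for `d` and for the constructed velocity, settles this index because v 1 0 = -1.
  have hzero : w (0 - 1) (0 + 1) = d 0 := by
    have h1 := hl.closure 0 1 1
    simp only [zero_add] at h1
    obtain ⟨N, rfl⟩ : ∃ N, n = N + 1 := ⟨n - 1, by omega⟩
    rw [Finset.sum_range_succ'] at h1 hS
    have : ∑ k ∈ Finset.range N, w (((k + 1 : ℕ) : ℤ) - 1) (((k + 1 : ℕ) : ℤ) + 1) *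
        v 1 (k + 1 : ℕ) * v 1 (k + 1 : ℕ) =
        ∑ k ∈ Finset.range N, d (k + 1 : ℕ) * v 1 (k + 1 : ℕ) * v 1 (k + 1 : ℕ) := by
      refine Finset.sum_congr rfl fun k hk => ?_
      rw [Finset.mem_range] at hk
      rw [hmid k (by omega)]
    rw [this] at h1
    simp only [Nat.cast_zero, v10] at h1 hS
    simp only [zero_sub, zero_add] at h1 ⊢
    linarith
  have hper : Function.Periodic (fun j : ℤ => w (j - 1) (j + 1) - d j) n := by
    intro j
    simp only
    rw [hd, show j + (n : ℤ) - 1 = j - 1 + n by ring, show j + (n : ℤ) + 1 = j + 1 + n by ring,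
      hl.periodic]
  intro j
  obtain ⟨k, r, hr, rfl⟩ := exists_int_decomp hn0 j
  have h1 := hper.int_mul k r
  have h2 : w ((r : ℤ) - 1) (r + 1) - d r = 0 := by
    rcases r with _ | r
    · simpa using sub_eq_zero.2 hzero
    · exact sub_eq_zero.2 (hmid r hr)
  simp only [Int.cast_id] at h1
  rw [h2, show (r : ℤ) + (k : ℤ) * n = n * k + r by ring] at h1
  linarith

/-! ### Vector fields and variations of the potential -/

theorem _root_.ContDiff.deriv_infty {f : ℝ → ℝ} (h : ContDiff ℝ ∞ f) : ContDiff ℝ ∞ (deriv f) :=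
  (contDiff_infty_iff_deriv.1 h).2

theorem _root_.ContDiff.hasDerivAt_infty {f : ℝ → ℝ} (h : ContDiff ℝ ∞ f) (x : ℝ) :
    HasDerivAt f (deriv f x) x :=
  (h.differentiable (by simp) x).hasDerivAt

theorem deriv_periodic {f : ℝ → ℝ} {T : ℝ} (h : ∀ x, f (x + T) = f x) (x : ℝ) :
    deriv f (x + T) = deriv f x := by
  rw [← deriv_comp_add_const, funext h]

theorem deriv_antiperiodic {f f' : ℝ → ℝ} {T : ℝ} (h : ∀ x, f (x + T) = -f x)
    (hd : ∀ x, HasDerivAt f (f' x) x) (x : ℝ) : f' (x + T) = -f' x := by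
  have := (hd (x + T)).comp_add_const x T
  exact this.unique ((hd x).neg.congr_of_eventuallyEq (Eventually.of_forall h))

theorem IsVectorField.deriv {T : ℝ} {X : ℝ → ℝ} (h : IsVectorField T X) :
    IsVectorField T (deriv X) :=
  ⟨h.smooth.deriv_infty, deriv_periodic h.periodic⟩

/-- The variation `X q' + 2 X' q - X''' / 2` of the potential of `y'' = q y` under `X d/dx`. -/
def hillVar (q X : ℝ → ℝ) (x : ℝ) : ℝ :=
  X x * deriv q x + 2 * deriv X x * q x - deriv (deriv (deriv X)) x / 2

theorem continuous_hillVar {q X : ℝ → ℝ} (hq : ContDiff ℝ ∞ q) (hX : ContDiff ℝ ∞ X) :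
    Continuous (hillVar q X) := by
  have h1 := hq.continuous
  have h2 := hq.deriv_infty.continuous
  have h3 := hX.continuous
  have h4 := hX.deriv_infty.continuous
  have h5 := hX.deriv_infty.deriv_infty.deriv_infty.continuous
  unfold hillVar
  fun_prop

/-- Solutions of `y'' = q y`, with their derivatives. -/
structure IsHillSolution (q y y' : ℝ → ℝ) : Prop where
  deriv : ∀ x, HasDerivAt y (y' x) x
  deriv' : ∀ x, HasDerivAt y' (q x * y x) x

theorem IsHillSolution.continuous {q y y' : ℝ → ℝ} (h : IsHillSolution q y y') : Continuous y :=
  continuous_iff_continuousAt.2 fun x => (h.deriv x).continuousAt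

theorem IsHillSolution.comb {q y y' z z' : ℝ → ℝ} (hy : IsHillSolution q y y')
    (hz : IsHillSolution q z z') (c d : ℝ) :
    IsHillSolution q (fun x => c * y x + d * z x) fun x => c * y' x + d * z' x :=
  ⟨fun x => ((hy.deriv x).const_mul c).add ((hz.deriv x).const_mul d), fun x => by
    convert! ((hy.deriv' x).const_mul c).add ((hz.deriv' x).const_mul d) using 1; ring⟩

/-- An antiderivative of `hillVar q X * y * z`, for solutions `y`, `z` of Hill's equation. -/
def concomitant (q X y y' z z' : ℝ → ℝ) (x : ℝ) : ℝ :=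
  (q x * X x - deriv (deriv X) x / 2) * (y x * z x) +
    deriv X x / 2 * (y' x * z x + y x * z' x) - X x * (y' x * z' x)

/-- The operator X ↦ Xq' + 2X'q - X'''/2 is formally skew-adjoint and annihilates products of two
solutions; the concomitant is the boundary term of the resulting integration by parts. -/
theorem hasDerivAt_concomitant {q X y y' z z' : ℝ → ℝ} (hq : ContDiff ℝ ∞ q)
    (hX : ContDiff ℝ ∞ X) (hy : IsHillSolution q y y') (hz : IsHillSolution q z z') (x : ℝ) :
    HasDerivAt (concomitant q X y y' z z') (hillVar q X x * (y x * z x)) x := by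
  have q1 := hq.hasDerivAt_infty x
  have X0 := hX.hasDerivAt_infty x
  have X1 := hX.deriv_infty.hasDerivAt_infty x
  have X2 := hX.deriv_infty.deriv_infty.hasDerivAt_infty x
  have y0 := hy.deriv x
  have y1 := hy.deriv' x
  have z0 := hz.deriv x
  have z1 := hz.deriv' x
  convert! ((((q1.mul X0).sub (X2.div_const 2)).mul (y0.mul z0)).add
    ((X1.div_const 2).mul ((y1.mul z0).add (y0.mul z1)))).sub (X0.mul (y1.mul z1)) using 1
  simp only [hillVar, Pi.mul_apply, Pi.add_apply, Pi.sub_apply]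
  ring

theorem integral_hillVar_mul {q X y y' z z' : ℝ → ℝ} (hq : ContDiff ℝ ∞ q)
    (hX : ContDiff ℝ ∞ X) (hy : IsHillSolution q y y') (hz : IsHillSolution q z z') (s t : ℝ) :
    ∫ x in s..t, hillVar q X x * (y x * z x) =
      concomitant q X y y' z z' t - concomitant q X y y' z z' s :=
  intervalIntegral.integral_eq_sub_of_hasDerivAt
    (fun x _ => hasDerivAt_concomitant hq hX hy hz x)
    (((continuous_hillVar hq hX).mul (hy.continuous.mul hz.continuous)).intervalIntegrable _ _)

/-- The variation of the potential is orthogonal to the products of antiperiodic solutions. -/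
theorem integral_hillVar_period {T : ℝ} {q X y y' z z' : ℝ → ℝ} (hq : IsVectorField T q)
    (hX : IsVectorField T X) (hy : IsHillSolution q y y') (hz : IsHillSolution q z z')
    (hyT : ∀ x, y (x + T) = -y x) (hzT : ∀ x, z (x + T) = -z x) :
    ∫ x in (0 : ℝ)..T, hillVar q X x * (y x * z x) = 0 := by
  rw [integral_hillVar_mul hq.smooth hX.smooth hy hz, sub_eq_zero]
  have e0 := hq.periodic 0
  have e1 := hX.periodic 0
  have e2 := hX.deriv.periodic 0
  have e3 := hX.deriv.deriv.periodic 0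
  have e4 := hyT 0
  have e5 := hzT 0
  have e6 := deriv_antiperiodic hyT hy.deriv 0
  have e7 := deriv_antiperiodic hzT hz.deriv 0
  rw [zero_add] at *
  simp only [concomitant, e0, e1, e2, e3, e4, e5, e6, e7]
  ring

namespace HillBasis

variable {q a b a' b' : ℝ → ℝ}

theorem sol_fst (h : HillBasis q a b a' b') : IsHillSolution q a a' := ⟨h.fst, h.fst'⟩

theorem sol_snd (h : HillBasis q a b a' b') : IsHillSolution q b b' := ⟨h.snd, h.snd'⟩

theorem sol_kernel_right (h : HillBasis q a b a' b') (x : ℝ) :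
    IsHillSolution q (fun s => kernel a b x s) fun s => a x * b' s - b x * a' s := by
  convert! h.sol_snd.comb h.sol_fst (a x) (-b x) using 1
  · funext s; simp only [kernel]; ring
  · funext s; ring

theorem sol_kernel_left (h : HillBasis q a b a' b') (y : ℝ) :
    IsHillSolution q (fun s => kernel a b s y) fun s => a' s * b y - b' s * a y := by
  convert! h.sol_fst.comb h.sol_snd (b y) (-a y) using 1
  · funext s; simp only [kernel]; ring
  · funext s; ring

/-- The limit of the entries of tangent vectors. -/
theorem integral_hillVar_kernel_kernel (h : HillBasis q a b a' b') {X : ℝ → ℝ}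
    (hX : ContDiff ℝ ∞ X) (x y : ℝ) :
    ∫ s in x..y, hillVar q X s * (kernel a b x s * kernel a b s y) =
      ((X x * a' x - deriv X x / 2 * a x) * b y - (X x * b' x - deriv X x / 2 * b x) * a y) +
      (a x * (X y * b' y - deriv X y / 2 * b y) - b x * (X y * a' y - deriv X y / 2 * a y)) := by
  rw [integral_hillVar_mul h.smooth hX (h.sol_kernel_right x) (h.sol_kernel_left y)]
  simp only [concomitant, kernel]
  have w1 := h.wronskian x
  have w2 := h.wronskian y
  linear_combination ((a x * b y - b x * a y) * (-deriv X x / 2) + X x * (a' x * b y - b' x * a y))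
    * w1 + ((a x * b y - b x * a y) * (-deriv X y / 2) + X y * (a x * b' y - b x * a' y)) * w2

/-- The limit of the cluster form as a double integral. -/
theorem integral_integral_hillVar (h : HillBasis q a b a' b') {T : ℝ} (hq : IsVectorField T q)
    (ha : ∀ x, a (x + T) = -a x) (hb : ∀ x, b (x + T) = -b x) {X Y : ℝ → ℝ}
    (hX : IsVectorField T X) (hY : IsVectorField T Y) :
    ∫ y in (0 : ℝ)..T, hillVar q X y * ∫ s in (0 : ℝ)..y, hillVar q Y s * kernel a b s y ^ 2 =
      (∫ x in (0 : ℝ)..T, q x * (X x * deriv Y x - deriv X x * Y x)) +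
        1 / 2 * ∫ x in (0 : ℝ)..T, deriv X x * deriv (deriv Y) x := by
  set A := q 0 * Y 0 - deriv (deriv Y) 0 / 2 with hA
  set K : ℝ → ℝ := fun y => kernel a b 0 y with hK
  set L : ℝ → ℝ := fun y => a' 0 * b y - b' 0 * a y with hL
  -- At the upper end the kernel vanishes and its derivative in s is -1, so the concomitant is -Y y.
  -- The lower end contributes a quadratic form in the antiperiodic solutions K and L.
  have inner : ∀ y, ∫ s in (0 : ℝ)..y, hillVar q Y s * kernel a b s y ^ 2 =
      -Y y - (A * (K y * K y) + deriv Y 0 * (K y * L y) - Y 0 * (L y * L y)) := by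
    intro y
    have := integral_hillVar_mul h.smooth hY.smooth (h.sol_kernel_left y) (h.sol_kernel_left y) 0 y
    simp only [← pow_two] at this
    rw [this]
    have w := h.wronskian y
    simp only [concomitant, hA, hK, hL, kernel]
    linear_combination Y y * (b y * a' y - a y * b' y - 1) * w
  have solK : IsHillSolution q K fun s => a 0 * b' s - b 0 * a' s := h.sol_kernel_right 0
  have solL : IsHillSolution q L fun s => a' 0 * b' s + (-b' 0) * a' s := by
    convert! h.sol_snd.comb h.sol_fst (a' 0) (-b' 0) using 1
    funext s; simp only [hL]; ring
  have KT : ∀ x, K (x + T) = -K x := fun x => by simp only [hK, kernel, ha, hb]; ring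
  have LT : ∀ x, L (x + T) = -L x := fun x => by simp only [hL, ha, hb]; ring
  -- By orthogonality the quadratic form in K and L integrates to zero against `hillVar q X`; only
  -- -Y y survives.
  have z1 := integral_hillVar_period hq hX solK solK KT KT
  have z2 := integral_hillVar_period hq hX solK solL KT LT
  have z3 := integral_hillVar_period hq hX solL solL LT LT
  have cr := continuous_hillVar hq.smooth hX.smooth
  have cK := solK.continuous
  have cL := solL.continuous
  have cY := hY.smooth.continuous
  have cX := hX.smooth.continuous
  have cX1 := hX.deriv.smooth.continuous
  have cY1 := hY.deriv.smooth.continuous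
  have cY2 := hY.deriv.deriv.smooth.continuous
  have cq := hq.smooth.continuous
  have ii : ∀ f : ℝ → ℝ, Continuous f → IntervalIntegrable f MeasureTheory.volume 0 T :=
    fun f hf => hf.intervalIntegrable _ _
  have e1 : ∫ y in (0 : ℝ)..T, hillVar q X y * ∫ s in (0 : ℝ)..y,
      hillVar q Y s * kernel a b s y ^ 2 = -∫ y in (0 : ℝ)..T, hillVar q X y * Y y := by
    simp only [inner]
    have : ∀ y, hillVar q X y *
        (-Y y - (A * (K y * K y) + deriv Y 0 * (K y * L y) - Y 0 * (L y * L y))) =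
        -(hillVar q X y * Y y) - (A * (hillVar q X y * (K y * K y)) +
          deriv Y 0 * (hillVar q X y * (K y * L y)) - Y 0 * (hillVar q X y * (L y * L y))) :=
      fun y => by ring
    simp only [this]
    rw [intervalIntegral.integral_sub (ii _ (by fun_prop)) (ii _ (by fun_prop)),
      intervalIntegral.integral_sub (ii _ (by fun_prop)) (ii _ (by fun_prop)),
      intervalIntegral.integral_add (ii _ (by fun_prop)) (ii _ (by fun_prop)),
      intervalIntegral.integral_const_mul, intervalIntegral.integral_const_mul,
      intervalIntegral.integral_const_mul, z1, z2, z3, intervalIntegral.integral_neg]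
    ring
  rw [e1, ← intervalIntegral.integral_const_mul, ← intervalIntegral.integral_add
    (ii _ (by fun_prop)) (ii _ (by fun_prop)), ← intervalIntegral.integral_neg, ← sub_eq_zero,
    ← intervalIntegral.integral_sub (ii _ (by fun_prop)) (ii _ (by fun_prop))]
  -- The two integrands differ by the derivative of a periodic function.
  have hd : ∀ x, HasDerivAt (fun x => -(q x * X x * Y x) +
      (deriv (deriv X) x * Y x - deriv X x * deriv Y x) / 2)
      (-(hillVar q X x * Y x) - (q x * (X x * deriv Y x - deriv X x * Y x) +
        1 / 2 * (deriv X x * deriv (deriv Y) x))) x := by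
    intro x
    have q1 := hq.smooth.hasDerivAt_infty x
    have X0 := hX.smooth.hasDerivAt_infty x
    have X1 := hX.deriv.smooth.hasDerivAt_infty x
    have X2 := hX.deriv.deriv.smooth.hasDerivAt_infty x
    have Y0 := hY.smooth.hasDerivAt_infty x
    have Y1 := hY.deriv.smooth.hasDerivAt_infty x
    convert! ((q1.mul X0).mul Y0).neg.add (((X2.mul Y0).sub (X1.mul Y1)).div_const 2) using 1
    simp only [hillVar, Pi.mul_apply]
    ring
  rw [intervalIntegral.integral_eq_sub_of_hasDerivAt (fun x _ => hd x) (ii _ (by fun_prop))]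
  have p0 := hq.periodic 0
  have p1 := hX.periodic 0
  have p2 := hX.deriv.periodic 0
  have p3 := hX.deriv.deriv.periodic 0
  have p4 := hY.periodic 0
  have p5 := hY.deriv.periodic 0
  rw [zero_add] at p0 p1 p2 p3 p4 p5
  rw [p0, p1, p2, p3, p4, p5]
  ring

/-- A variation of the potential that is orthogonal to the squares of solutions comes from a
vector field. -/
theorem exists_vectorField (h : HillBasis q a b a' b') {T : ℝ}
    (ha : ∀ x, a (x + T) = -a x) (hb : ∀ x, b (x + T) = -b x) {r : ℝ → ℝ}
    (hr : IsVectorField T r) (h0 : ∀ x, ∫ s in (0 : ℝ)..T, r s * kernel a b s x ^ 2 = 0) :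
    ∃ X, IsVectorField T X ∧ ∀ x, r x = hillVar q X x := by
  have ca := h.contDiff_fst
  have cb := h.contDiff_snd
  have ca' := h.contDiff_fst'
  have cb' := h.contDiff_snd'
  have prim : ∀ f : ℝ → ℝ, ContDiff ℝ ∞ f →
      ContDiff ℝ ∞ (fun x => ∫ s in (0 : ℝ)..x, f s) ∧
      ∀ x, HasDerivAt (fun x => ∫ s in (0 : ℝ)..x, f s) (f x) x := by
    intro f hf
    have hd : ∀ x, HasDerivAt (fun x => ∫ s in (0 : ℝ)..x, f s) (f x) x := fun x =>
      intervalIntegral.integral_hasDerivAt_right (hf.continuous.intervalIntegrable _ _)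
        (hf.continuous.stronglyMeasurableAtFilter _ _) hf.continuous.continuousAt
    refine ⟨contDiff_infty_iff_deriv.2 ⟨fun x => (hd x).differentiableAt, ?_⟩, hd⟩
    rwa [show deriv (fun x => ∫ s in (0 : ℝ)..x, f s) = f from funext fun x => (hd x).deriv]
  obtain ⟨sA, dA⟩ := prim (fun s => r s * (a s * a s)) (hr.smooth.mul (ca.mul ca))
  obtain ⟨sB, dB⟩ := prim (fun s => r s * (a s * b s)) (hr.smooth.mul (ca.mul cb))
  obtain ⟨sC, dC⟩ := prim (fun s => r s * (b s * b s)) (hr.smooth.mul (cb.mul cb))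
  set A := fun x => ∫ s in (0 : ℝ)..x, r s * (a s * a s)
  set B := fun x => ∫ s in (0 : ℝ)..x, r s * (a s * b s)
  set C := fun x => ∫ s in (0 : ℝ)..x, r s * (b s * b s)
  -- Variation of constants for the third order operator, whose Green function is -[Γ(s), Γ(x)]².
  -- Expanding the square separates the variables, so that smoothness and the derivatives can be
  -- read off.
  set X : ℝ → ℝ := fun x => -(A x * (b x * b x) - 2 * B x * (a x * b x) + C x * (a x * a x))
    with hXd
  have hXi : ∀ x, X x = -∫ s in (0 : ℝ)..x, r s * kernel a b s x ^ 2 := by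
    intro x
    have e : ∀ s, r s * kernel a b s x ^ 2 = (b x * b x) * (r s * (a s * a s)) -
        (2 * (a x * b x)) * (r s * (a s * b s)) + (a x * a x) * (r s * (b s * b s)) := fun s => by
      simp only [kernel]; ring
    have c0 := hr.smooth.continuous
    have c1 := ca.continuous
    have c2 := cb.continuous
    have ii : ∀ f : ℝ → ℝ, Continuous f → IntervalIntegrable f MeasureTheory.volume 0 x :=
      fun f hf => hf.intervalIntegrable _ _
    simp only [e]
    rw [intervalIntegral.integral_add (ii _ (by fun_prop)) (ii _ (by fun_prop)),
      intervalIntegral.integral_sub (ii _ (by fun_prop)) (ii _ (by fun_prop)),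
      intervalIntegral.integral_const_mul, intervalIntegral.integral_const_mul,
      intervalIntegral.integral_const_mul]
    simp only [hXd]
    ring
  have sX : ContDiff ℝ ∞ X := ((((sA.mul (cb.mul cb)).sub
    ((contDiff_const.mul sB).mul (ca.mul cb))).add (sC.mul (ca.mul ca)))).neg
  have X1 : ∀ x, HasDerivAt X (-(A x * (2 * (b x * b' x)) -
      2 * B x * (a' x * b x + a x * b' x) + C x * (2 * (a x * a' x)))) x := by
    intro x
    convert! ((((dA x).mul ((h.snd x).mul (h.snd x))).sub
      (((dB x).const_mul 2).mul ((h.fst x).mul (h.snd x)))).add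
      ((dC x).mul ((h.fst x).mul (h.fst x)))).neg using 1
    simp only [Pi.mul_apply]
    ring
  have X2 : ∀ x, HasDerivAt (fun x => -(A x * (2 * (b x * b' x)) -
      2 * B x * (a' x * b x + a x * b' x) + C x * (2 * (a x * a' x))))
      (-(A x * (2 * (b' x * b' x) + 2 * q x * (b x * b x)) -
        2 * B x * (2 * (a' x * b' x) + 2 * q x * (a x * b x)) +
        C x * (2 * (a' x * a' x) + 2 * q x * (a x * a x)))) x := by
    intro x
    convert! ((((dA x).mul (((h.snd x).mul (h.snd' x)).const_mul 2)).sub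
      (((dB x).const_mul 2).mul (((h.fst' x).mul (h.snd x)).add ((h.fst x).mul (h.snd' x))))).add
      ((dC x).mul (((h.fst x).mul (h.fst' x)).const_mul 2))).neg using 1
    simp only [Pi.mul_apply, Pi.add_apply]
    ring
  have X3 : ∀ x, HasDerivAt (fun x => -(A x * (2 * (b' x * b' x) + 2 * q x * (b x * b x)) -
        2 * B x * (2 * (a' x * b' x) + 2 * q x * (a x * b x)) +
        C x * (2 * (a' x * a' x) + 2 * q x * (a x * a x))))
      (2 * (X x * deriv q x) + 4 * q x * (-(A x * (2 * (b x * b' x)) -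
      2 * B x * (a' x * b x + a x * b' x) + C x * (2 * (a x * a' x)))) - 2 * r x) x := by
    intro x
    have q1 := h.smooth.hasDerivAt_infty x
    convert! ((((dA x).mul ((((h.snd' x).mul (h.snd' x)).const_mul 2).add
        ((q1.const_mul 2).mul ((h.snd x).mul (h.snd x))))).sub
      (((dB x).const_mul 2).mul ((((h.fst' x).mul (h.snd' x)).const_mul 2).add
        ((q1.const_mul 2).mul ((h.fst x).mul (h.snd x)))))).add
      ((dC x).mul ((((h.fst' x).mul (h.fst' x)).const_mul 2).add
        ((q1.const_mul 2).mul ((h.fst x).mul (h.fst x)))))).neg using 1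
    have w := h.wronskian x
    simp only [Pi.mul_apply, Pi.add_apply, hXd]
    linear_combination (2 * r x * (a x * b' x - b x * a' x + 1)) * w
  refine ⟨X, ⟨sX, fun x => ?_⟩, fun x => ?_⟩
  · rw [hXi, hXi]
    have c0 := hr.smooth.continuous
    have cc : Continuous fun s => r s * kernel a b s x ^ 2 := by
      have c1 := ca.continuous
      have c2 := cb.continuous
      simp only [kernel]
      fun_prop
    have e : ∀ s, r s * kernel a b s (x + T) ^ 2 = r s * kernel a b s x ^ 2 := fun s => by
      simp only [kernel, ha, hb]; ring
    have per : Function.Periodic (fun s => r s * kernel a b s x ^ 2) T := fun s => by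
      simp only [kernel, ha, hb, hr.periodic]; ring
    simp only [e]
    -- Passing from x to x + T adds an integral over a full period, which is zero by `h0`.
    rw [← intervalIntegral.integral_add_adjacent_intervals (cc.intervalIntegrable 0 x)
      (cc.intervalIntegrable x (x + T)), per.intervalIntegral_add_eq x 0, zero_add, h0, add_zero]
  · have d1 := funext fun x => (X1 x).deriv
    have d2 := funext fun x => (X2 x).deriv
    have d3 := (X3 x).deriv
    rw [hillVar, d1, d2, d3]
    ring

end HillBasis

/-! ### Uniform closeness -/

/-- The difference of `f n i` and `g n i` tends to zero, uniformly in `i`. -/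
def UnifClose {ι : Type*} (f g : ℕ → ι → ℝ) : Prop :=
  ∀ δ > 0, ∀ᶠ n in atTop, ∀ i, |f n i - g n i| ≤ δ

theorem abs_mul_sub_mul_le {x y X Y δ M : ℝ} (hx : |x - X| ≤ δ) (hy : |y - Y| ≤ δ)
    (hX : |X| ≤ M) (hY : |Y| ≤ M) (hδ : δ ≤ 1) : |x * y - X * Y| ≤ (2 * M + 1) * δ := by
  have h0 : 0 ≤ δ := (abs_nonneg _).trans hx
  have h1 : x * y - X * Y = (x - X) * (y - Y) + (x - X) * Y + X * (y - Y) := by ring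
  rw [h1]
  calc _ ≤ |(x - X) * (y - Y)| + |(x - X) * Y| + |X * (y - Y)| := abs_add_three _ _ _
    _ = |x - X| * |y - Y| + |x - X| * |Y| + |X| * |y - Y| := by simp only [abs_mul]
    _ ≤ δ * 1 + δ * M + M * δ := by
        have := hy.trans hδ
        gcongr
        exact (abs_nonneg _).trans hX
    _ = _ := by ring

theorem UnifClose.mul {ι : Type*} {f g f' g' : ℕ → ι → ℝ} (h : UnifClose f g)
    (h' : UnifClose f' g') (hg : ∃ M, ∀ n i, |g n i| ≤ M) (hg' : ∃ M, ∀ n i, |g' n i| ≤ M) :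
    UnifClose (fun n i => f n i * f' n i) fun n i => g n i * g' n i := by
  obtain ⟨M, hM⟩ := hg
  obtain ⟨M', hM'⟩ := hg'
  intro δ hδ
  set K := max 0 (max M M')
  have hK : 0 ≤ K := le_max_left _ _
  have hp : 0 < min 1 (δ / (2 * K + 1)) := by positivity
  filter_upwards [h _ hp, h' _ hp] with n h1 h2 i
  refine (abs_mul_sub_mul_le (M := K) (h1 i) (h2 i) ((hM n i).trans ((le_max_left _ _).trans
    (le_max_right _ _))) ((hM' n i).trans ((le_max_right _ _).trans
    (le_max_right _ _))) (min_le_left _ _)).trans ?_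
  calc (2 * K + 1) * min 1 (δ / (2 * K + 1)) ≤ (2 * K + 1) * (δ / (2 * K + 1)) := by
        gcongr; exact min_le_right _ _
    _ = δ := by field_simp

theorem eventually_step {T : ℝ} (hT : 0 < T) {η : ℝ} (hη : 0 < η) :
    ∀ᶠ n : ℕ in atTop, 0 < n ∧ 0 < T / n ∧ T / n < η := by
  filter_upwards [eventually_gt_atTop 0,
    (tendsto_const_div_atTop_nhds_zero_nat T).eventually (gt_mem_nhds hη)] with n h1 h2
  exact ⟨h1, by positivity, h2⟩

theorem exists_abs_le_of_periodic {f : ℝ → ℝ} {T : ℝ} (hT : 0 < T) (hc : Continuous f)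
    (hp : ∀ x, f (x + T) = f x) : ∃ M, ∀ x, |f x| ≤ M := by
  obtain ⟨M, hM⟩ := (isCompact_Icc (a := (0 : ℝ)) (b := 0 + T)).exists_bound_of_continuousOn
    hc.continuousOn
  refine ⟨M, fun x => ?_⟩
  obtain ⟨y, hy, e⟩ := (show Function.Periodic f T from hp).exists_mem_Ico hT x 0
  rw [e]
  exact hM y ⟨hy.1, hy.2.le⟩

theorem exists_abs_le_of_antiperiodic {f : ℝ → ℝ} {T : ℝ} (hT : 0 < T) (hc : Continuous f)
    (hp : ∀ x, f (x + T) = -f x) : ∃ M, ∀ x, |f x| ≤ M := by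
  obtain ⟨M, hM⟩ := exists_abs_le_of_periodic (f := fun x => |f x|) hT hc.abs
    (fun x => by simp only [hp, abs_neg])
  exact ⟨M, fun x => by simpa using hM x⟩

/-! ### Riemann sums -/

/-- Riemann sums of a function that depends continuously on parameters, with perturbed values. -/
theorem exists_riemann_sum_bound {h : ℝ → ℝ × ℝ → ℝ} (hc : Continuous fun z : ℝ × ℝ × ℝ => h z.1 z.2)
    {L : ℝ} {K : Set (ℝ × ℝ)} (hK : IsCompact K) {δ : ℝ} (hδ : 0 < δ) :
    ∃ η > 0, ∀ ε, 0 < ε → ε < η → ∀ p ∈ K, ∀ (i : ℤ) (N : ℕ) (f : ℕ → ℝ), -L ≤ i * ε →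
      (i + N) * ε ≤ L → (∀ l < N, |f l - h ((i + l) * ε) p| ≤ δ) →
      |∑ l ∈ Finset.range N, ε * f l - ∫ s in (i * ε)..((i + N) * ε), h s p| ≤ 4 * L * δ := by
  have huc := (isCompact_Icc (a := -L) (b := L)).prod hK |>.uniformContinuousOn_of_continuous
    hc.continuousOn
  rw [Metric.uniformContinuousOn_iff_le] at huc
  obtain ⟨η, hη, H⟩ := huc δ hδ
  refine ⟨η, hη, fun ε hε hεη p hp i N f h1 h2 hf => ?_⟩
  have hcp : Continuous fun s => h s p := hc.comp (by fun_prop : Continuous fun s : ℝ => (s, p))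
  have hii : ∀ s t, IntervalIntegrable (fun s => h s p) MeasureTheory.volume s t :=
    fun s t => hcp.intervalIntegrable _ _
  have hsum : ∑ l ∈ Finset.range N,
      ∫ s in ((i + l) * ε : ℝ)..((i + (l + 1 : ℕ)) * ε : ℝ), h s p =
      ∫ s in (i * ε)..((i + N) * ε), h s p := by
    have := intervalIntegral.sum_integral_adjacent_intervals (f := fun s => h s p)
      (μ := MeasureTheory.volume) (a := fun l : ℕ => ((i + l) * ε : ℝ)) (n := N)
      (fun k _ => hii _ _)
    simpa using this
  rw [← hsum, ← Finset.sum_sub_distrib]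
  -- One δ comes from the perturbed values and one from the modulus of continuity; as N ε ≤ 2L, the
  -- errors add up to 4Lδ.
  have hterm : ∀ l ∈ Finset.range N, |ε * f l -
      ∫ s in ((i + l) * ε : ℝ)..((i + (l + 1 : ℕ)) * ε : ℝ), h s p| ≤ 2 * δ * ε := by
    intro l hl
    rw [Finset.mem_range] at hl
    have hlN : (l : ℝ) + 1 ≤ N := by exact_mod_cast hl
    have hlε : ((i + (l + 1 : ℕ)) * ε : ℝ) - (i + l) * ε = ε := by push_cast; ring
    have e1 : ε * f l - ∫ s in ((i + l) * ε : ℝ)..((i + (l + 1 : ℕ)) * ε : ℝ), h s p =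
        ∫ s in ((i + l) * ε : ℝ)..((i + (l + 1 : ℕ)) * ε : ℝ), (f l - h s p) := by
      rw [intervalIntegral.integral_sub (by simp) (hii _ _), intervalIntegral.integral_const,
        hlε, smul_eq_mul]
    rw [e1, ← Real.norm_eq_abs]
    have := intervalIntegral.norm_integral_le_of_norm_le_const (a := ((i + l) * ε : ℝ))
      (b := ((i + (l + 1 : ℕ)) * ε : ℝ)) (C := 2 * δ) (f := fun s => f l - h s p) (fun s hs => ?_)
    · rwa [hlε, abs_of_pos hε] at this
    · rw [Set.uIoc_of_le (by linarith)] at hs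
      push_cast at hs
      have l0 : (0 : ℝ) ≤ l := Nat.cast_nonneg l
      have b1 : -L ≤ (i + l) * ε := by nlinarith
      have b2 : (i + l) * ε + ε ≤ L := by nlinarith
      have hs1 := hs.1
      have hs2 := hs.2
      have := H ((i + l) * ε, p) ⟨⟨b1, by linarith⟩, hp⟩ (s, p) ⟨⟨by linarith, by nlinarith⟩, hp⟩ (by
        rw [Prod.dist_eq, dist_self, max_eq_left dist_nonneg, Real.dist_eq, abs_le]
        constructor <;> nlinarith)
      rw [Real.dist_eq] at this
      rw [Real.norm_eq_abs]
      calc |f l - h s p| ≤ |f l - h ((i + l) * ε) p| + |h ((i + l) * ε) p - h s p| :=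
            abs_sub_le _ _ _
        _ ≤ δ + δ := add_le_add (hf l hl) this
        _ = 2 * δ := by ring
  calc _ ≤ ∑ l ∈ Finset.range N, |ε * f l -
        ∫ s in ((i + l) * ε : ℝ)..((i + (l + 1 : ℕ)) * ε : ℝ), h s p| :=
        Finset.abs_sum_le_sum_abs _ _
    _ ≤ ∑ l ∈ Finset.range N, 2 * δ * ε := Finset.sum_le_sum hterm
    _ = 2 * δ * (N * ε) := by rw [Finset.sum_const, Finset.card_range, nsmul_eq_mul]; ring
    _ ≤ 2 * δ * (2 * L) := mul_le_mul_of_nonneg_left (by linarith) (by positivity)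
    _ = 4 * L * δ := by ring

/-! ### Taylor estimates -/

theorem abs_le_of_hasDerivAt {g g' : ℝ → ℝ} {h B : ℝ} (h0 : g 0 = 0)
    (hd : ∀ t, |t| ≤ |h| → HasDerivAt g (g' t) t) (hB : ∀ t, |t| ≤ |h| → |g' t| ≤ B) :
    |g h| ≤ B * |h| := by
  have hconv : Convex ℝ (Set.Icc (-|h|) |h|) := convex_Icc _ _
  have := hconv.norm_image_sub_le_of_norm_hasDerivWithin_le (f := g) (f' := g') (C := B)
    (x := 0) (y := h) (fun t ht => (hd t (abs_le.2 ht)).hasDerivWithinAt)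
    (fun t ht => hB t (abs_le.2 ht)) ⟨neg_nonpos.2 (abs_nonneg _), abs_nonneg _⟩ (abs_le.1 le_rfl)
  simpa [h0] using this

/-- Taylor's formula of order two with a locally uniform remainder. -/
theorem exists_taylor_bound {f f1 f2 f3 : ℝ → ℝ} (h1 : ∀ x, HasDerivAt f (f1 x) x)
    (h2 : ∀ x, HasDerivAt f1 (f2 x) x) (h3 : ∀ x, HasDerivAt f2 (f3 x) x) (hc : Continuous f3)
    (L : ℝ) : ∃ C > 0, ∀ y h, |y| ≤ L → |h| ≤ 1 →
      |f (y + h) - f y - h * f1 y - h ^ 2 / 2 * f2 y| ≤ C * |h| ^ 3 := by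
  obtain ⟨C, hC⟩ := (isCompact_Icc (a := -(L + 1)) (b := L + 1)).exists_bound_of_continuousOn
    hc.continuousOn
  refine ⟨max C 1, by positivity, fun y h hy hh => ?_⟩
  have hC' : ∀ t, |t| ≤ 1 → |f3 (y + t)| ≤ max C 1 := by
    intro t ht
    rw [abs_le] at ht hy
    exact (hC (y + t) ⟨by linarith, by linarith⟩).trans (le_max_left _ _)
  have s1 : ∀ t, |t| ≤ 1 → |f2 (y + t) - f2 y| ≤ max C 1 * |t| := by
    intro t ht
    refine abs_le_of_hasDerivAt (g := fun t => f2 (y + t) - f2 y) (g' := fun t => f3 (y + t))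
      (by simp) (fun s _ => ?_) fun s hs => hC' s (hs.trans ht)
    exact ((h3 (y + s)).comp_const_add y s).sub_const _
  have s2 : ∀ t, |t| ≤ 1 → |f1 (y + t) - f1 y - t * f2 y| ≤ max C 1 * |t| * |t| := by
    intro t ht
    refine abs_le_of_hasDerivAt (g := fun t => f1 (y + t) - f1 y - t * f2 y)
      (g' := fun t => f2 (y + t) - f2 y)
      (by simp) (fun s _ => ?_) fun s hs => (s1 s (hs.trans ht)).trans (by gcongr)
    convert! (((h2 (y + s)).comp_const_add y s).sub_const (f1 y)).sub
      ((hasDerivAt_id s).mul_const (f2 y)) using 1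
    ring
  have := abs_le_of_hasDerivAt (g := fun t => f (y + t) - f y - t * f1 y - t ^ 2 / 2 * f2 y)
    (g' := fun t => f1 (y + t) - f1 y - t * f2 y) (h := h) (B := max C 1 * |h| * |h|)
      (by simp) (fun s _ => ?_) fun s hs => (s2 s (hs.trans hh)).trans (by gcongr)
  · calc _ ≤ _ := this
      _ = _ := by ring
  · convert! ((((h1 (y + s)).comp_const_add y s).sub_const (f y)).sub
      ((hasDerivAt_id s).mul_const (f1 y))).sub
      ((((hasDerivAt_id s).pow 2).div_const 2).mul_const (f2 y)) using 1
    simp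

theorem IsHillSolution.exists_taylor_bound {q y y' : ℝ → ℝ} (h : IsHillSolution q y y')
    (hq : ContDiff ℝ ∞ q) (L : ℝ) : ∃ C > 0, ∀ x t, |x| ≤ L → |t| ≤ 1 →
      |y (x + t) - y x - t * y' x - t ^ 2 / 2 * (q x * y x)| ≤ C * |t| ^ 3 := by
  refine FriezeLimit.exists_taylor_bound h.deriv h.deriv'
    (fun x => (hq.hasDerivAt_infty x).mul (h.deriv x)) ?_ L
  have h1 := hq.continuous
  have h2 := hq.deriv_infty.continuous
  have h3 := h.continuous
  have h4 : Continuous y' := continuous_iff_continuousAt.2 fun x => (h.deriv' x).continuousAt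
  fun_prop

/-- Expansion of the kernel in the second variable. -/
theorem HillBasis.exists_kernel_taylor {q a b a' b' : ℝ → ℝ} (h : HillBasis q a b a' b') (L : ℝ) :
    ∃ C > 0, ∀ x y t, |x| ≤ L → |y| ≤ L → |t| ≤ 1 →
      |kernel a b x (y + t) - kernel a b x y - t * (a x * b' y - b x * a' y) -
        t ^ 2 / 2 * (q y * kernel a b x y)| ≤ C * |t| ^ 3 := by
  obtain ⟨C1, hC1, H1⟩ := h.sol_fst.exists_taylor_bound h.smooth L
  obtain ⟨C2, hC2, H2⟩ := h.sol_snd.exists_taylor_bound h.smooth L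
  obtain ⟨A, hA⟩ := (isCompact_Icc (a := -L) (b := L)).exists_bound_of_continuousOn
    h.continuous_fst.continuousOn
  obtain ⟨B, hB⟩ := (isCompact_Icc (a := -L) (b := L)).exists_bound_of_continuousOn
    h.continuous_snd.continuousOn
  refine ⟨|A| * C2 + |B| * C1 + 1, by positivity, fun x y t hx hy ht => ?_⟩
  have e1 := H1 y t hy ht
  have e2 := H2 y t hy ht
  have e3 := (hA x (abs_le.1 hx)).trans (le_abs_self A)
  have e4 := (hB x (abs_le.1 hx)).trans (le_abs_self B)
  rw [Real.norm_eq_abs] at e3 e4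
  have : kernel a b x (y + t) - kernel a b x y - t * (a x * b' y - b x * a' y) -
        t ^ 2 / 2 * (q y * kernel a b x y) =
      a x * (b (y + t) - b y - t * b' y - t ^ 2 / 2 * (q y * b y)) -
      b x * (a (y + t) - a y - t * a' y - t ^ 2 / 2 * (q y * a y)) := by
    simp only [kernel]; ring
  rw [this]
  calc _ ≤ |a x| * |b (y + t) - b y - t * b' y - t ^ 2 / 2 * (q y * b y)| +
        |b x| * |a (y + t) - a y - t * a' y - t ^ 2 / 2 * (q y * a y)| := by
        rw [← abs_mul, ← abs_mul]; exact abs_sub _ _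
    _ ≤ |A| * (C2 * |t| ^ 3) + |B| * (C1 * |t| ^ 3) := by gcongr
    _ ≤ _ := by nlinarith [pow_nonneg (abs_nonneg t) 3]

/-! ### Convergence of discrete solutions -/

/-- Here e is the error of a second order scheme and D its difference quotient. In each step |e| +
|D| grows at most by the factor 1 + ε(R + 1), apart from an error of size ετ; the bound ε ≤ 1
absorbs the term ε²R|D|. -/
theorem discrete_gronwall_pair {e D : ℕ → ℝ} {ε R τ : ℝ} (hε : 0 ≤ ε) (hε1 : ε ≤ 1) (hR : 0 ≤ R)
    (hτ : 0 ≤ τ) {N : ℕ} (h1 : ∀ k < N, e (k + 1) = e k + ε * D k)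
    (h2 : ∀ k < N, |D (k + 1) - D k| ≤ ε * (R * |e (k + 1)| + τ)) :
    |e N| + |D N| ≤ (|e 0| + |D 0| + N * ε * τ) * Real.exp (N * ε * (R + 1)) := by
  have key : ∀ k ≤ N, |e k| + |D k| ≤ (|e 0| + |D 0| + k * ε * τ) * (1 + ε * (R + 1)) ^ k := by
    intro k
    induction k with
    | zero => intro _; simp
    | succ k ih =>
      intro hk
      have i1 := ih (by omega)
      have i2 : |e (k + 1)| ≤ |e k| + ε * |D k| := by
        rw [h1 k (by omega)]
        exact (abs_add_le _ _).trans (by rw [abs_mul, abs_of_nonneg hε])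
      have i3 : |D (k + 1)| ≤ |D k| + ε * (R * |e (k + 1)| + τ) := by
        have := h2 k (by omega)
        have h3 := abs_add_le (D k) (D (k + 1) - D k)
        rw [add_sub_cancel] at h3
        linarith
      have hpow : 1 ≤ (1 + ε * (R + 1)) ^ (k + 1) := one_le_pow₀ (by nlinarith)
      have a1 := abs_nonneg (e k)
      have a2 := abs_nonneg (D k)
      have i4 : ε * R * |e (k + 1)| ≤ ε * R * (|e k| + ε * |D k|) := by gcongr
      have i5 : ε * R * (ε * |D k|) ≤ ε * R * |D k| := by
        have : ε * |D k| ≤ 1 * |D k| := by gcongr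
        have h0 : 0 ≤ ε * R := by positivity
        nlinarith
      have i6 : |e (k + 1)| + |D (k + 1)| ≤ (1 + ε * (R + 1)) * (|e k| + |D k|) + ε * τ := by
        nlinarith [mul_nonneg hε a1, mul_nonneg hε a2]
      calc |e (k + 1)| + |D (k + 1)| ≤ (1 + ε * (R + 1)) * (|e k| + |D k|) + ε * τ := i6
        _ ≤ (1 + ε * (R + 1)) * ((|e 0| + |D 0| + k * ε * τ) * (1 + ε * (R + 1)) ^ k) +
            ε * τ * (1 + ε * (R + 1)) ^ (k + 1) := by
            exact add_le_add (mul_le_mul_of_nonneg_left i1 (by positivity))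
              (le_mul_of_one_le_right (by positivity) hpow)
        _ = (|e 0| + |D 0| + (k + 1 : ℕ) * ε * τ) * (1 + ε * (R + 1)) ^ (k + 1) := by
            push_cast; ring
  refine (key N le_rfl).trans ?_
  gcongr
  have := Real.add_one_le_exp (ε * (R + 1))
  calc (1 + ε * (R + 1)) ^ N ≤ (Real.exp (ε * (R + 1))) ^ N := by
        gcongr; linarith
    _ = Real.exp (N * ε * (R + 1)) := by rw [← Real.exp_nat_mul]; ring_nf

/-- The entries of friezes that converge to Hill's equation converge to the kernel, together with
their differences, locally uniformly. -/
theorem FriezeConverges.entries_local {T : ℝ} (hT : 0 < T) {v : ℕ → ℤ → ℤ → ℝ}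
    {q a b a' b' : ℝ → ℝ} (h : HillBasis q a b a' b') (hv : ∀ᶠ n in atTop, IsClosedFrieze n (v n))
    (hq : FriezeConverges T v q) {L : ℝ} (hL : 0 < L) {δ : ℝ} (hδ : 0 < δ) :
    ∀ᶠ n : ℕ in atTop, ∀ (i : ℤ) (N : ℕ), -L ≤ i * (T / n) → (i + N) * (T / n) ≤ L →
      |T / n * v n i (i + N) - kernel a b (i * (T / n)) ((i + N) * (T / n))| ≤ δ ∧
      |v n i (i + N + 1) - v n i (i + N) - (a (i * (T / n)) * b' ((i + N) * (T / n)) -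
        b (i * (T / n)) * a' ((i + N) * (T / n)))| ≤ δ := by
  obtain ⟨C, hC, HC⟩ := h.exists_kernel_taylor L
  obtain ⟨K, hK⟩ := (isCompact_Icc (a := -L) (b := L)).exists_bound_of_continuousOn
    h.smooth.continuous.continuousOn
  obtain ⟨M, hM⟩ := ((isCompact_Icc (a := -L) (b := L)).prod
    (isCompact_Icc (a := -L) (b := L))).exists_bound_of_continuousOn
    h.continuous_kernel.continuousOn
  have hK' : ∀ x, |x| ≤ L → |q x| ≤ |K| := fun x hx =>
    (hK x (abs_le.1 hx)).trans (le_abs_self K)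
  have hM' : ∀ x y, |x| ≤ L → |y| ≤ L → |kernel a b x y| ≤ |M| := fun x y hx hy =>
    (hM (x, y) ⟨abs_le.1 hx, abs_le.1 hy⟩).trans (le_abs_self M)
  set R := |K| + 1 with hR
  set X := Real.exp (2 * L * (R + 1)) with hX
  have hX0 : 0 < X := Real.exp_pos _
  have hX1 : 1 ≤ X := by rw [hX]; exact Real.one_le_exp (by positivity)
  -- the size of the consistency error
  set τ := δ / (2 * ((1 + 2 * L) * X)) with hτ
  have hτ0 : 0 < τ := by positivity
  -- The error in the potential, multiplied by the bound of the kernel, takes half of τ. The step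
  -- bound η leaves the other half for the two Taylor remainders, and makes the last passage from
  -- difference quotient to derivative cost at most δ/2.
  set θ := min 1 (τ / (2 * (|M| + 1))) with hθ
  have hθ0 : 0 < θ := by positivity
  have hθM : θ * |M| ≤ τ / 2 := by
    calc θ * |M| ≤ (τ / (2 * (|M| + 1))) * (|M| + 1) := by
          gcongr
          · exact min_le_right _ _
          · linarith
      _ = τ / 2 := by field_simp
  set η := min 1 (min (τ / (4 * C)) (δ / (2 * (C + |K| * |M| + 1)))) with hη
  have hη0 : 0 < η := by positivity
  filter_upwards [hv, hq θ hθ0, eventually_step hT hη0] with n hvn hqn hn i N hi hN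
  obtain ⟨-, hε, hεη⟩ := hn
  set ε := T / n with hεd
  have hε1 : ε ≤ 1 := hεη.le.trans (min_le_left _ _)
  have hε2 : C * ε ≤ τ / 4 := by
    have : ε ≤ τ / (4 * C) := hεη.le.trans ((min_le_right _ _).trans (min_le_left _ _))
    calc C * ε ≤ C * (τ / (4 * C)) := by gcongr
      _ = τ / 4 := by field_simp
  have hε3 : (C + |K| * |M|) * ε ≤ δ / 2 := by
    have h3 : ε ≤ δ / (2 * (C + |K| * |M| + 1)) :=
      hεη.le.trans ((min_le_right _ _).trans (min_le_right _ _))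
    calc (C + |K| * |M|) * ε ≤ (C + |K| * |M| + 1) * (δ / (2 * (C + |K| * |M| + 1))) :=
          mul_le_mul (by linarith) h3 hε.le (by positivity)
      _ = δ / 2 := by field_simp
  set x : ℝ := i * ε with hx
  set F : ℕ → ℝ := fun k => kernel a b x ((i + k) * ε) with hF
  set e : ℕ → ℝ := fun k => ε * v n i (i + k) - F k with he
  set D : ℕ → ℝ := fun k => (e (k + 1) - e k) / ε with hD
  have hpt : ∀ k : ℕ, k ≤ N → |((i : ℝ) + k) * ε| ≤ L := by
    intro k hk
    have hk' : (k : ℝ) ≤ N := by exact_mod_cast hk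
    have hk0 : (0 : ℝ) ≤ k := Nat.cast_nonneg k
    rw [abs_le]
    constructor <;> nlinarith
  have hxL : |x| ≤ L := by
    have := hpt 0 (Nat.zero_le _)
    rwa [Nat.cast_zero, add_zero] at this
  have hshift : ∀ k : ℕ, ((i : ℝ) + (k + 1 : ℕ)) * ε = (i + k) * ε + ε := fun k => by
    push_cast; ring
  have hshift' : ∀ k : ℕ, ((i : ℝ) + k) * ε = (i + (k + 1 : ℕ)) * ε + -ε := fun k => by
    push_cast; ring
  have hεa : |ε| = ε := abs_of_pos hε
  have hNε : N * ε ≤ 2 * L := by linarith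
  have r1 : ∀ k < N, e (k + 1) = e k + ε * D k := fun k _ => by
    simp only [hD]; field_simp; ring
  have r2 : ∀ k < N, |D (k + 1) - D k| ≤ ε * (R * |e (k + 1)| + τ) := by
    intro k hk
    have hy := hpt (k + 1) hk
    set y : ℝ := (i + (k + 1 : ℕ)) * ε with hyd
    have t1 := HC x y ε hxL hy (by rw [hεa]; exact hε1)
    have t2 := HC x y (-ε) hxL hy (by rw [abs_neg, hεa]; exact hε1)
    rw [abs_neg] at t2
    rw [hεa] at t1 t2
    have F1 : kernel a b x (y + ε) = F (k + 2) := by simp only [hF, hyd]; congr 1; push_cast; ring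
    have F2 : kernel a b x (y + -ε) = F k := by simp only [hF, hyd]; congr 1; push_cast; ring
    have F3 : kernel a b x y = F (k + 1) := rfl
    rw [F1, F3] at t1
    rw [F2, F3] at t2
    have hc := hqn (i + (k + 1 : ℕ))
    have hrec := hvn.recurrence i (i + (k + 1 : ℕ))
    set c := v n (i + (k + 1 : ℕ) - 1) (i + (k + 1 : ℕ) + 1) with hcd
    have hcast : (((i + (k + 1 : ℕ) : ℤ) : ℝ)) * ε = y := by simp only [hyd]; push_cast; ring
    rw [hcast] at hc
    have v1 : v n i (i + (k + 1 : ℕ) + 1) = v n i (i + (k + 2 : ℕ)) := by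
      congr 1; push_cast; ring
    have v2 : v n i (i + (k + 1 : ℕ) - 1) = v n i (i + k) := by
      congr 1; push_cast; ring
    rw [v1, v2] at hrec
    have hκ : |c - 2| ≤ ε ^ 2 * R := by
      have h5 := hK' y hy
      have h6 : |ε ^ 2 * q y| ≤ ε ^ 2 * |K| := by
        rw [abs_mul, abs_of_nonneg (sq_nonneg ε)]; gcongr
      have h7 := abs_add_le (c - 2 - ε ^ 2 * q y) (ε ^ 2 * q y)
      rw [sub_add_cancel] at h7
      have h8 : θ * ε ^ 2 ≤ 1 * ε ^ 2 := by gcongr; exact min_le_left _ _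
      rw [hR]; linarith
    have hm := hM' x y hxL hy
    rw [F3] at hm
    -- In the Taylor expansions at y + ε and y - ε the first order terms cancel and the second order
    -- terms add up to ε² q F, the continuous counterpart of (c - 2) v.
    have main : ε * (D (k + 1) - D k) = (c - 2) * e (k + 1) + (c - 2 - ε ^ 2 * q y) * F (k + 1) -
        ((F (k + 2) - F (k + 1) - ε * (a x * b' y - b x * a' y) - ε ^ 2 / 2 * (q y * F (k + 1))) +
        (F k - F (k + 1) - -ε * (a x * b' y - b x * a' y) -
          (-ε) ^ 2 / 2 * (q y * F (k + 1)))) := by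
      simp only [hD, he]
      rw [show k + 1 + 1 = k + 2 from rfl, hrec]
      field_simp
      ring
    have bound : ε * |D (k + 1) - D k| ≤ ε * (ε * (R * |e (k + 1)| + τ)) := by
      rw [← abs_of_pos hε, ← abs_mul, abs_of_pos hε, main]
      calc _ ≤ |(c - 2) * e (k + 1)| + |(c - 2 - ε ^ 2 * q y) * F (k + 1)| +
            (|F (k + 2) - F (k + 1) - ε * (a x * b' y - b x * a' y) -
              ε ^ 2 / 2 * (q y * F (k + 1))| + |F k - F (k + 1) - -ε * (a x * b' y - b x * a' y) -
          (-ε) ^ 2 / 2 * (q y * F (k + 1))|) := by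
            refine (abs_sub _ _).trans ?_
            exact add_le_add (abs_add_le _ _) (abs_add_le _ _)
        _ ≤ ε ^ 2 * R * |e (k + 1)| + θ * ε ^ 2 * |M| + (C * ε ^ 3 + C * ε ^ 3) := by
            rw [abs_mul, abs_mul]
            gcongr
        _ = ε ^ 2 * (R * |e (k + 1)| + θ * |M| + 2 * (C * ε)) := by ring
        _ ≤ ε ^ 2 * (R * |e (k + 1)| + τ / 2 + 2 * (τ / 4)) := by gcongr
        _ = _ := by ring
    exact le_of_mul_le_mul_left bound hε
  have e0 : e 0 = 0 := by
    simp only [he, hF, Nat.cast_zero, add_zero, hvn.zero_row, kernel, ← hx]; ring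
  have D0 : |D 0| ≤ τ := by
    have t1 := HC x x ε hxL hxL (by rw [hεa]; exact hε1)
    rw [hεa] at t1
    have k0 : kernel a b x x = 0 := by simp only [kernel]; ring
    rw [k0, h.wronskian x] at t1
    have F1 : F 1 = kernel a b x (x + ε) := by simp only [hF]; congr 1; push_cast; rw [hx]; ring
    have v1 : v n i (i + (1 : ℕ)) = 1 := by rw [Nat.cast_one]; exact hvn.one_row i
    have : ε * D 0 = -(kernel a b x (x + ε) - 0 - ε * 1 - ε ^ 2 / 2 * (q x * 0)) := by
      simp only [hD, zero_add, e0]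
      simp only [he, v1, F1]
      field_simp
      ring
    have b1 : ε * |D 0| ≤ C * ε ^ 3 := by
      rw [← abs_of_pos hε, ← abs_mul, abs_of_pos hε, this, abs_neg]; exact t1
    have b2 : ε * |D 0| ≤ ε * τ := by
      have : C * ε ^ 3 = ε * (C * ε * ε) := by ring
      have : C * ε * ε ≤ τ / 4 * 1 := by gcongr
      nlinarith
    exact le_of_mul_le_mul_left b2 hε
  have hfin := discrete_gronwall_pair hε.le hε1 (by positivity) hτ0.le r1 r2
  have hfin' : |e N| + |D N| ≤ δ / 2 := by
    refine hfin.trans ?_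
    rw [e0, abs_zero, zero_add]
    calc (|D 0| + N * ε * τ) * Real.exp (N * ε * (R + 1)) ≤ (τ + 2 * L * τ) * X := by
          rw [hX]; gcongr
      _ = δ / 2 := by rw [hτ]; field_simp
  have hy := hpt N le_rfl
  refine ⟨by
    have := abs_nonneg (D N)
    change |e N| ≤ δ
    linarith, ?_⟩
  -- So far the differences of entries are compared with difference quotients of the kernel; one
  -- more expansion replaces these by the derivative.
  have t1 := HC x ((i + N) * ε) ε hxL hy (by rw [hεa]; exact hε1)
  rw [hεa] at t1
  have F1 : kernel a b x ((i + N) * ε + ε) = F (N + 1) := by rw [← hshift]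
  have F3 : kernel a b x ((i + N) * ε) = F N := rfl
  rw [F1, F3] at t1
  have vN : v n i (i + N + 1) = v n i (i + (N + 1 : ℕ)) := by congr 1; push_cast; ring
  set G := a x * b' ((i + N) * ε) - b x * a' ((i + N) * ε) with hG
  have main : ε * (v n i (i + N + 1) - v n i (i + N) - G) = ε * D N +
      (F (N + 1) - F N - ε * G - ε ^ 2 / 2 * (q ((i + N) * ε) * F N)) +
      ε ^ 2 / 2 * (q ((i + N) * ε) * F N) := by
    simp only [hD, he]
    rw [vN]
    field_simp
    ring
  have hm := hM' x _ hxL hy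
  rw [F3] at hm
  have hk := hK' _ hy
  have b1 : ε * |v n i (i + N + 1) - v n i (i + N) - G| ≤ ε * δ := by
    rw [← abs_of_pos hε, ← abs_mul, abs_of_pos hε, main]
    calc _ ≤ |ε * D N| + |F (N + 1) - F N - ε * G - ε ^ 2 / 2 * (q ((i + N) * ε) * F N)| +
          |ε ^ 2 / 2 * (q ((i + N) * ε) * F N)| := abs_add_three _ _ _
      _ ≤ ε * (δ / 2) + C * ε ^ 3 + ε ^ 2 / 2 * (|K| * |M|) := by
          rw [abs_mul, abs_mul (ε ^ 2 / 2), abs_mul (q _), hεa,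
            abs_of_nonneg (show 0 ≤ ε ^ 2 / 2 by positivity)]
          gcongr
          linarith [abs_nonneg (e N)]
      _ ≤ ε * (δ / 2) + C * ε ^ 2 * 1 + ε ^ 2 * (|K| * |M|) := by
          have : C * ε ^ 3 = C * ε ^ 2 * ε := by ring
          rw [this]
          gcongr
          linarith [sq_nonneg ε]
      _ = ε * (δ / 2 + (C + |K| * |M|) * ε) := by ring
      _ ≤ ε * (δ / 2 + δ / 2) := by gcongr
      _ = ε * δ := by ring
  exact le_of_mul_le_mul_left b1 hε

/-! ### Lattice approximation -/

theorem tendsto_floor_mul_step {T : ℝ} (hT : 0 < T) (x : ℝ) :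
    Tendsto (fun n : ℕ => (⌊x / (T / n)⌋ : ℝ) * (T / n)) atTop (𝓝 x) := by
  rw [Metric.tendsto_atTop']
  intro δ hδ
  obtain ⟨N, hN⟩ := eventually_atTop.1 (eventually_step hT hδ)
  refine ⟨N, fun n hn => ?_⟩
  obtain ⟨-, h1, h2⟩ := hN n hn.le
  have h3 := Int.floor_le (x / (T / n))
  have h4 := Int.lt_floor_add_one (x / (T / n))
  rw [le_div_iff₀ h1] at h3
  rw [div_lt_iff₀ h1] at h4
  rw [Real.dist_eq, abs_lt]
  constructor <;> linarith

theorem step_add {T : ℝ} {n : ℕ} (hn : 0 < n) (i : ℤ) :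
    ((i + n : ℤ) : ℝ) * (T / n) = i * (T / n) + T := by
  have : (n : ℝ) ≠ 0 := by positivity
  push_cast
  field_simp

/-- The limit of periodic sequences is periodic. -/
theorem ScaledLimit.periodic {T : ℝ} (hT : 0 < T) {p : ℕ → ℤ → ℝ} {q : ℝ → ℝ}
    (h : ScaledLimit T p q) (hp : ∀ᶠ n in atTop, ∀ i, p n (i + n) = p n i) (hq : Continuous q)
    (x : ℝ) : q (x + T) = q x := by
  have hlim : Tendsto (fun n : ℕ => |q ((⌊x / (T / n)⌋ : ℝ) * (T / n) + T) -
      q ((⌊x / (T / n)⌋ : ℝ) * (T / n))|) atTop (𝓝 |q (x + T) - q x|) := by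
    have h1 := tendsto_floor_mul_step hT x
    have h2 := (hq.tendsto (x + T)).comp (h1.add_const T)
    exact (h2.sub ((hq.tendsto x).comp h1)).abs
  have : |q (x + T) - q x| ≤ 0 := by
    refine le_of_forall_pos_le_add fun δ hδ => ?_
    refine le_of_tendsto hlim ?_
    filter_upwards [h (δ / 2) (by positivity), hp, eventually_step hT zero_lt_one] with n h1 h2 h3
    obtain ⟨h3, h4, -⟩ := h3
    set i := ⌊x / (T / n)⌋
    have e1 := h1 (i + n)
    have e2 := h1 i
    rw [h2, step_add h3] at e1
    have hpos : 0 < (T / n) ^ 2 := by positivity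
    have : (T / n) ^ 2 * |q (i * (T / n) + T) - q (i * (T / n))| ≤ (T / n) ^ 2 * (0 + δ) := by
      rw [← abs_of_pos hpos, ← abs_mul, abs_of_pos hpos]
      rw [abs_le] at e1 e2 ⊢
      constructor <;> linarith
    exact le_of_mul_le_mul_left this hpos
  have := abs_nonpos_iff.1 this
  linarith

/-- Discrete and continuous antiperiodicity match, so the absolute error is n-periodic in each index
and a fundamental domain in i and j - i suffices. -/
theorem entriesConverge_of_local {T : ℝ} {v : ℕ → ℤ → ℤ → ℝ} {F : ℝ → ℝ → ℝ}
    (hl : ∀ᶠ n in atTop, ∀ i j, v n (i + n) j = -v n i j)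
    (hr : ∀ᶠ n in atTop, ∀ i j, v n i (j + n) = -v n i j)
    (Fl : ∀ x y, F (x + T) y = -F x y) (Fr : ∀ x y, F x (y + T) = -F x y)
    (H : ∀ δ > 0, ∀ᶠ n : ℕ in atTop, ∀ i N : ℕ, i < n → N < n →
      |T / n * v n i (i + N) - F (i * (T / n)) ((i + N) * (T / n))| ≤ δ) :
    EntriesConverge T v F := by
  intro δ hδ
  filter_upwards [hl, hr, H δ hδ, eventually_gt_atTop 0] with n h1 h2 h3 hn i j
  set g : ℤ → ℤ → ℝ := fun i j => |T / n * v n i j - F (i * (T / n)) (j * (T / n))| with hg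
  have p1 : ∀ j, Function.Periodic (fun i => g i j) (n : ℤ) := fun j i => by
    simp only [hg]
    rw [h1, step_add hn, Fl, ← abs_neg]
    congr 1; ring
  have p2 : ∀ i, Function.Periodic (fun j => g i j) (n : ℤ) := fun i j => by
    simp only [hg]
    rw [h2, step_add hn, Fr, ← abs_neg]
    congr 1; ring
  obtain ⟨k, r, hr, rfl⟩ := exists_int_decomp hn i
  obtain ⟨k', N, hN, hj⟩ := exists_int_decomp hn (j - r)
  have e1 := (p1 j).int_mul k r
  have e2 := (p2 r).int_mul k' (r + N)
  simp only [Int.cast_id] at e1 e2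
  rw [show (r : ℤ) + k * n = n * k + r by ring] at e1
  rw [show (r : ℤ) + N + k' * n = j by linarith] at e2
  change g _ _ ≤ δ
  rw [e1, e2]
  have := h3 r N hr hN
  simp only [hg]
  push_cast
  exact this

theorem FriezeConverges.entriesConverge {T : ℝ} (hT : 0 < T) {v : ℕ → ℤ → ℤ → ℝ}
    {q a b a' b' : ℝ → ℝ} (h : HillBasis q a b a' b') (ha : ∀ x, a (x + T) = -a x)
    (hb : ∀ x, b (x + T) = -b x) (hv : ∀ᶠ n in atTop, IsClosedFrieze n (v n))
    (hq : FriezeConverges T v q) : EntriesConverge T v (kernel a b) := by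
  refine entriesConverge_of_local (hv.mono fun n hn => hn.anti_left)
    (hv.mono fun n hn => hn.anti_right) (fun x y => by simp only [kernel, ha, hb]; ring)
    (fun x y => by simp only [kernel, ha, hb]; ring) fun δ hδ => ?_
  filter_upwards [hq.entries_local hT h hv (show 0 < 2 * T by positivity) hδ,
    eventually_gt_atTop 0] with n hn hn0 i N hi hN
  have hn0' : (0 : ℝ) < n := by exact_mod_cast hn0
  have e : (n : ℝ) * (T / n) = T := by field_simp
  have hε : 0 < T / n := by positivity
  have hi' : (i : ℝ) ≤ n := by exact_mod_cast hi.le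
  have hN' : (N : ℝ) ≤ n := by exact_mod_cast hN.le
  have := (hn i N (by
    have : (0 : ℝ) ≤ ((i : ℤ) : ℝ) * (T / n) := by positivity
    linarith) (by push_cast; nlinarith)).1
  simpa using this

/-! ### Positivity -/

/-- Convergence of ε v does not decide signs near the rows of zeros. There the differences of
consecutive entries, which are close to a derivative near 1, exceed 1/2; the second row of zeros is
reduced to the first by the glide symmetry. In between, the kernel has a positive minimum by
compactness. -/
theorem FriezeConverges.eventually_positive {T : ℝ} (hT : 0 < T) {v : ℕ → ℤ → ℤ → ℝ}
    {q a b a' b' : ℝ → ℝ} (h : HillBasis q a b a' b')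
    (hpos : ∀ x y, x < y → y < x + T → 0 < kernel a b x y)
    (hv : ∀ᶠ n in atTop, IsClosedFrieze n (v n)) (hq : FriezeConverges T v q) :
    ∀ᶠ n in atTop, IsPositiveFrieze n (v n) := by
  have ca := h.continuous_fst
  have cb := h.continuous_snd
  have ca' := h.continuous_fst'
  have cb' := h.continuous_snd'
  set g : ℝ × ℝ → ℝ := fun p => a p.1 * b' (p.1 + p.2) - b p.1 * a' (p.1 + p.2) with hg
  have cg : Continuous g := by fun_prop
  have huc := ((isCompact_Icc (a := (0 : ℝ)) (b := 2 * T)).prod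
    (isCompact_Icc (a := (0 : ℝ)) (b := T))).uniformContinuousOn_of_continuous cg.continuousOn
  rw [Metric.uniformContinuousOn_iff_le] at huc
  obtain ⟨η, hη, Hη⟩ := huc (1 / 4) (by norm_num)
  set η' := min η (T / 3) with hη'
  have hη'0 : 0 < η' := by positivity
  have hη'T : η' ≤ T / 3 := min_le_right _ _
  have hG : ∀ x t, x ∈ Set.Icc 0 (2 * T) → 0 ≤ t → t ≤ η' → 3 / 4 ≤ g (x, t) := by
    intro x t hx h0 ht
    have := Hη (x, t) ⟨hx, h0, by linarith⟩ (x, 0) ⟨hx, le_rfl, hT.le⟩ (by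
      rw [Prod.dist_eq, dist_self, max_eq_right dist_nonneg, Real.dist_eq, sub_zero,
        abs_of_nonneg h0]
      exact ht.trans (min_le_left _ _))
    have e : g (x, 0) = 1 := by simp only [hg, add_zero]; exact h.wronskian x
    rw [e, Real.dist_eq, abs_le] at this
    linarith [this.1]
  set f : ℝ × ℝ → ℝ := fun p => kernel a b p.1 (p.1 + p.2) with hf
  have cf : Continuous f :=
    h.continuous_kernel.comp (by fun_prop : Continuous fun p : ℝ × ℝ => (p.1, p.1 + p.2))
  obtain ⟨z, hz, hzmin⟩ := ((isCompact_Icc (a := (0 : ℝ)) (b := T)).prod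
    (isCompact_Icc (a := η') (b := T - η'))).exists_isMinOn
    ⟨(0, η'), ⟨⟨le_rfl, hT.le⟩, ⟨le_rfl, by linarith⟩⟩⟩ cf.continuousOn
  have hμ : 0 < f z := hpos _ _ (by linarith [hz.2.1]) (by linarith [hz.2.2])
  set μ := f z
  have hmin : 0 < min (1 / 4) (μ / 2) := by positivity
  filter_upwards [hv, hq.entries_local hT h hv (show 0 < 4 * T by positivity) hmin,
    eventually_step hT hη'0] with n hn hloc hst
  obtain ⟨hn0, hε, hεη⟩ := hst
  have hn0' : (0 : ℝ) < n := by exact_mod_cast hn0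
  have enT : (n : ℝ) * (T / n) = T := by field_simp
  set ε := T / n
  -- The range 2n is needed because the glide symmetry starts the second use at i + N.
  have near : ∀ (i N : ℕ), i < 2 * n → (N : ℝ) * ε ≤ η' →
      (N : ℝ) / 2 ≤ v n (i : ℤ) ((i : ℤ) + N) := by
    intro i N hi
    have hi' : (i : ℝ) ≤ 2 * n := by exact_mod_cast hi.le
    have hi0 : (0 : ℝ) ≤ i * ε := by positivity
    have hi1 : (i : ℝ) * ε ≤ 2 * T := by nlinarith
    induction N with
    | zero => intro _; simp [hn.zero_row]
    | succ N ih =>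
      intro hN
      push_cast at hN
      have hN' : (N : ℝ) * ε ≤ η' := by nlinarith
      have h1 := ih hN'
      have h2 := (hloc i N (by push_cast; linarith) (by push_cast; nlinarith)).2
      have h3 := hG (i * ε) (N * ε) ⟨hi0, hi1⟩ (by positivity) hN'
      simp only [hg] at h3
      rw [← add_mul] at h3
      rw [abs_le] at h2
      have h4 := h2.1
      have h5 : min (1 / 4) (μ / 2) ≤ 1 / 4 := min_le_left _ _
      push_cast at h4 ⊢
      rw [← add_assoc]
      linarith
  have base : ∀ i N : ℕ, i < n → 0 < N → N < n → 0 < v n (i : ℤ) ((i : ℤ) + N) := by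
    intro i N hi hN0 hN
    have hN0' : (0 : ℝ) < N := by exact_mod_cast hN0
    rcases le_or_gt ((N : ℝ) * ε) η' with h1 | h1
    · have := near i N (by omega) h1
      linarith
    rcases le_or_gt ((n - N : ℕ) * ε : ℝ) η' with h2 | h2
    · have h3 := near (i + N) (n - N) (by omega) h2
      have h4 : (0 : ℝ) < ((n - N : ℕ) : ℝ) := by exact_mod_cast Nat.sub_pos_of_lt hN
      have h5 := hn.glide i (i + N)
      rw [← h5]
      push_cast at h3
      rw [Nat.cast_sub hN.le] at h3 h4
      rw [show (i : ℤ) + N + ((n - N : ℕ) : ℤ) = i + n by omega] at h3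
      linarith
    · rw [Nat.cast_sub hN.le, sub_mul, enT] at h2
      have hi' : (i : ℝ) ≤ n := by exact_mod_cast hi.le
      have hi0 : (0 : ℝ) ≤ i * ε := by positivity
      have hi1 : (i : ℝ) * ε ≤ T := by nlinarith
      have h3 := (hloc i N (by push_cast; linarith) (by push_cast; nlinarith)).1
      have h4 : μ ≤ f (i * ε, N * ε) :=
        hzmin ⟨⟨hi0, hi1⟩, ⟨h1.le, by change (N : ℝ) * ε ≤ T - η'; linarith⟩⟩
      simp only [hf] at h4
      rw [← add_mul] at h4
      rw [abs_le] at h3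
      have h5 := h3.1
      have h6 : min (1 / 4) (μ / 2) ≤ μ / 2 := min_le_right _ _
      push_cast at h5
      have h7 : 0 < ε * v n (i : ℤ) ((i : ℤ) + N) := by linarith
      exact pos_of_mul_pos_right h7 hε.le
  intro i j h1 h2
  obtain ⟨k, r, hr, rfl⟩ := exists_int_decomp hn0 i
  obtain ⟨N, hN⟩ := Int.eq_ofNat_of_zero_le (show 0 ≤ j - (n * k + r) by linarith)
  have per : Function.Periodic (fun i => v n i (i + N)) (n : ℤ) := fun i => by
    simp only
    rw [show i + (n : ℤ) + N = i + N + n by ring, hn.periodic]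
  have e := per.int_mul k r
  simp only [Int.cast_id] at e
  rw [show (r : ℤ) + k * n = n * k + r by ring] at e
  rw [show j = n * k + r + N by linarith, e]
  exact base r N hr (by omega) (by omega)

/-! ### Smooth limits of positive friezes -/

/-- The kernel of the limit equation inherits antiperiodicity and nonnegativity from the entries;
strictness comes from the Wronskian. -/
theorem FriezeConverges.exists_projCurve {T : ℝ} (hT : 0 < T) {v : ℕ → ℤ → ℤ → ℝ} {q : ℝ → ℝ}
    (hv : ∀ᶠ n in atTop, IsClosedFrieze n (v n) ∧ IsPositiveFrieze n (v n))
    (hqs : ContDiff ℝ ∞ q) (hq : FriezeConverges T v q) : ∃ γ : ProjCurve T, γ.hill = q := by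
  obtain ⟨a, b, a', b', h⟩ := exists_hillBasis hqs
  have hvc : ∀ᶠ n in atTop, IsClosedFrieze n (v n) := hv.mono fun n hn => hn.1
  -- entries at lattice points next to `x ≤ y`
  have hlim : ∀ x y, x ≤ y → Tendsto (fun n : ℕ => T / n * v n ⌊x / (T / n)⌋ ⌊y / (T / n)⌋) atTop
      (𝓝 (kernel a b x y)) := by
    intro x y hxy
    have h1 := tendsto_floor_mul_step hT x
    have h2 := tendsto_floor_mul_step hT y
    have h3 := (h.continuous_kernel.tendsto (x, y)).comp (h1.prodMk_nhds h2)
    refine tendsto_of_tendsto_of_dist h3 ?_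
    rw [Metric.tendsto_atTop']
    intro δ hδ
    set L := |x| + |y| + 1 with hL
    have hL0 : 0 < L := by positivity
    obtain ⟨M, hM⟩ := eventually_atTop.1 ((hq.entries_local hT h hvc hL0 (half_pos hδ)).and
      ((eventually_step hT one_pos).and ((h1.eventually (lt_mem_nhds (show x - 1 < x by linarith))).and
      (h2.eventually (gt_mem_nhds (show y < y + 1 by linarith))))))
    refine ⟨M, fun n hn => ?_⟩
    obtain ⟨hn1, ⟨hn0, hε, -⟩, hn3, hn4⟩ := hM n hn.le
    have hfl : ⌊x / (T / n)⌋ ≤ ⌊y / (T / n)⌋ := Int.floor_le_floor (by gcongr)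
    obtain ⟨N, hN⟩ := Int.eq_ofNat_of_zero_le (sub_nonneg.2 hfl)
    have hj : ⌊y / (T / n)⌋ = ⌊x / (T / n)⌋ + N := by linarith
    have hj' : (⌊y / (T / n)⌋ : ℝ) = ⌊x / (T / n)⌋ + N := by rw [hj]; push_cast; rfl
    have := (hn1 ⌊x / (T / n)⌋ N (by linarith [neg_abs_le x, abs_nonneg y]) (by
      rw [← hj']; linarith [le_abs_self y, abs_nonneg x])).1
    rw [← hj, ← hj'] at this
    rw [Real.dist_eq, sub_zero, abs_of_nonneg dist_nonneg, dist_comm, Real.dist_eq]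
    simp only [Function.comp]
    linarith
  have hnn : ∀ x y, x < y → y < x + T → 0 ≤ kernel a b x y := by
    intro x y h1 h2
    refine ge_of_tendsto (hlim x y h1.le) ?_
    have h3 : 0 < min (y - x) (x + T - y) := by
      rw [lt_min_iff]; constructor <;> linarith
    filter_upwards [hv, eventually_step hT h3] with n hn hst
    obtain ⟨hn0, hε, hεη⟩ := hst
    have hε1 := hεη.trans_le (min_le_left _ _)
    have hε2 := hεη.trans_le (min_le_right _ _)
    have l1 : ⌊x / (T / n)⌋ < ⌊y / (T / n)⌋ := by
      rw [Int.lt_iff_add_one_le, Int.le_floor]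
      push_cast
      have := Int.floor_le (x / (T / n))
      calc (⌊x / (T / n)⌋ : ℝ) + 1 ≤ x / (T / n) + 1 := by linarith
        _ = (x + T / n) / (T / n) := by field_simp
        _ ≤ y / (T / n) := by gcongr; linarith
    have l2 : ⌊y / (T / n)⌋ < ⌊x / (T / n)⌋ + n := by
      rw [Int.floor_lt]
      push_cast
      have := Int.lt_floor_add_one (x / (T / n))
      have hn0' : (0 : ℝ) < n := by exact_mod_cast hn0
      calc y / (T / n) ≤ (x + T - T / n) / (T / n) := by gcongr; linarith
        _ = x / (T / n) + n - 1 := by field_simp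
        _ < ⌊x / (T / n)⌋ + n := by linarith
    exact (mul_pos hε (hn.2 _ _ l1 l2)).le
  have hanti : ∀ x y, x ≤ y → kernel a b x (y + T) = -kernel a b x y := by
    intro x y hxy
    refine tendsto_nhds_unique (hlim x (y + T) (by linarith)) (((hlim x y hxy).neg).congr' ?_)
    filter_upwards [hvc, eventually_gt_atTop 0] with n hn hn0
    have hn0' : (0 : ℝ) < n := by exact_mod_cast hn0
    have : (y + T) / (T / n) = y / (T / n) + n := by field_simp
    rw [this, Int.floor_add_natCast, hn.anti_right]
    ring
  have hanti' : ∀ y, a (y + T) = -a y ∧ b (y + T) = -b y := by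
    intro y
    have e0 : ∀ x ≤ y, a x * (b (y + T) + b y) - b x * (a (y + T) + a y) = 0 := by
      intro x hx
      have := hanti x y hx
      simp only [kernel] at this
      linarith
    -- The vector Γ(y + T) + Γ(y) has zero bracket with Γ(x) for all x ≤ y, hence with Γ and Γ' at y
    -- - 1, which form a basis.
    have e1 : a' (y - 1) * (b (y + T) + b y) - b' (y - 1) * (a (y + T) + a y) = 0 := by
      refine (((h.fst (y - 1)).mul_const _).sub ((h.snd (y - 1)).mul_const _)).unique
        ((hasDerivAt_const (y - 1) (0 : ℝ)).congr_of_eventuallyEq ?_)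
      filter_upwards [gt_mem_nhds (show y - 1 < y by linarith)] with x hx using e0 x hx.le
    have e2 := e0 (y - 1) (by linarith)
    have w := h.wronskian (y - 1)
    constructor
    · have : a (y + T) + a y = 0 := by
        linear_combination a' (y - 1) * e2 - a (y - 1) * e1 - (a (y + T) + a y) * w
      linarith
    · have : b (y + T) + b y = 0 := by
        linear_combination b' (y - 1) * e2 - b (y - 1) * e1 - (b (y + T) + b y) * w
      linarith
  obtain ⟨γ, hγ⟩ := h.exists_projCurve hT (fun x => (hanti' x).1) (fun x => (hanti' x).2) (by
    intro x y h1 h2 h0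
    -- A zero of a nonnegative function is a minimum, so Γ(x) would have zero bracket with both Γ(y)
    -- and Γ'(y) and would vanish.
    have hmin : IsLocalMin (fun t => kernel a b x t) y := by
      filter_upwards [Ioo_mem_nhds h1 h2] with t ht
      rw [h0]
      exact hnn x t ht.1 ht.2
    have hd := hmin.hasDerivAt_eq_zero (h.hasDerivAt_kernel_right x y)
    have w := h.wronskian y
    have hN := h.normSq_pos x
    simp only [kernel] at h0
    have ha0 : a x = 0 := by
      linear_combination (-a' y) * h0 + a y * hd - a x * w
    have hb0 : b x = 0 := by
      linear_combination (-b' y) * h0 + b y * hd - b x * w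
    rw [ha0, hb0] at hN
    norm_num at hN)
  refine ⟨γ, ?_⟩
  have l0 : (fun x => γ.lift x 0) = a := funext fun x => by simp [hγ]
  have l1 : (fun x => γ.lift x 1) = b := funext fun x => by simp [hγ]
  have hb := γ.hillBasis
  rw [l0, l1] at hb
  have d0 : (fun x => deriv γ.lift x 0) = a' := funext fun x => (hb.fst x).unique (h.fst x)
  have d1 : (fun x => deriv γ.lift x 1) = b' := funext fun x => (hb.snd x).unique (h.snd x)
  rw [d0, d1] at hb
  funext x
  have e0 := (hb.fst' x).unique (h.fst' x)
  have e1 := (hb.snd' x).unique (h.snd' x)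
  have w := h.wronskian x
  linear_combination b' x * e0 - a' x * e1 - (γ.hill x - q x) * w

/-! ### Limits of sums along the rows of friezes -/

/-- Riemann sums with step `T / n`, uniformly in the indices `j` with `S n j`. -/
theorem riemann_sums_close {T : ℝ} (hT : 0 < T) {h : ℝ → ℝ × ℝ → ℝ}
    (hc : Continuous fun z : ℝ × ℝ × ℝ => h z.1 z.2) (L : ℝ) {K : Set (ℝ × ℝ)} (hK : IsCompact K)
    {ι : Type*} {S : ℕ → ι → Prop} {p : ℕ → ι → ℝ × ℝ} {i : ℕ → ι → ℤ} {N : ℕ → ι → ℕ}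
    {f : ℕ → ι → ℕ → ℝ}
    (hp : ∀ᶠ n in atTop, ∀ j, S n j → p n j ∈ K ∧ -L ≤ i n j * (T / n) ∧
      (i n j + N n j) * (T / n) ≤ L)
    (hf : ∀ δ > 0, ∀ᶠ n in atTop, ∀ j, S n j → ∀ l < N n j,
      |f n j l - h ((i n j + l) * (T / n)) (p n j)| ≤ δ) {δ : ℝ} (hδ : 0 < δ) :
    ∀ᶠ n in atTop, ∀ j, S n j → |∑ l ∈ Finset.range (N n j), T / n * f n j l -
      ∫ s in (i n j * (T / n))..((i n j + N n j) * (T / n)), h s (p n j)| ≤ δ := by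
  have hδ' : 0 < δ / (4 * |L| + 1) := by positivity
  obtain ⟨η, hη, H⟩ := exists_riemann_sum_bound hc (L := L) hK hδ'
  filter_upwards [hp, hf _ hδ', eventually_step hT hη] with n h1 h2 h3 j hj
  obtain ⟨h4, h5, h6⟩ := h1 j hj
  refine (H _ h3.2.1 h3.2.2 _ h4 _ _ _ h5 h6 (h2 j hj)).trans ?_
  calc 4 * L * (δ / (4 * |L| + 1)) ≤ (4 * |L| + 1) * (δ / (4 * |L| + 1)) := by
        gcongr; linarith [le_abs_self L]
    _ = δ := by field_simp

/-- Riemann sums over a period. -/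
theorem tendsto_riemann_sum {T : ℝ} (hT : 0 < T) {g : ℝ → ℝ} (hg : Continuous g)
    {f : ℕ → ℕ → ℝ} (hf : ∀ δ > 0, ∀ᶠ n : ℕ in atTop, ∀ l < n, |f n l - g (l * (T / n))| ≤ δ) :
    Tendsto (fun n : ℕ => ∑ l ∈ Finset.range n, T / n * f n l) atTop
      (𝓝 (∫ s in (0 : ℝ)..T, g s)) := by
  rw [Metric.tendsto_nhds]
  intro δ hδ
  have := riemann_sums_close (ι := Unit) (S := fun _ _ => True) hT (h := fun s _ => g s)
    (by fun_prop) T (K := {0}) isCompact_singleton (p := fun n _ => 0) (i := fun _ _ => 0)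
    (N := fun n _ => n) (f := fun n _ l => f n l) ?_ ?_ (half_pos hδ)
  · filter_upwards [this, eventually_gt_atTop 0] with n h1 hn0
    have e : ((0 : ℤ) + (n : ℝ)) * (T / n) = T := by push_cast; field_simp; ring
    have h2 := h1 () trivial
    rw [e, Int.cast_zero, zero_mul] at h2
    rw [Real.dist_eq]
    linarith
  · filter_upwards [eventually_gt_atTop 0] with n hn0 _ _
    refine ⟨rfl, by simp [hT.le], ?_⟩
    push_cast
    rw [zero_add]
    exact le_of_eq (by field_simp)
  · intro δ hδ
    filter_upwards [hf δ hδ] with n hn _ _ l hl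
    simpa using hn l hl

theorem ScaledLimit.unifClose {T : ℝ} (hT : 0 < T) {p : ℕ → ℤ → ℝ} {q : ℝ → ℝ}
    (h : ScaledLimit T p q) :
    UnifClose (fun n k => p n k / (T / n) ^ 2) fun n (k : ℤ) => q (k * (T / n)) := by
  intro δ hδ
  filter_upwards [h δ hδ, eventually_step hT one_pos] with n h1 h2 k
  have hpos : 0 < (T / n) ^ 2 := pow_pos h2.2.1 2
  rw [show p n k / (T / n) ^ 2 - q (k * (T / n)) =
    (p n k - (T / n) ^ 2 * q (k * (T / n))) / (T / n) ^ 2 by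
      rw [sub_div, mul_div_cancel_left₀ _ hpos.ne'],
    abs_div, abs_of_pos hpos, div_le_iff₀ hpos]
  exact h1 k

theorem exists_abs_kernel_le {T : ℝ} (hT : 0 < T) {q a b a' b' : ℝ → ℝ}
    (h : HillBasis q a b a' b') (ha : ∀ x, a (x + T) = -a x) (hb : ∀ x, b (x + T) = -b x) :
    ∃ M, ∀ x y, |kernel a b x y| ≤ M := by
  obtain ⟨A, hA⟩ := exists_abs_le_of_antiperiodic hT h.continuous_fst ha
  obtain ⟨B, hB⟩ := exists_abs_le_of_antiperiodic hT h.continuous_snd hb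
  refine ⟨A * B + B * A, fun x y => (abs_sub _ _).trans ?_⟩
  rw [abs_mul, abs_mul]
  have := (abs_nonneg _).trans (hA 0)
  have := (abs_nonneg _).trans (hB 0)
  exact add_le_add (mul_le_mul (hA x) (hB y) (abs_nonneg _) (by assumption))
    (mul_le_mul (hB x) (hA y) (abs_nonneg _) (by assumption))

/-- The summands of the sums along rows converge uniformly. -/
theorem EntriesConverge.summand_close {T : ℝ} (hT : 0 < T) {q a b a' b' : ℝ → ℝ}
    (h : HillBasis q a b a' b') (ha : ∀ x, a (x + T) = -a x) (hb : ∀ x, b (x + T) = -b x)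
    {v : ℕ → ℤ → ℤ → ℝ} (hv : EntriesConverge T v (kernel a b)) {d : ℕ → ℤ → ℝ} {r : ℝ → ℝ}
    (hd : ScaledLimit T d r) (hr : ∃ M, ∀ x, |r x| ≤ M) :
    UnifClose (fun n (t : ℤ × (ℤ × ℤ) × (ℤ × ℤ)) => d n t.1 / (T / n) ^ 2 *
      (T / n * v n t.2.1.1 t.2.1.2 * (T / n * v n t.2.2.1 t.2.2.2)))
      fun n t => r (t.1 * (T / n)) * (kernel a b (t.2.1.1 * (T / n)) (t.2.1.2 * (T / n)) *
        kernel a b (t.2.2.1 * (T / n)) (t.2.2.2 * (T / n))) := by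
  obtain ⟨M, hM⟩ := exists_abs_kernel_le hT h ha hb
  obtain ⟨R, hR⟩ := hr
  have h1 : UnifClose (fun n (t : ℤ × (ℤ × ℤ) × (ℤ × ℤ)) => d n t.1 / (T / n) ^ 2)
      fun n t => r (t.1 * (T / n)) := fun δ hδ => (hd.unifClose hT δ hδ).mono fun n hn t => hn _
  have h2 : UnifClose (fun n (t : ℤ × (ℤ × ℤ) × (ℤ × ℤ)) => T / n * v n t.2.1.1 t.2.1.2)
      fun n t => kernel a b (t.2.1.1 * (T / n)) (t.2.1.2 * (T / n)) :=
    fun δ hδ => (hv δ hδ).mono fun n hn t => hn _ _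
  have h3 : UnifClose (fun n (t : ℤ × (ℤ × ℤ) × (ℤ × ℤ)) => T / n * v n t.2.2.1 t.2.2.2)
      fun n t => kernel a b (t.2.2.1 * (T / n)) (t.2.2.2 * (T / n)) :=
    fun δ hδ => (hv δ hδ).mono fun n hn t => hn _ _
  refine h1.mul (h2.mul h3 ⟨M, fun n t => hM _ _⟩ ⟨M, fun n t => hM _ _⟩) ⟨R, fun n t => hR _⟩
    ⟨M * M, fun n t => ?_⟩
  rw [abs_mul]
  exact mul_le_mul (hM _ _) (hM _ _) (abs_nonneg _) ((abs_nonneg _).trans (hM 0 0))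

section Limits

variable {T : ℝ} {q a b a' b' : ℝ → ℝ} {v w w' : ℕ → ℤ → ℤ → ℝ} {r r' : ℝ → ℝ}

theorem TangentConverges.periodic (hT : 0 < T)
    (hw : ∀ᶠ n in atTop, IsLinearTangent n (v n) (w n)) (hr : Continuous r)
    (h : TangentConverges T w r) (x : ℝ) : r (x + T) = r x := by
  refine ScaledLimit.periodic hT h (hw.mono fun n hn i => ?_) hr x
  rw [show i + (n : ℤ) - 1 = i - 1 + n by ring, show i + (n : ℤ) + 1 = i + 1 + n by ring,
    hn.periodic]

/-- Smooth limits of tangent vectors are tangent to the orbit. -/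
theorem TangentConverges.exists_vectorField (hT : 0 < T) (h : HillBasis q a b a' b')
    (ha : ∀ x, a (x + T) = -a x) (hb : ∀ x, b (x + T) = -b x)
    (hv : EntriesConverge T v (kernel a b))
    (hw : ∀ᶠ n in atTop, IsLinearTangent n (v n) (w n)) (hr : ContDiff ℝ ∞ r)
    (hwr : TangentConverges T w r) : ∃ X, IsVectorField T X ∧ ∀ x, r x = hillVar q X x := by
  have hper := hwr.periodic hT hw hr.continuous
  have hbd := exists_abs_le_of_periodic hT hr.continuous hper
  have hcl := EntriesConverge.summand_close hT h ha hb hv hwr hbd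
  refine h.exists_vectorField ha hb ⟨hr, hper⟩ fun x => ?_
  set g : ℝ → ℝ × ℝ → ℝ := fun s p => r s * (kernel a b p.1 s * kernel a b p.1 s) with hg
  have cg : Continuous fun z : ℝ × ℝ × ℝ => g z.1 z.2 := by
    have := hr.continuous
    have := h.continuous_fst
    have := h.continuous_snd
    simp only [hg, kernel]
    fun_prop
  have hfl := tendsto_floor_mul_step hT x
  set p : ℕ → ℝ × ℝ := fun n => ((⌊x / (T / n)⌋ : ℝ) * (T / n), 0) with hp
  have hlim : Tendsto (fun n => |∫ s in (0 : ℝ)..T, g s (p n)|) atTop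
      (𝓝 |∫ s in (0 : ℝ)..T, g s (x, 0)|) := by
    have c1 : Continuous fun p : ℝ × ℝ => ∫ s in (0 : ℝ)..T, g s p :=
      intervalIntegral.continuous_parametric_intervalIntegral_of_continuous'
        (f := fun p s => g s p) (cg.comp continuous_swap) 0 T
    exact ((c1.tendsto _).comp (hfl.prodMk_nhds tendsto_const_nhds)).abs
  -- At lattice points the discrete closure relation makes the Riemann sums vanish exactly; lattice
  -- points approaching x transfer this to the integral.
  have hzero : |∫ s in (0 : ℝ)..T, g s (x, 0)| ≤ 0 := by
    refine le_of_forall_pos_le_add fun δ hδ => le_of_tendsto hlim ?_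
    have := riemann_sums_close (ι := Unit) (S := fun _ _ => True) hT cg T
      (K := Set.Icc (x - 1) (x + 1) ×ˢ {0}) (isCompact_Icc.prod isCompact_singleton)
      (p := fun n _ => p n) (i := fun _ _ => 0) (N := fun n _ => n)
      (f := fun n _ l => w n ((l : ℤ) - 1) (l + 1) / (T / n) ^ 2 *
        (T / n * v n ⌊x / (T / n)⌋ l * (T / n * v n ⌊x / (T / n)⌋ l))) ?_ ?_ hδ
    · filter_upwards [this, hw, eventually_step hT one_pos] with n h1 h2 h3
      have h4 := h1 () trivial
      obtain ⟨hn0, hε, -⟩ := h3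
      have e : ((0 : ℤ) + (n : ℝ)) * (T / n) = T := by push_cast; field_simp; ring
      rw [e] at h4
      have e2 : ∑ l ∈ Finset.range n, T / n * (w n ((l : ℤ) - 1) (l + 1) / (T / n) ^ 2 *
        (T / n * v n ⌊x / (T / n)⌋ l * (T / n * v n ⌊x / (T / n)⌋ l))) = 0 := by
        have := h2.closure 0 ⌊x / (T / n)⌋ ⌊x / (T / n)⌋
        simp only [zero_add] at this
        rw [← mul_zero (T / n : ℝ), ← this, Finset.mul_sum]
        refine Finset.sum_congr rfl fun l _ => ?_
        field_simp
      rw [e2, zero_sub, abs_neg] at h4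
      simpa using h4
    · filter_upwards [hfl (Icc_mem_nhds (show x - 1 < x by linarith) (show x < x + 1 by linarith)),
        eventually_gt_atTop 0] with n h1 hn0 _ _
      refine ⟨⟨h1, rfl⟩, by simp [hT.le], ?_⟩
      push_cast
      rw [zero_add]
      exact le_of_eq (by field_simp)
    · intro δ hδ
      filter_upwards [hcl δ hδ] with n hn _ _ l _
      have := hn (l, (⌊x / (T / n)⌋, l), (⌊x / (T / n)⌋, l))
      simpa [hg, hp] using this
  have := abs_nonpos_iff.1 hzero
  simp only [hg] at this
  rw [← this]
  congr 1
  funext s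
  simp only [kernel]
  ring

/-- Convergence of the entries of tangent vectors. -/
theorem TangentConverges.entriesConverge (hT : 0 < T) (h : HillBasis q a b a' b')
    (ha : ∀ x, a (x + T) = -a x) (hb : ∀ x, b (x + T) = -b x)
    (hv : EntriesConverge T v (kernel a b))
    (hw : ∀ᶠ n in atTop, IsLinearTangent n (v n) (w n)) {X : ℝ → ℝ} (hX : IsVectorField T X)
    (hwr : TangentConverges T w (hillVar q X)) :
    EntriesConverge T w fun x y =>
      ((X x * a' x - deriv X x / 2 * a x) * b y - (X x * b' x - deriv X x / 2 * b x) * a y) +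
      (a x * (X y * b' y - deriv X y / 2 * b y) -
        b x * (X y * a' y - deriv X y / 2 * a y)) := by
  have hr := continuous_hillVar h.smooth hX.smooth
  have hper := hwr.periodic hT hw hr
  have hcl := EntriesConverge.summand_close hT h ha hb hv hwr
    (exists_abs_le_of_periodic hT hr hper)
  have ha' := deriv_antiperiodic ha h.fst
  have hb' := deriv_antiperiodic hb h.snd
  refine entriesConverge_of_local (hw.mono fun n hn => hn.anti_left)
    (hw.mono fun n hn => hn.anti_right)
    (fun x y => by simp only [ha, hb, ha', hb', hX.periodic, hX.deriv.periodic]; ring)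
    (fun x y => by simp only [ha, hb, ha', hb', hX.periodic, hX.deriv.periodic]; ring)
    fun δ hδ => ?_
  set g : ℝ → ℝ × ℝ → ℝ := fun s p => hillVar q X s * (kernel a b p.1 s * kernel a b s p.2) with hg
  have cg : Continuous fun z : ℝ × ℝ × ℝ => g z.1 z.2 := by
    have := h.continuous_fst
    have := h.continuous_snd
    simp only [hg, kernel]
    fun_prop
  have := riemann_sums_close (ι := ℕ × ℕ) (S := fun n t => t.1 < n ∧ t.2 < n) hT cg (2 * T)
    (K := Set.Icc 0 (2 * T) ×ˢ Set.Icc 0 (2 * T)) (isCompact_Icc.prod isCompact_Icc)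
    (p := fun n t => (t.1 * (T / n), (t.1 + t.2) * (T / n))) (i := fun _ t => t.1)
    (N := fun n t => t.2)
    (f := fun n t l => w n (t.1 + (l : ℤ) - 1) (t.1 + l + 1) / (T / n) ^ 2 *
        (T / n * v n t.1 (t.1 + l) * (T / n * v n (t.1 + l) (t.1 + t.2)))) ?_ ?_ hδ
  · filter_upwards [this, hw, eventually_step hT one_pos] with n h1 h2 h3 i N hi hN
    have hε := h3.2.1
    have h4 := h1 (i, N) ⟨hi, hN⟩
    simp only [Int.cast_natCast] at h4
    rw [h.integral_hillVar_kernel_kernel hX.smooth] at h4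
    -- The scaling fits a Riemann sum: ε d v v = ε (d/ε²)(ε v)(ε v).
    rw [h2.eq_sum, Finset.mul_sum]
    convert! h4 using 3
    refine Finset.sum_congr rfl fun l _ => ?_
    field_simp
  · filter_upwards [eventually_step hT one_pos] with n h3 t ht
    obtain ⟨hn0, hε, -⟩ := h3
    have hn0' : (0 : ℝ) < n := by exact_mod_cast hn0
    have e : (n : ℝ) * (T / n) = T := by field_simp
    have h1 : (t.1 : ℝ) ≤ n := by exact_mod_cast ht.1.le
    have h2 : (t.2 : ℝ) ≤ n := by exact_mod_cast ht.2.le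
    have p1 : 0 ≤ (t.1 : ℝ) * (T / n) := by positivity
    have p2 : 0 ≤ (t.2 : ℝ) * (T / n) := by positivity
    have p3 : (t.1 : ℝ) * (T / n) ≤ T := by nlinarith
    have p4 : (t.2 : ℝ) * (T / n) ≤ T := by nlinarith
    simp only [Int.cast_natCast, add_mul]
    exact ⟨⟨⟨p1, by linarith⟩, ⟨by positivity, by linarith⟩⟩,
      by linarith, by linarith⟩
  · intro δ hδ
    filter_upwards [hcl δ hδ] with n hn t _ l _
    have := hn (t.1 + l, (t.1, t.1 + l), (t.1 + l, t.1 + t.2))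
    simpa [hg] using this

/-- The limit of the cluster form. -/
theorem tendsto_clusterForm (hT : 0 < T) (h : HillBasis q a b a' b')
    (ha : ∀ x, a (x + T) = -a x) (hb : ∀ x, b (x + T) = -b x)
    (hv : EntriesConverge T v (kernel a b)) (hpos : ∀ᶠ n in atTop, IsPositiveFrieze n (v n))
    (hw : ∀ᶠ n in atTop, IsLinearTangent n (v n) (w n))
    (hw' : ∀ᶠ n in atTop, IsLinearTangent n (v n) (w' n))
    (hr : Continuous r) (hr' : Continuous r')
    (hwr : TangentConverges T w r) (hwr' : TangentConverges T w' r') (m : ℤ) :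
    Tendsto (fun n => clusterForm n m (v n) (w n) (w' n)) atTop
      (𝓝 (∫ y in (0 : ℝ)..T, r y * ∫ s in (0 : ℝ)..y, r' s * kernel a b s y ^ 2)) := by
  have hcl := EntriesConverge.summand_close hT h ha hb hv hwr'
    (exists_abs_le_of_periodic hT hr' (hwr'.periodic hT hw' hr'))
  have hd := ScaledLimit.unifClose hT hwr
  set g : ℝ → ℝ × ℝ → ℝ := fun s p => r' s * (kernel a b s p.1 * kernel a b s p.1) with hg
  have cg : Continuous fun z : ℝ × ℝ × ℝ => g z.1 z.2 := by
    have := h.continuous_fst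
    have := h.continuous_snd
    simp only [hg, kernel]
    fun_prop
  set I : ℝ → ℝ := fun y => ∫ s in (0 : ℝ)..y, g s (y, 0) with hI
  have cI : Continuous I :=
    intervalIntegral.continuous_parametric_intervalIntegral_of_continuous
      (f := fun y s => g s (y, 0))
      (cg.comp (by fun_prop : Continuous fun z : ℝ × ℝ => (z.2, z.1, (0 : ℝ)))) continuous_id
  have bounds : ∀ᶠ n : ℕ in atTop, ∀ l < n, (l : ℝ) * (T / n) ∈ Set.Icc 0 T := by
    filter_upwards [eventually_step hT one_pos] with n h3 l hl
    obtain ⟨hn0, hε, -⟩ := h3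
    have hn0' : (0 : ℝ) < n := by exact_mod_cast hn0
    have e : (n : ℝ) * (T / n) = T := by field_simp
    have h1 : (l : ℝ) ≤ n := by exact_mod_cast hl.le
    exact ⟨by positivity, by nlinarith⟩
  set J : ℕ → ℕ → ℝ := fun n k => ∑ l ∈ Finset.range k, T / n *
    (w' n ((l : ℤ) - 1) (l + 1) / (T / n) ^ 2 * (T / n * v n l k * (T / n * v n l k))) with hJ
  have inner : ∀ δ > 0, ∀ᶠ n : ℕ in atTop, ∀ k < n, |J n k - I (k * (T / n))| ≤ δ := by
    intro δ hδ
    have := riemann_sums_close (ι := ℕ) (S := fun n k => k < n) hT cg T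
      (K := Set.Icc 0 T ×ˢ {0}) (isCompact_Icc.prod isCompact_singleton)
      (p := fun n k => (k * (T / n), 0)) (i := fun _ _ => 0) (N := fun n k => k)
      (f := fun n k l => w' n ((l : ℤ) - 1) (l + 1) / (T / n) ^ 2 *
        (T / n * v n l k * (T / n * v n l k))) ?_ ?_ hδ
    · filter_upwards [this] with n h1 k hk
      have h4 := h1 k hk
      simp only [Int.cast_zero, zero_mul, zero_add] at h4
      exact h4
    · filter_upwards [bounds] with n hn k hk
      refine ⟨⟨hn k hk, rfl⟩, by simp [hT.le], ?_⟩
      simpa using (hn k hk).2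
    · intro δ hδ
      filter_upwards [hcl δ hδ] with n hn k _ l _
      have := hn (l, (l, k), (l, k))
      simpa [hg] using this
  obtain ⟨M1, hM1⟩ := (isCompact_Icc (a := (0 : ℝ)) (b := T)).exists_bound_of_continuousOn
    cI.continuousOn
  obtain ⟨M2, hM2⟩ := (isCompact_Icc (a := (0 : ℝ)) (b := T)).exists_bound_of_continuousOn
    hr.continuousOn
  set M := max M1 M2
  have hM0 : 0 ≤ M := ((norm_nonneg _).trans (hM1 0 ⟨le_rfl, hT.le⟩)).trans (le_max_left _ _)
  have outer : Tendsto (fun n : ℕ => ∑ l ∈ Finset.range n, T / n *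
      (w n ((l : ℤ) - 1) (l + 1) / (T / n) ^ 2 * J n l)) atTop
      (𝓝 (∫ y in (0 : ℝ)..T, r y * I y)) := by
    refine tendsto_riemann_sum hT (hr.mul cI) fun δ hδ => ?_
    have hp : 0 < min 1 (δ / (2 * M + 1)) := by positivity
    filter_upwards [hd _ hp, inner _ hp, bounds] with n h1 h2 h3 l hl
    have h4 := h1 l
    simp only [Int.cast_natCast] at h4
    have h5 := h3 l hl
    refine (abs_mul_sub_mul_le (M := M) h4 (h2 l hl) ((hM2 _ h5).trans (le_max_right _ _))
      ((hM1 _ h5).trans (le_max_left _ _)) (min_le_left _ _)).trans ?_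
    calc (2 * M + 1) * min 1 (δ / (2 * M + 1)) ≤ (2 * M + 1) * (δ / (2 * M + 1)) := by
          gcongr; exact min_le_right _ _
      _ = δ := by field_simp
  have e : (fun y => r y * ∫ s in (0 : ℝ)..y, r' s * kernel a b s y ^ 2) = fun y => r y * I y := by
    funext y
    simp only [hI, hg, pow_two]
  rw [e]
  refine outer.congr' ?_
  filter_upwards [hw, hw', hpos, eventually_step hT one_pos, eventually_ge_atTop 4]
    with n h2 h3 h4 h5 h6
  obtain ⟨hn0, hε, -⟩ := h5
  -- No power of ε is left over: d d' v² = ε (d/ε²) · ε (d'/ε²) · (ε v)².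
  rw [clusterForm_eq h2 h3 m h6 fun l hl hln => (h4 _ _ (by omega) (by omega)).ne']
  refine Finset.sum_congr rfl fun l _ => ?_
  simp only [hJ, Finset.mul_sum]
  refine Finset.sum_congr rfl fun k _ => ?_
  field_simp

end Limits

/-! ### Equidistant polygons inscribed in a curve -/

section Step

variable {T : ℝ} {q a b a' b' : ℝ → ℝ}

/-- The derivative of t ↦ [Γ(x), Γ(x + t)] at 0 is the Wronskian, and it stays within 1/2 of 1
uniformly in x by compactness of a period. The kernel can therefore serve as a distance along the
curve. -/
theorem HillBasis.exists_kernel_slope (h : HillBasis q a b a' b') (hT : 0 < T)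
    (ha : ∀ x, a (x + T) = -a x) (hb : ∀ x, b (x + T) = -b x) :
    ∃ η > 0, η ≤ 1 ∧ ∀ x s t, 0 ≤ s → s ≤ t → t ≤ η →
      1 / 2 * (t - s) ≤ kernel a b x (x + t) - kernel a b x (x + s) ∧
      kernel a b x (x + t) - kernel a b x (x + s) ≤ 3 / 2 * (t - s) := by
  have ca := h.continuous_fst
  have cb := h.continuous_snd
  have ca' := h.continuous_fst'
  have cb' := h.continuous_snd'
  have ha' := deriv_antiperiodic ha h.fst
  have hb' := deriv_antiperiodic hb h.snd
  set g : ℝ × ℝ → ℝ := fun p => a p.1 * b' (p.1 + p.2) - b p.1 * a' (p.1 + p.2) with hg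
  have cg : Continuous g := by fun_prop
  have huc := ((isCompact_Icc (a := (0 : ℝ)) (b := T)).prod
    (isCompact_Icc (a := (0 : ℝ)) (b := 1))).uniformContinuousOn_of_continuous cg.continuousOn
  rw [Metric.uniformContinuousOn_iff_le] at huc
  obtain ⟨η, hη, Hη⟩ := huc (1 / 2) (by norm_num)
  have hG : ∀ x t, 0 ≤ t → t ≤ min η 1 → |g (x, t) - 1| ≤ 1 / 2 := by
    intro x t h0 ht
    have per : Function.Periodic (fun x => g (x, t)) T := fun x => by
      simp only [hg, ha, hb, show x + T + t = x + t + T by ring, ha', hb']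
      ring
    obtain ⟨y, hy, e⟩ := per.exists_mem_Ico₀ hT x
    rw [e]
    have := Hη (y, t) ⟨⟨hy.1, hy.2.le⟩, h0, ht.trans (min_le_right _ _)⟩ (y, 0)
      ⟨⟨hy.1, hy.2.le⟩, le_rfl, zero_le_one⟩ (by
        rw [Prod.dist_eq, dist_self, max_eq_right dist_nonneg, Real.dist_eq, sub_zero,
          abs_of_nonneg h0]
        exact ht.trans (min_le_left _ _))
    have e : g (y, 0) = 1 := by simp only [hg, add_zero]; exact h.wronskian y
    rwa [e, Real.dist_eq] at this
  refine ⟨min η 1, by positivity, min_le_right _ _, fun x s t h0 hst ht => ?_⟩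
  have hd : ∀ t, HasDerivAt (fun t => kernel a b x (x + t)) (g (x, t)) t := fun t =>
    (h.hasDerivAt_kernel_right x (x + t)).comp_const_add x t
  have hcont : ContinuousOn (fun t => kernel a b x (x + t)) (Set.Icc 0 (min η 1)) :=
    fun t _ => (hd t).continuousAt.continuousWithinAt
  have hdiff : DifferentiableOn ℝ (fun t => kernel a b x (x + t))
      (interior (Set.Icc 0 (min η 1))) :=
    fun t _ => (hd t).differentiableAt.differentiableWithinAt
  have hbd : ∀ t ∈ interior (Set.Icc 0 (min η 1)), |deriv (fun t => kernel a b x (x + t)) t - 1|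
      ≤ 1 / 2 := fun t ht => by
    have ht := interior_subset ht
    rw [(hd t).deriv]
    exact hG x t ht.1 ht.2
  constructor
  · exact (convex_Icc 0 (min η 1)).mul_sub_le_image_sub_of_le_deriv hcont hdiff
      (fun t ht => by linarith [(abs_le.1 (hbd t ht)).1]) s ⟨h0, hst.trans ht⟩ t
      ⟨h0.trans hst, ht⟩ hst
  · exact (convex_Icc 0 (min η 1)).image_sub_le_mul_sub_of_deriv_le hcont hdiff
      (fun t ht => by linarith [(abs_le.1 (hbd t ht)).2]) s ⟨h0, hst.trans ht⟩ t
      ⟨h0.trans hst, ht⟩ hst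

theorem kernel_self (a b : ℝ → ℝ) (x : ℝ) : kernel a b x x = 0 := by
  simp only [kernel]; ring

/-- The step to the next point at given distance, where `kernel` measures distances. -/
theorem HillBasis.exists_step (h : HillBasis q a b a' b') (hT : 0 < T)
    (ha : ∀ x, a (x + T) = -a x) (hb : ∀ x, b (x + T) = -b x) :
    ∃ η > 0, ∃ g : ℝ → ℝ → ℝ, (Continuous fun p : ℝ × ℝ => g p.1 p.2) ∧
      (∀ x δ, g (x + T) δ = g x δ) ∧ ∀ x δ, 0 ≤ δ → δ ≤ η →
        kernel a b x (x + g x δ) = δ ∧ 2 / 3 * δ ≤ g x δ ∧ g x δ ≤ 2 * δ := by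
  obtain ⟨η, hη, -, H⟩ := h.exists_kernel_slope hT ha hb
  have ck : ∀ x, Continuous fun t => kernel a b x (x + t) := fun x =>
    h.continuous_kernel.comp (by fun_prop : Continuous fun t : ℝ => (x, x + t))
  -- Clamping makes the step a total function that is continuous on the whole plane. Distances up to
  -- η/2 are attained because the slope is at least 1/2.
  set cl : ℝ → ℝ := fun δ => max 0 (min δ (η / 2)) with hcl
  have ccl : Continuous cl := by fun_prop
  have hcl0 : ∀ δ, cl δ ∈ Set.Icc 0 (η / 2) := fun δ =>
    ⟨le_max_left _ _, max_le (by positivity) (min_le_right _ _)⟩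
  have ex : ∀ x δ, ∃ t ∈ Set.Icc 0 η, kernel a b x (x + t) = cl δ := by
    intro x δ
    have := (H x 0 η le_rfl hη.le le_rfl).1
    rw [add_zero, kernel_self, sub_zero, sub_zero] at this
    obtain ⟨t, ht, e⟩ := intermediate_value_Icc hη.le (ck x).continuousOn
      (show cl δ ∈ Set.Icc (kernel a b x (x + 0)) (kernel a b x (x + η)) by
        rw [add_zero, kernel_self]
        exact ⟨(hcl0 δ).1, (hcl0 δ).2.trans (by linarith)⟩)
    exact ⟨t, ht, e⟩
  choose g hg hgk using ex
  -- The lower slope bound makes the chosen step unique; its continuity and periodicity follow.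
  have near : ∀ x s t, s ∈ Set.Icc 0 η → t ∈ Set.Icc 0 η →
      |s - t| ≤ 2 * |kernel a b x (x + s) - kernel a b x (x + t)| := by
    intro x s t hs ht
    rcases le_total s t with hst | hst
    · have := (H x s t hs.1 hst ht.2).1
      rw [abs_sub_comm, abs_of_nonneg (sub_nonneg.2 hst), abs_sub_comm]
      linarith [le_abs_self (kernel a b x (x + t) - kernel a b x (x + s))]
    · have := (H x t s ht.1 hst hs.2).1
      rw [abs_of_nonneg (sub_nonneg.2 hst)]
      linarith [le_abs_self (kernel a b x (x + s) - kernel a b x (x + t))]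
  refine ⟨η / 2, by positivity, g, ?_, fun x δ => ?_, fun x δ h0 hδ => ?_⟩
  · refine continuous_iff_continuousAt.2 fun p => tendsto_iff_dist_tendsto_zero.2 ?_
    have c1 : Continuous fun p' : ℝ × ℝ =>
        2 * |cl p'.2 - kernel a b p'.1 (p'.1 + g p.1 p.2)| := by
      have := h.continuous_kernel.comp
        (by fun_prop : Continuous fun p' : ℝ × ℝ => (p'.1, p'.1 + g p.1 p.2))
      have := (ccl.comp _root_.continuous_snd).sub this
      exact continuous_const.mul this.abs
    have c2 := c1.tendsto p
    simp only [hgk, sub_self, abs_zero, mul_zero] at c2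
    refine squeeze_zero (fun _ => dist_nonneg) (fun p' => ?_) c2
    rw [Real.dist_eq]
    refine (near p'.1 _ _ (hg _ _) (hg _ _)).trans ?_
    rw [hgk]
  · have := near x _ _ (hg (x + T) δ) (hg x δ)
    have e : kernel a b x (x + g (x + T) δ) = cl δ := by
      rw [← hgk (x + T) δ, show x + T + g (x + T) δ = x + g (x + T) δ + T by ring]
      simp only [kernel, ha, hb]
      ring
    rw [e, hgk, sub_self, abs_zero, mul_zero] at this
    linarith [abs_nonpos_iff.1 this]
  · have e : cl δ = δ := by
      simp only [hcl]
      rw [min_eq_left hδ, max_eq_right h0]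
    have := H x 0 (g x δ) le_rfl (hg x δ).1 (hg x δ).2
    rw [hgk, e, add_zero, kernel_self] at this
    exact ⟨(hgk x δ).trans e, by linarith, by linarith⟩

/-- A shooting argument: the n-th point of the walk from 0 with steps of distance δ depends
continuously on δ, is at 0 for δ = 0 and, for large n, beyond T for the largest admissible δ. At an
intermediate δ the walk closes up after one period. -/
theorem HillBasis.exists_equidistant (h : HillBasis q a b a' b') (hT : 0 < T)
    (ha : ∀ x, a (x + T) = -a x) (hb : ∀ x, b (x + T) = -b x) :
    ∃ C > 0, ∀ᶠ n : ℕ in atTop, ∃ δ > 0, ∃ x : ℤ → ℝ, (∀ j, x (j + n) = x j + T) ∧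
      (∀ j, kernel a b (x j) (x (j + 1)) = δ) ∧ (∀ j, |x j - j * (T / n)| ≤ C * (T / n) ^ 2) ∧
      ∀ j, |x (j + 1) - x j - T / n| ≤ C * (T / n) ^ 3 := by
  obtain ⟨η, hη, g, cg, gT, Hg⟩ := h.exists_step hT ha hb
  obtain ⟨C, hC, HC⟩ := h.exists_kernel_taylor T
  refine ⟨54 * C * (T + 1), by positivity, ?_⟩
  filter_upwards [eventually_step hT (show 0 < min (1 / 3) (2 / 3 * η) by positivity)] with n hst
  obtain ⟨hn, hε, hεη⟩ := hst
  have hn' : (0 : ℝ) < n := by exact_mod_cast hn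
  have enT : (n : ℝ) * (T / n) = T := by field_simp
  have hε1 := hεη.trans_le (min_le_left _ _)
  have hε2 := hεη.trans_le (min_le_right _ _)
  set ε := T / n with hεdef
  set y : ℝ → ℕ → ℝ := fun δ k => (fun x => x + g x δ)^[k] 0 with hy
  have y0 : ∀ δ, y δ 0 = 0 := fun δ => rfl
  have ys : ∀ δ k, y δ (k + 1) = y δ k + g (y δ k) δ := fun δ k =>
    Function.iterate_succ_apply' _ _ _
  have cy : ∀ k, Continuous fun δ => y δ k := by
    intro k
    induction k with
    | zero => simp only [y0]; exact continuous_const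
    | succ k ih =>
      simp only [ys]
      exact ih.add (cg.comp (ih.prodMk continuous_id))
  have lo : ∀ δ, 0 ≤ δ → δ ≤ η → ∀ k : ℕ, k * (2 / 3 * δ) ≤ y δ k := by
    intro δ h0 h1 k
    induction k with
    | zero => simp [y0]
    | succ k ih => rw [ys]; push_cast; linarith [(Hg (y δ k) δ h0 h1).2.1]
  have hi : ∀ δ, 0 ≤ δ → δ ≤ η → ∀ k : ℕ, y δ k ≤ k * (2 * δ) := by
    intro δ h0 h1 k
    induction k with
    | zero => simp [y0]
    | succ k ih => rw [ys]; push_cast; linarith [(Hg (y δ k) δ h0 h1).2.2]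
  obtain ⟨δ, ⟨hδ0, hδη⟩, hyn⟩ : ∃ δ ∈ Set.Icc 0 η, y δ n = T := by
    refine intermediate_value_Icc hη.le (cy n).continuousOn ⟨?_, ?_⟩
    · have := hi 0 le_rfl hη.le n
      rw [mul_zero, mul_zero] at this
      exact this.trans hT.le
    · have := lo η hη.le le_rfl n
      change T ≤ y η n
      nlinarith
  have hstep := fun x => Hg x δ hδ0 hδη
  have hδε : δ ≤ 3 / 2 * ε := by
    have := lo δ hδ0 hδη n
    rw [hyn, ← enT] at this
    have := le_of_mul_le_mul_left this hn'
    linarith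
  have hεδ : ε ≤ 2 * δ := by
    have := hi δ hδ0 hδη n
    rw [hyn, ← enT] at this
    exact le_of_mul_le_mul_left this hn'
  have hmono : ∀ k, y δ k ≤ y δ (k + 1) := fun k => by
    rw [ys]; linarith [(hstep (y δ k)).2.1]
  have hrange : ∀ k ≤ n, y δ k ∈ Set.Icc 0 T := by
    intro k hk
    have := monotone_nat_of_le_succ hmono
    exact ⟨y0 δ ▸ this (Nat.zero_le k), hyn ▸ this hk⟩
  have hg0 : ∀ x, 0 ≤ g x δ ∧ g x δ ≤ 3 * ε := fun x => by
    have := hstep x; constructor <;> linarith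
  -- The quadratic Taylor term of t ↦ [Γ(x), Γ(x + t)] contains [Γ(x), Γ(x)] = 0, so steps differ
  -- from δ only in third order. Their sum T = nε then forces δ = ε + O(ε³).
  have hgδ : ∀ k ≤ n, |g (y δ k) δ - δ| ≤ 27 * C * ε ^ 3 := by
    intro k hk
    have h1 := hrange k hk
    have h2 := hg0 (y δ k)
    have h3 := HC (y δ k) (y δ k) (g (y δ k) δ) (by rw [abs_of_nonneg h1.1]; exact h1.2)
      (by rw [abs_of_nonneg h1.1]; exact h1.2) (by rw [abs_of_nonneg h2.1]; linarith)
    rw [(hstep _).1, kernel_self, h.wronskian, abs_of_nonneg h2.1] at h3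
    rw [abs_sub_comm]
    calc _ = |δ - 0 - g (y δ k) δ * 1 - g (y δ k) δ ^ 2 / 2 * (q (y δ k) * 0)| := by
          congr 1; ring
      _ ≤ C * g (y δ k) δ ^ 3 := h3
      _ ≤ C * (3 * ε) ^ 3 := by have := h2.1; gcongr; exact h2.2
      _ = _ := by ring
  have hsum : ∀ k ≤ n, |y δ k - k * δ| ≤ k * (27 * C * ε ^ 3) := by
    intro k
    induction k with
    | zero => simp [y0]
    | succ k ih =>
      intro hk
      have h1 := ih (by omega)
      have h2 := hgδ k (by omega)
      rw [ys]
      push_cast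
      rw [abs_le] at *
      constructor <;> linarith
  have hδ' : |δ - ε| ≤ 27 * C * ε ^ 3 := by
    have := hsum n le_rfl
    rw [hyn, ← enT, ← mul_sub, abs_mul, abs_of_pos hn'] at this
    rw [abs_sub_comm]
    exact le_of_mul_le_mul_left this hn'
  have hgε : ∀ k ≤ n, |g (y δ k) δ - ε| ≤ 54 * C * ε ^ 3 := fun k hk => by
    have := hgδ k hk
    rw [abs_le] at *
    constructor <;> linarith
  have hyε : ∀ k ≤ n, |y δ k - k * ε| ≤ 54 * C * T * ε ^ 2 := by
    intro k hk
    have h1 := hsum k hk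
    have hk' : (k : ℝ) ≤ n := by exact_mod_cast hk
    have h2 : |(k : ℝ) * δ - k * ε| ≤ k * (27 * C * ε ^ 3) := by
      rw [← mul_sub, abs_mul, Nat.abs_cast]
      gcongr
    have h3 : (k : ℝ) * (27 * C * ε ^ 3) ≤ 27 * C * T * ε ^ 2 := by
      calc (k : ℝ) * (27 * C * ε ^ 3) ≤ n * (27 * C * ε ^ 3) := by gcongr
        _ = 27 * C * (n * ε) * ε ^ 2 := by ring
        _ = _ := by rw [enT]
    rw [abs_le] at *
    constructor <;> linarith
  have hn0 : (n : ℤ) ≠ 0 := by omega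
  set x : ℤ → ℝ := fun j => y δ (j % n).toNat + (j / n : ℤ) * T with hx
  have xval : ∀ (k : ℤ) (r : ℕ), r ≤ n → x (n * k + r) = y δ r + k * T := by
    intro k r hr
    rcases hr.lt_or_eq with hr | rfl
    · have e1 : ((n : ℤ) * k + r) % n = r := by
        rw [Int.mul_add_emod_self_left, Int.emod_eq_of_lt (by omega) (by omega)]
      have e2 : ((n : ℤ) * k + r) / n = k := by
        rw [Int.mul_add_ediv_left _ _ hn0, Int.ediv_eq_zero_of_lt (by omega) (by omega), add_zero]
      simp only [hx, e1, e2, Int.toNat_natCast]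
    · have e1 : ((r : ℤ) * k + r) % r = 0 := by
        rw [Int.mul_add_emod_self_left, Int.emod_self]
      have e2 : ((r : ℤ) * k + r) / r = k + 1 := by
        rw [Int.mul_add_ediv_left _ _ hn0, Int.ediv_self hn0]
      simp only [hx, e1, e2, Int.toNat_zero, y0, hyn]
      push_cast
      ring
  have kT : ∀ (k : ℤ) s t, kernel a b (s + k * T) (t + k * T) = kernel a b s t := by
    intro k s t
    have per : Function.Periodic (fun z => kernel a b (s + z) (t + z)) T := fun z => by
      simp only [kernel, ← add_assoc, ha, hb]
      ring
    have := per.int_mul k 0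
    simpa using this
  have C1 : 54 * C * T ≤ 54 * C * (T + 1) := by gcongr; linarith
  have C2 : 54 * C ≤ 54 * C * (T + 1) := by nlinarith
  refine ⟨δ, by linarith, x, fun j => ?_, fun j => ?_, fun j => ?_, fun j => ?_⟩ <;>
    obtain ⟨k, r, hr, rfl⟩ := exists_int_decomp hn j
  · rw [show (n : ℤ) * k + r + n = n * (k + 1) + r by ring, xval _ r hr.le, xval _ r hr.le]
    push_cast
    ring
  · rw [show (n : ℤ) * k + r + 1 = n * k + (r + 1 : ℕ) by push_cast; ring, xval _ r hr.le,
      xval _ (r + 1) hr, kT, ys]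
    exact (hstep _).1
  · rw [xval _ r hr.le]
    push_cast
    have e : y δ r + k * T - (n * k + r) * ε = y δ r - r * ε := by
      rw [← enT]; ring
    rw [e]
    exact (hyε r hr.le).trans (by gcongr)
  · rw [show (n : ℤ) * k + r + 1 = n * k + (r + 1 : ℕ) by push_cast; ring, xval _ r hr.le,
      xval _ (r + 1) hr, ys]
    have e : y δ r + g (y δ r) δ + k * T - (y δ r + k * T) - ε = g (y δ r) δ - ε := by ring
    rw [e]
    exact (hgε r hr.le).trans (by gcongr)

end Step

/-! ### Friezes inscribed in a projective curve -/

section Inscribed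

variable {T : ℝ} {q a b a' b' : ℝ → ℝ}

theorem HillBasis.isVectorField (h : HillBasis q a b a' b') (ha : ∀ x, a (x + T) = -a x)
    (hb : ∀ x, b (x + T) = -b x) : IsVectorField T q := by
  refine ⟨h.smooth, fun x => ?_⟩
  have e0 := deriv_antiperiodic (deriv_antiperiodic ha h.fst) h.fst' x
  have e1 := deriv_antiperiodic (deriv_antiperiodic hb h.snd) h.snd' x
  rw [ha] at e0
  rw [hb] at e1
  have w := h.wronskian x
  linear_combination (a' x) * e1 - (b' x) * e0 - (q (x + T) - q x) * w

theorem IsVectorField.exists_lipschitz (hT : 0 < T) (hq : IsVectorField T q) :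
    ∃ M ≥ 0, ∀ x y, |q x - q y| ≤ M * |x - y| := by
  obtain ⟨M, hM⟩ := exists_abs_le_of_periodic hT hq.deriv.smooth.continuous hq.deriv.periodic
  refine ⟨M, (abs_nonneg _).trans (hM 0), fun x y => ?_⟩
  exact convex_univ.norm_image_sub_le_of_norm_deriv_le
    (fun z _ => (hq.smooth.hasDerivAt_infty z).differentiableAt) (fun z _ => hM z)
    (Set.mem_univ y) (Set.mem_univ x)

/-- Expansion of the coefficient of `Γ(x)` in `Γ(x + t)` in the basis `Γ(x)`, `Γ'(x)`. -/
theorem HillBasis.exists_cosine_taylor (h : HillBasis q a b a' b') (hT : 0 < T)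
    (ha : ∀ x, a (x + T) = -a x) (hb : ∀ x, b (x + T) = -b x) (L : ℝ) :
    ∃ C > 0, ∀ x t, |x| ≤ L → |t| ≤ 1 →
      |a (x + t) * b' x - b (x + t) * a' x - 1 - t ^ 2 / 2 * q x| ≤ C * |t| ^ 3 := by
  obtain ⟨C1, hC1, H1⟩ := h.sol_fst.exists_taylor_bound h.smooth L
  obtain ⟨C2, hC2, H2⟩ := h.sol_snd.exists_taylor_bound h.smooth L
  obtain ⟨A, hA⟩ := exists_abs_le_of_antiperiodic hT h.continuous_fst'
    (deriv_antiperiodic ha h.fst)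
  obtain ⟨B, hB⟩ := exists_abs_le_of_antiperiodic hT h.continuous_snd'
    (deriv_antiperiodic hb h.snd)
  have hA0 := (abs_nonneg _).trans (hA 0)
  have hB0 := (abs_nonneg _).trans (hB 0)
  refine ⟨C1 * B + C2 * A + 1, by positivity, fun x t hx ht => ?_⟩
  have w := h.wronskian x
  have e : a (x + t) * b' x - b (x + t) * a' x - 1 - t ^ 2 / 2 * q x =
      (a (x + t) - a x - t * a' x - t ^ 2 / 2 * (q x * a x)) * b' x -
      (b (x + t) - b x - t * b' x - t ^ 2 / 2 * (q x * b x)) * a' x := by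
    linear_combination (1 + t ^ 2 / 2 * q x) * w
  rw [e]
  refine (abs_sub _ _).trans ?_
  rw [abs_mul, abs_mul]
  have h1 := mul_le_mul (H1 x t hx ht) (hB x) (abs_nonneg _) (by positivity)
  have h2 := mul_le_mul (H2 x t hx ht) (hA x) (abs_nonneg _) (by positivity)
  have h3 : 0 ≤ |t| ^ 3 := by positivity
  linarith

/-- The polygon Γ(x_j)/√δ through equidistant points has unit brackets. Its potential is a sum of
two coefficients 1 + t²q/2 + O(t³) with t = ±ε + O(ε³). -/
theorem HillBasis.exists_friezes (h : HillBasis q a b a' b') (hT : 0 < T)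
    (ha : ∀ x, a (x + T) = -a x) (hb : ∀ x, b (x + T) = -b x) :
    ∃ v : ℕ → ℤ → ℤ → ℝ, (∀ᶠ n in atTop, IsClosedFrieze n (v n)) ∧ FriezeConverges T v q := by
  obtain ⟨C, hC, HC⟩ := h.exists_equidistant hT ha hb
  obtain ⟨K, hK, HK⟩ := h.exists_cosine_taylor hT ha hb (T + 1)
  have hq := h.isVectorField ha hb
  obtain ⟨M, hM, HM⟩ := hq.exists_lipschitz hT
  obtain ⟨Q, HQ⟩ := exists_abs_le_of_periodic hT hq.smooth.continuous hq.periodic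
  have hQ := (abs_nonneg _).trans (HQ 0)
  have key : ∀ᶠ n : ℕ in atTop, ∃ v, IsClosedFrieze n v ∧ ∀ j : ℤ,
      |v (j - 1) (j + 1) - 2 - (T / n) ^ 2 * q (j * (T / n))| ≤
        (16 * K + 3 * C * Q + M * C) * (T / n) ^ 3 := by
    filter_upwards [HC, eventually_step hT
      (show 0 < min (1 / 2) (1 / (C + 1)) by positivity)] with n hn hst
    obtain ⟨δ, hδ, x, xT, xδ, xε, xs⟩ := hn
    obtain ⟨hn0, hε, hεη⟩ := hst
    have hn' : (0 : ℝ) < n := by exact_mod_cast hn0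
    have enT : (n : ℝ) * (T / n) = T := by field_simp
    have hε1 := hεη.trans_le (min_le_left _ _)
    have hε2 := hεη.trans_le (min_le_right _ _)
    have hstepj : ∀ j : ℤ, (j : ℝ) * (T / n) + T = ((j + n : ℤ) : ℝ) * (T / n) := fun j =>
      (step_add hn0 j).symm
    set ε := T / n with hεdef
    have hCε : C * ε ≤ 1 := by
      rw [lt_div_iff₀ (by positivity)] at hε2
      nlinarith
    have hCε2 : C * ε ^ 2 ≤ 1 := by nlinarith
    have hCε3 : C * ε ^ 3 ≤ ε := by nlinarith [mul_nonneg hε.le hε.le]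
    have hs := Real.sqrt_pos.2 hδ
    have hss := Real.mul_self_sqrt hδ.le
    have hv := isClosedFrieze_of_polygon (n := n) (p := fun j => a (x j) / √δ)
      (s := fun j => b (x j) / √δ) (fun j => by simp only [xT, ha, neg_div])
      (fun j => by simp only [xT, hb, neg_div]) (fun j => by
        have := xδ j
        simp only [kernel] at this
        field_simp
        rw [this, Real.sq_sqrt hδ.le])
    set v : ℤ → ℤ → ℝ := fun i j => a (x i) / √δ * (b (x j) / √δ) -
      b (x i) / √δ * (a (x j) / √δ) with hvdef
    refine ⟨v, hv, fun j => ?_⟩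
    have per : Function.Periodic (fun j : ℤ => |v (j - 1) (j + 1) - 2 - ε ^ 2 * q (j * ε)|)
        (n : ℤ) := fun j => by
      simp only
      rw [show j + (n : ℤ) - 1 = j - 1 + n by ring, show j + (n : ℤ) + 1 = j + 1 + n by ring,
        hv.periodic, ← hstepj, hq.periodic]
    obtain ⟨k, r, hr, rfl⟩ := exists_int_decomp hn0 j
    have e := per.int_mul k r
    simp only [Int.cast_id] at e
    rw [show (r : ℤ) + k * n = n * k + r by ring] at e
    rw [e]
    clear e per
    set j : ℤ := (r : ℤ) with hj
    set y := x j
    set t := x (j + 1) - y with ht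
    set t' := x (j - 1) - y with ht'
    have s1 := xs j
    have s2 := xs (j - 1)
    rw [sub_add_cancel] at s2
    have hcube : 0 < ε ^ 3 := by positivity
    have t1 : |t - ε| ≤ C * ε ^ 3 := s1
    have t2 : |t' + ε| ≤ C * ε ^ 3 := by
      rw [← abs_neg]; convert! s2 using 2; simp only [ht', y]; ring
    have t3 : |t| ≤ 2 * ε := by
      rw [abs_le] at *; constructor <;> linarith
    have t4 : |t'| ≤ 2 * ε := by
      rw [abs_le] at *; constructor <;> linarith
    have hr' : (r : ℝ) ≤ n := by exact_mod_cast hr.le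
    have yL : |y| ≤ T + 1 := by
      have h1 := xε j
      have h2 : 0 ≤ (r : ℝ) * ε := by positivity
      have h3 : (r : ℝ) * ε ≤ T := by nlinarith
      simp only [hj, Int.cast_natCast] at h1
      rw [abs_le] at *
      constructor <;> linarith
    have T1 := HK y t yL (by linarith)
    have T2 := HK y t' yL (by linarith)
    have cube : ∀ z : ℝ, |z| ≤ 2 * ε → K * |z| ^ 3 ≤ 8 * K * ε ^ 3 := fun z hz => by
      calc K * |z| ^ 3 ≤ K * (2 * ε) ^ 3 := by gcongr
        _ = _ := by ring
    have Sq1 : |t ^ 2 - ε ^ 2| ≤ 3 * C * ε ^ 3 := by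
      have : |t + ε| ≤ 3 := by rw [abs_le] at *; constructor <;> linarith
      rw [show t ^ 2 - ε ^ 2 = (t - ε) * (t + ε) by ring, abs_mul]
      calc _ ≤ C * ε ^ 3 * 3 := by gcongr
        _ = _ := by ring
    have Sq2 : |t' ^ 2 - ε ^ 2| ≤ 3 * C * ε ^ 3 := by
      have : |t' - ε| ≤ 3 := by rw [abs_le] at *; constructor <;> linarith
      rw [show t' ^ 2 - ε ^ 2 = (t' + ε) * (t' - ε) by ring, abs_mul]
      calc _ ≤ C * ε ^ 3 * 3 := by gcongr
        _ = _ := by ring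
    have hqq : |ε ^ 2 * (q y - q (j * ε))| ≤ M * C * ε ^ 3 := by
      rw [abs_mul, abs_of_pos (by positivity : 0 < ε ^ 2)]
      calc ε ^ 2 * |q y - q (j * ε)| ≤ ε ^ 2 * (M * (C * ε ^ 2)) := by
            gcongr
            exact (HM _ _).trans (by gcongr; exact xε j)
        _ = M * C * ε ^ 3 * ε := by ring
        _ ≤ M * C * ε ^ 3 * 1 := by gcongr; linarith
        _ = _ := by ring
    have hqt : ∀ z, |z| ≤ 3 * C * ε ^ 3 → |z / 2 * q y| ≤ 3 / 2 * C * Q * ε ^ 3 := fun z hz => by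
      rw [abs_mul, abs_div, abs_two]
      calc |z| / 2 * |q y| ≤ 3 * C * ε ^ 3 / 2 * Q := by gcongr; exact HQ y
        _ = _ := by ring
    -- The potential c satisfies Γ(x_{j-1}) + Γ(x_{j+1}) = c Γ(x_j); the bracket with Γ'(x_j)
    -- isolates c.
    have hval : v (j - 1) (j + 1) = (a (y + t) * b' y - b (y + t) * a' y) +
        (a (y + t') * b' y - b (y + t') * a' y) := by
      have d1 := xδ j
      have d2 := xδ (j - 1)
      rw [sub_add_cancel] at d2
      have w := h.wronskian y
      have et : y + t = x (j + 1) := by simp only [ht]; ring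
      have et' : y + t' = x (j - 1) := by simp only [ht']; ring
      rw [et, et']
      simp only [kernel] at d1 d2
      have : a (x (j - 1)) * b (x (j + 1)) - b (x (j - 1)) * a (x (j + 1)) =
          δ * ((a (x (j + 1)) * b' y - b (x (j + 1)) * a' y) +
        (a (x (j - 1)) * b' y - b (x (j - 1)) * a' y)) := by
        linear_combination -(a (x (j - 1)) * b (x (j + 1)) - b (x (j - 1)) * a (x (j + 1))) * w +
          (a (x (j - 1)) * b' y - b (x (j - 1)) * a' y) * d1 +
          (a (x (j + 1)) * b' y - b (x (j + 1)) * a' y) * d2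
      simp only [hvdef]
      field_simp
      rw [Real.sq_sqrt hδ.le]
      linear_combination this
    have e : v (j - 1) (j + 1) - 2 - ε ^ 2 * q (j * ε) =
        (a (y + t) * b' y - b (y + t) * a' y - 1 - t ^ 2 / 2 * q y) +
        (a (y + t') * b' y - b (y + t') * a' y - 1 - t' ^ 2 / 2 * q y) +
        (t ^ 2 - ε ^ 2) / 2 * q y + (t' ^ 2 - ε ^ 2) / 2 * q y + ε ^ 2 * (q y - q (j * ε)) := by
      rw [hval]; ring
    rw [e]
    have A1 := T1.trans (cube t t3)
    have A2 := T2.trans (cube t' t4)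
    have A3 := hqt _ Sq1
    have A4 := hqt _ Sq2
    clear_value v y t t'
    rw [abs_le] at *
    constructor <;> linarith
  obtain ⟨v, hv⟩ := key.choice
  refine ⟨v, hv.mono fun n hn => hn.1, fun δ hδ => ?_⟩
  have hpos : 0 < δ / (16 * K + 3 * C * Q + M * C) := by positivity
  filter_upwards [hv, eventually_step hT hpos] with n hn hst i
  refine (hn.2 i).trans ?_
  have := hst.2.2.le
  rw [le_div_iff₀ (by positivity)] at this
  calc _ = (T / n * (16 * K + 3 * C * Q + M * C)) * (T / n) ^ 2 := by ring
    _ ≤ _ := by gcongr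

end Inscribed

/-! ### Tangent vectors with a given limit -/

theorem hillVar_periodic {T : ℝ} {q X : ℝ → ℝ} (hq : IsVectorField T q) (hX : IsVectorField T X)
    (x : ℝ) : hillVar q X (x + T) = hillVar q X x := by
  simp only [hillVar, hq.periodic, hq.deriv.periodic, hX.periodic, hX.deriv.periodic,
    hX.deriv.deriv.deriv.periodic]

/-- Linearly independent continuous functions have an invertible Gram matrix. -/
theorem det_gram_ne_zero {T : ℝ} (hT : 0 < T) {m : ℕ} {e : Fin m → ℝ → ℝ}
    (he : ∀ k, Continuous (e k))
    (hind : ∀ α : Fin m → ℝ, (∀ s ∈ Set.Icc 0 T, ∑ k, α k * e k s = 0) → α = 0) :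
    (Matrix.of fun k l => ∫ s in (0 : ℝ)..T, e k s * e l s).det ≠ 0 := by
  intro h0
  obtain ⟨α, hα, h1⟩ := Matrix.exists_mulVec_eq_zero_iff.2 h0
  refine hα (hind α ?_)
  -- A null vector of the Gram matrix is a combination of zero norm, which vanishes identically by
  -- continuity.
  have h2 : ∫ s in (0 : ℝ)..T, (∑ k, α k * e k s) ^ 2 = 0 := by
    have e1 : (fun s => (∑ k, α k * e k s) ^ 2) = fun s => ∑ k, ∑ l, α k * α l * (e k s * e l s) := by
      funext s
      rw [pow_two, Finset.sum_mul_sum]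
      exact Finset.sum_congr rfl fun k _ => Finset.sum_congr rfl fun l _ => by ring
    have e2 : ∀ k, ∑ l, (∫ s in (0 : ℝ)..T, e k s * e l s) * α l = 0 := fun k => congrFun h1 k
    have c2 : ∀ k l, Continuous fun s => α k * α l * (e k s * e l s) := fun k l => by fun_prop
    have c1 : ∀ k, Continuous fun s => ∑ l, α k * α l * (e k s * e l s) := fun k => by fun_prop
    rw [e1, intervalIntegral.integral_finsetSum fun k _ => (c1 k).intervalIntegrable _ _]
    refine Finset.sum_eq_zero fun k _ => ?_
    rw [intervalIntegral.integral_finsetSum fun l _ => (c2 k l).intervalIntegrable _ _]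
    simp only [intervalIntegral.integral_const_mul]
    refine Eq.trans ?_ (show α k * ∑ l, (∫ s in (0 : ℝ)..T, e k s * e l s) * α l = 0 by
      rw [e2 k, mul_zero])
    rw [Finset.mul_sum]
    exact Finset.sum_congr rfl fun l _ => by ring
  intro s hs
  by_contra hne
  have hc : Continuous fun s => (∑ k, α k * e k s) ^ 2 :=
    (continuous_finsetSum _ fun l _ => continuous_const.mul (he l)).pow 2
  exact (intervalIntegral.integral_pos hT hc.continuousOn (fun x _ => sq_nonneg _)
    ⟨s, hs, by positivity⟩).ne' h2

section Tangents

variable {T : ℝ} {q a b a' b' : ℝ → ℝ}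

/-- The two solutions vanish at 0 and at T/2 respectively, so these points isolate the coefficients
of the squares; T/4 then gives the mixed one. -/
theorem kernel_products_independent {a b : ℝ → ℝ} (hT : 0 < T)
    (hpos : ∀ x y, x < y → y < x + T → 0 < kernel a b x y) (α : Fin 3 → ℝ)
    (hα : ∀ s ∈ Set.Icc 0 T, ∑ k, α k * (![kernel a b 0, kernel a b 0, kernel a b (T / 2)] k s *
      ![kernel a b 0, kernel a b (T / 2), kernel a b (T / 2)] k s) = 0) : α = 0 := by
  have skew : ∀ x y, kernel a b y x = -kernel a b x y := fun x y => by simp only [kernel]; ring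
  have p1 := hpos 0 (T / 2) (by linarith) (by linarith)
  have p2 := hpos 0 (T / 4) (by linarith) (by linarith)
  have p3 := hpos (T / 4) (T / 2) (by linarith) (by linarith)
  have h0 := hα 0 ⟨le_rfl, hT.le⟩
  have h1 := hα (T / 2) ⟨by linarith, by linarith⟩
  have h2 := hα (T / 4) ⟨by linarith, by linarith⟩
  simp only [Fin.sum_univ_three, Matrix.cons_val_zero, Matrix.cons_val_one,
    Matrix.cons_val, kernel_self, skew 0 (T / 2), skew (T / 4) (T / 2)] at h0 h1 h2
  have a2 : α 2 = 0 := by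
    have : α 2 * (kernel a b 0 (T / 2) * kernel a b 0 (T / 2)) = 0 := by linarith
    exact (mul_eq_zero.1 this).resolve_right (by positivity)
  have a0 : α 0 = 0 := by
    have : α 0 * (kernel a b 0 (T / 2) * kernel a b 0 (T / 2)) = 0 := by linarith
    exact (mul_eq_zero.1 this).resolve_right (by positivity)
  have a1 : α 1 = 0 := by
    rw [a0, a2] at h2
    have : α 1 * (kernel a b 0 (T / 4) * kernel a b (T / 4) (T / 2)) = 0 := by linarith
    exact (mul_eq_zero.1 this).resolve_right (by positivity)
  funext k
  fin_cases k
  exacts [a0, a1, a2]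

/-- The linear system for the correction that makes an infinitesimal change of the potential
orthogonal to the functions `e k`. -/
theorem exists_correction {m : ℕ} {G : ℕ → Matrix (Fin m) (Fin m) ℝ}
    {G₀ : Matrix (Fin m) (Fin m) ℝ} (hG : Tendsto G atTop (𝓝 G₀)) (h0 : G₀.det ≠ 0)
    {B : ℕ → Fin m → ℝ} (hB : Tendsto B atTop (𝓝 0)) :
    ∃ α : ℕ → Fin m → ℝ, Tendsto α atTop (𝓝 0) ∧ ∀ᶠ n in atTop, B n + G n *ᵥ α n = 0 := by
  have cdet : Tendsto (fun n => (G n).det) atTop (𝓝 G₀.det) :=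
    ((continuous_id.matrix_det).tendsto G₀).comp hG
  have cadj : Tendsto (fun n => (G n).adjugate) atTop (𝓝 G₀.adjugate) :=
    ((continuous_id.matrix_adjugate).tendsto G₀).comp hG
  -- Cramer's rule gives a formula for all n, whose limit follows from continuity of determinant and
  -- adjugate.
  refine ⟨fun n k => -((G n).det⁻¹ * ∑ l, (G n).adjugate k l * B n l), ?_, ?_⟩
  · refine tendsto_pi_nhds.2 fun k => ?_
    have h1 : Tendsto (fun n => ∑ l, (G n).adjugate k l * B n l) atTop
        (𝓝 (∑ l, G₀.adjugate k l * 0)) := tendsto_finsetSum _ fun l _ =>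
      (tendsto_pi_nhds.1 (tendsto_pi_nhds.1 cadj k) l).mul (tendsto_pi_nhds.1 hB l)
    have h2 := ((cdet.inv₀ h0).mul h1).neg
    simpa only [mul_zero, Finset.sum_const_zero, neg_zero, Pi.zero_apply] using h2
  · filter_upwards [cdet.eventually_ne h0] with n hn
    have h1 : G n *ᵥ ((G n).adjugate *ᵥ B n) = (G n).det • B n := by
      rw [Matrix.mulVec_mulVec, Matrix.mul_adjugate, Matrix.smul_mulVec, Matrix.one_mulVec]
    funext k
    have h2 := congrFun h1 k
    simp only [Matrix.mulVec, dotProduct, Pi.smul_apply, smul_eq_mul, Pi.add_apply,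
      Pi.zero_apply] at h2 ⊢
    have h3 : ∑ l, G n k l * -((G n).det⁻¹ * ∑ l', (G n).adjugate l l' * B n l') =
        -((G n).det⁻¹ * ∑ l, G n k l * ∑ l', (G n).adjugate l l' * B n l') := by
      rw [Finset.mul_sum, ← Finset.sum_neg_distrib]
      exact Finset.sum_congr rfl fun l _ => by ring
    rw [h3, h2, ← mul_assoc, inv_mul_cancel₀ hn]
    ring

/-- The sampled variation satisfies the closure relations only approximately. A combination of three
products of rows, with coefficients tending to zero, makes them exact without changing the limit. -/
theorem exists_tangents (h : HillBasis q a b a' b') (hT : 0 < T)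
    (ha : ∀ x, a (x + T) = -a x) (hb : ∀ x, b (x + T) = -b x)
    (hpos : ∀ x y, x < y → y < x + T → 0 < kernel a b x y) {v : ℕ → ℤ → ℤ → ℝ}
    (hv : ∀ᶠ n in atTop, IsClosedFrieze n (v n)) (hvp : ∀ᶠ n in atTop, IsPositiveFrieze n (v n))
    (hve : EntriesConverge T v (kernel a b)) {X : ℝ → ℝ} (hX : IsVectorField T X) :
    ∃ w : ℕ → ℤ → ℤ → ℝ, (∀ᶠ n in atTop, IsFriezeTangent n (v n) (w n)) ∧
      TangentConverges T w (hillVar q X) := by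
  have hq := h.isVectorField ha hb
  have cr := continuous_hillVar hq.smooth hX.smooth
  have rper := hillVar_periodic hq hX
  set r := hillVar q X with hr
  obtain ⟨R, hR⟩ := exists_abs_le_of_periodic hT cr rper
  obtain ⟨M, hM⟩ := exists_abs_kernel_le hT h ha hb
  have hM0 := (abs_nonneg _).trans (hM 0 0)
  have ck : ∀ x, Continuous (kernel a b x) := fun x => (h.sol_kernel_right x).continuous
  have kT : ∀ x y, kernel a b x (y + T) = -kernel a b x y := fun x y => by
    simp only [kernel, ha, hb]; ring
  -- The rows 0 and 1 have the same scaled limit, so their products would give a singular Gram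
  -- matrix in the limit. A row half a period away stays independent.
  set i₀ : ℕ → ℤ := fun n => ⌊T / 2 / (T / n)⌋ with hi₀
  set P : ℕ → ℤ → ℝ := fun n l => T / n * v n 0 l with hP
  set Q : ℕ → ℤ → ℝ := fun n l => T / n * v n (i₀ n) l with hQ
  have closeP : UnifClose P fun n (l : ℤ) => kernel a b 0 (l * (T / n)) := fun δ hδ =>
    (hve δ hδ).mono fun n hn l => by simpa using hn 0 l
  have closeQ : UnifClose Q fun n (l : ℤ) => kernel a b (T / 2) (l * (T / n)) := by
    intro δ hδ
    obtain ⟨A, hA⟩ := exists_abs_le_of_antiperiodic hT h.continuous_fst ha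
    obtain ⟨B, hB⟩ := exists_abs_le_of_antiperiodic hT h.continuous_snd hb
    have hA0 := (abs_nonneg _).trans (hA 0)
    have hB0 := (abs_nonneg _).trans (hB 0)
    have hfl := tendsto_floor_mul_step hT (T / 2)
    have l1 := (((((h.continuous_fst.tendsto _).comp hfl).sub_const (a (T / 2))).abs.mul_const B).add
      ((((h.continuous_snd.tendsto _).comp hfl).sub_const (b (T / 2))).abs.mul_const A))
    simp only [sub_self, abs_zero, zero_mul, add_zero] at l1
    filter_upwards [hve (δ / 2) (half_pos hδ), l1.eventually (gt_mem_nhds (half_pos hδ))]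
      with n h1 h2 l
    have h3 := h1 (i₀ n) l
    simp only [Function.comp] at h2
    have h4 : |kernel a b (i₀ n * (T / n)) (l * (T / n)) - kernel a b (T / 2) (l * (T / n))| ≤
        δ / 2 := by
      refine le_trans ?_ h2.le
      rw [show kernel a b (i₀ n * (T / n)) (l * (T / n)) - kernel a b (T / 2) (l * (T / n)) =
        (a (i₀ n * (T / n)) - a (T / 2)) * b (l * (T / n)) -
        (b (i₀ n * (T / n)) - b (T / 2)) * a (l * (T / n)) by simp only [kernel]; ring]
      refine (abs_sub _ _).trans ?_
      rw [abs_mul, abs_mul]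
      gcongr
      exacts [hB _, hA _]
    calc _ ≤ _ := abs_sub_le _ (kernel a b (i₀ n * (T / n)) (l * (T / n))) _
      _ ≤ δ / 2 + δ / 2 := add_le_add h3 h4
      _ = δ := by ring
  set e : Fin 3 → ℝ → ℝ := fun k s =>
    ![kernel a b 0, kernel a b 0, kernel a b (T / 2)] k s *
      ![kernel a b 0, kernel a b (T / 2), kernel a b (T / 2)] k s with he
  set E : ℕ → Fin 3 → ℤ → ℝ := fun n k l => ![P n, P n, Q n] k l * ![P n, Q n, Q n] k l with hE
  have closeE : ∀ k, UnifClose (fun n l => E n k l) fun n (l : ℤ) => e k (l * (T / n)) := by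
    have bd : ∀ x, ∃ M, ∀ (n : ℕ) (l : ℤ), |kernel a b x (l * (T / n))| ≤ M :=
      fun x => ⟨M, fun n l => hM _ _⟩
    intro k
    fin_cases k
    · exact closeP.mul closeP (bd _) (bd _)
    · exact closeP.mul closeQ (bd _) (bd _)
    · exact closeQ.mul closeQ (bd _) (bd _)
  have eM : ∀ k s, |e k s| ≤ M * M := by
    intro k s
    simp only [he, abs_mul]
    fin_cases k <;> exact mul_le_mul (hM _ _) (hM _ _) (abs_nonneg _) hM0
  have ce : ∀ k, Continuous (e k) := by
    intro k
    fin_cases k <;> exact (ck _).mul (ck _)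
  have sol : ∀ k, ∫ s in (0 : ℝ)..T, r s * e k s = 0 := by
    intro k
    fin_cases k <;> exact integral_hillVar_period hq hX (h.sol_kernel_right _)
      (h.sol_kernel_right _) (kT _) (kT _)
  set G : ℕ → Matrix (Fin 3) (Fin 3) ℝ := fun n => Matrix.of fun k k' =>
    ∑ l ∈ Finset.range n, T / n * (E n k l * E n k' l) with hG
  have limG : Tendsto G atTop (𝓝 (Matrix.of fun k k' => ∫ s in (0 : ℝ)..T, e k s * e k' s)) := by
    refine tendsto_pi_nhds.2 fun k => tendsto_pi_nhds.2 fun k' => ?_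
    refine tendsto_riemann_sum hT ((ce k).mul (ce k')) fun δ hδ => ?_
    filter_upwards [(closeE k).mul (closeE k') ⟨M * M, fun n l => eM _ _⟩
      ⟨M * M, fun n l => eM _ _⟩ δ hδ] with n hn l _
    simpa using hn l
  set B : ℕ → Fin 3 → ℝ := fun n k =>
    ∑ l ∈ Finset.range n, T / n * (r (l * (T / n)) * E n k l) with hB
  have limB : Tendsto B atTop (𝓝 0) := by
    refine tendsto_pi_nhds.2 fun k => ?_
    rw [Pi.zero_apply, ← sol k]
    refine tendsto_riemann_sum hT (cr.mul (ce k)) fun δ hδ => ?_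
    have cr' : UnifClose (fun n (l : ℤ) => r (l * (T / n))) fun n (l : ℤ) => r (l * (T / n)) :=
      fun δ hδ => Eventually.of_forall fun n l => by simpa using hδ.le
    filter_upwards [cr'.mul (closeE k) ⟨R, fun n l => hR _⟩ ⟨M * M, fun n l => eM _ _⟩ δ hδ]
      with n hn l _
    simpa using hn l
  obtain ⟨α, hα, hsys⟩ := exists_correction limG
    (det_gram_ne_zero hT ce (kernel_products_independent hT hpos)) limB
  set d : ℕ → ℤ → ℝ := fun n l => (T / n) ^ 2 * (r (l * (T / n)) + ∑ k, α n k * E n k l) with hd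
  have key : ∀ᶠ n in atTop, ∃ w, IsFriezeTangent n (v n) w ∧ ∀ j, w (j - 1) (j + 1) = d n j := by
    filter_upwards [hv, hvp, hsys, eventually_step hT (show 0 < T / 4 by positivity),
      eventually_ge_atTop 4] with n hn hnp hs hst hn4
    obtain ⟨hn0, hε, hε4⟩ := hst
    have hn' : (0 : ℝ) < n := by exact_mod_cast hn0
    have enT : (n : ℝ) * (T / n) = T := by field_simp
    have hi : 0 < i₀ n ∧ i₀ n < 0 + n := by
      constructor
      · rw [Int.lt_iff_add_one_le, Int.le_floor, zero_add, Int.cast_one, le_div_iff₀ hε]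
        linarith
      · rw [Int.floor_lt, zero_add, Int.cast_natCast, div_lt_iff₀ hε]
        linarith
    have hne := (hnp 0 (i₀ n) hi.1 hi.2).ne'
    have orth : ∀ k, ∑ l ∈ Finset.range n, d n l * E n k l = 0 := by
      intro k
      have h1 := congrFun hs k
      simp only [Pi.add_apply, Pi.zero_apply, hB, hG, Matrix.mulVec, dotProduct, Matrix.of_apply,
        Finset.sum_mul] at h1
      rw [Finset.sum_comm, ← Finset.sum_add_distrib] at h1
      rw [← mul_zero (T / n : ℝ), ← h1, Finset.mul_sum]
      refine Finset.sum_congr rfl fun l _ => ?_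
      simp only [hd, Int.cast_natCast]
      rw [mul_assoc, add_mul, Finset.sum_mul, mul_add, mul_add, Finset.mul_sum, Finset.mul_sum]
      congr 1
      · ring
      · exact Finset.sum_congr rfl fun k' _ => by ring
    have o0 : ∑ l ∈ Finset.range n, d n l * v n 0 l * v n 0 l = 0 := by
      have := orth 0
      rw [← mul_zero ((T / n : ℝ) ^ 2)⁻¹, ← this, Finset.mul_sum]
      refine Finset.sum_congr rfl fun l _ => ?_
      simp only [hE, hP, Matrix.cons_val_zero]
      field_simp
    have o1 : ∑ l ∈ Finset.range n, d n l * v n 0 l * v n (i₀ n) l = 0 := by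
      have := orth 1
      rw [← mul_zero ((T / n : ℝ) ^ 2)⁻¹, ← this, Finset.mul_sum]
      refine Finset.sum_congr rfl fun l _ => ?_
      simp only [hE, hP, hQ, Matrix.cons_val_one, Matrix.cons_val_zero]
      field_simp
    have o2 : ∑ l ∈ Finset.range n, d n l * v n (i₀ n) l * v n (i₀ n) l = 0 := by
      have := orth 2
      rw [← mul_zero ((T / n : ℝ) ^ 2)⁻¹, ← this, Finset.mul_sum]
      refine Finset.sum_congr rfl fun l _ => ?_
      simp only [hE, hQ, Matrix.cons_val]
      field_simp
    -- Since v 0 i₀ ≠ 0, row 1 is a combination of rows 0 and i₀, which converts the orthogonality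
    -- relations into those that `exists_tangent` asks for.
    have v1 : ∀ l : ℤ, v n 1 l =
        (v n 0 (i₀ n))⁻¹ * (v n 1 (i₀ n) * v n 0 l +
          v n (i₀ n) l) := fun l => by
      have h1 := hn.eq_det 0 (i₀ n) l
      rw [zero_add] at h1
      field_simp
      linear_combination -h1
    refine exists_tangent hn (by omega) (fun k hk hkn => (hnp 0 k (by omega) (by omega)).ne')
      (fun j => ?_) o0 ?_ ?_
    · simp only [hd]
      have hs : ((j + n : ℤ) : ℝ) * (T / n) = j * (T / n) + T := step_add hn0 j
      rw [hs, rper]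
      congr 2
      refine Finset.sum_congr rfl fun k _ => ?_
      congr 1
      simp only [hE, hP, hQ]
      fin_cases k <;> simp [hn.anti_right]
    · have : ∀ l ∈ Finset.range n, d n l * v n 0 l * v n 1 l =
          (v n 0 (i₀ n))⁻¹ * v n 1 (i₀ n) * (d n l * v n 0 l * v n 0 l) +
          (v n 0 (i₀ n))⁻¹ * (d n l * v n 0 l * v n (i₀ n) l) := fun l _ => by
        rw [v1 l]; ring
      rw [Finset.sum_congr rfl this, Finset.sum_add_distrib, ← Finset.mul_sum, ← Finset.mul_sum,
        o0, o1]
      ring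
    · have : ∀ l ∈ Finset.range n, d n l * v n 1 l * v n 1 l =
          ((v n 0 (i₀ n))⁻¹ * v n 1 (i₀ n)) ^ 2 * (d n l * v n 0 l * v n 0 l) +
          2 * (v n 0 (i₀ n))⁻¹ ^ 2 * v n 1 (i₀ n) * (d n l * v n 0 l * v n (i₀ n) l) +
          (v n 0 (i₀ n))⁻¹ ^ 2 * (d n l * v n (i₀ n) l * v n (i₀ n) l) := fun l _ => by
        rw [v1 l]; ring
      rw [Finset.sum_congr rfl this, Finset.sum_add_distrib, Finset.sum_add_distrib,
        ← Finset.mul_sum, ← Finset.mul_sum, ← Finset.mul_sum, o0, o1, o2]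
      ring
  obtain ⟨w, hw⟩ := key.choice
  refine ⟨w, hw.mono fun n hn => hn.1, fun δ hδ => ?_⟩
  have lim : Tendsto (fun n => ∑ k, |α n k| * (M * M + 1)) atTop (𝓝 0) := by
    have := tendsto_finsetSum Finset.univ fun k _ =>
      ((tendsto_pi_nhds.1 hα k).abs.mul_const (M * M + 1))
    simpa using this
  have bdE : ∀ᶠ n in atTop, ∀ k l, |E n k l| ≤ M * M + 1 := by
    refine eventually_all.2 fun k => (closeE k 1 one_pos).mono fun n hn l => ?_
    have h1 := abs_sub_abs_le_abs_sub (E n k l) (e k (l * (T / n)))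
    linarith [hn l, eM k (l * (T / n))]
  filter_upwards [hw, lim.eventually (gt_mem_nhds hδ), bdE] with n h1 h2 h3 j
  rw [h1.2 j]
  simp only [hd]
  rw [mul_add, add_sub_cancel_left, abs_mul, abs_of_nonneg (sq_nonneg (T / n : ℝ)), mul_comm]
  refine mul_le_mul_of_nonneg_right ?_ (sq_nonneg _)
  refine (Finset.abs_sum_le_sum_abs _ _).trans (le_trans ?_ h2.le)
  refine Finset.sum_le_sum fun k _ => ?_
  rw [abs_mul]
  exact mul_le_mul_of_nonneg_left (h3 k j) (abs_nonneg _)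

end Tangents

/-! ### Functions with removable singularities -/

theorem intervalIntegrable_of_tendsto_nhdsNE {f : ℝ → ℝ} (hm : Measurable f)
    (h : ∀ x, ∃ l, Tendsto f (𝓝[≠] x) (𝓝 l)) (s t : ℝ) :
    IntervalIntegrable f MeasureTheory.volume s t := by
  have hl : MeasureTheory.LocallyIntegrable f := fun x => by
    obtain ⟨l, hl⟩ := h x
    refine MeasureTheory.Measure.FiniteAtFilter.integrableAtFilter_of_tendsto_ae
      hm.stronglyMeasurable.stronglyMeasurableAtFilter
      (MeasureTheory.Measure.finiteAt_nhds _ x) (hl.mono_left ?_)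
    rw [nhdsWithin]
    exact inf_le_inf_left _ (le_principal_iff.2
      (MeasureTheory.compl_mem_ae_iff.2 (MeasureTheory.measure_singleton x)))
  exact (hl.integrableOn_isCompact isCompact_uIcc).intervalIntegrable

theorem tendsto_div_of_zero {u v : ℝ → ℝ} {u' v' x : ℝ} (hu : HasDerivAt u u' x)
    (hv : HasDerivAt v v' x) (u0 : u x = 0) (v0 : v x = 0) (hv' : v' ≠ 0) :
    Tendsto (fun y => u y / v y) (𝓝[≠] x) (𝓝 (u' / v')) := by
  refine ((hasDerivAt_iff_tendsto_slope.1 hu).div (hasDerivAt_iff_tendsto_slope.1 hv) hv').congr' ?_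
  filter_upwards [self_mem_nhdsWithin] with y hy
  have : y - x ≠ 0 := sub_ne_zero.2 hy
  rw [Pi.div_apply, slope, slope, vsub_eq_sub, vsub_eq_sub, u0, v0, sub_zero, sub_zero, smul_eq_mul,
    smul_eq_mul]
  exact mul_div_mul_left _ _ (inv_ne_zero this)

/-! ### The density of the limit form -/

/-- The expression `X Y' - X' Y`. -/
def wronsk (X Y : ℝ → ℝ) (x : ℝ) : ℝ := X x * deriv Y x - deriv X x * Y x

/-- The component along `b` of the variation of the curve under the vector field `X d/dx`. -/
def variationComp (b b' X : ℝ → ℝ) (x : ℝ) : ℝ := X x * b' x - deriv X x / 2 * b x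

section Density

variable {T : ℝ} {q a b a' b' X Y : ℝ → ℝ}

theorem hasDerivAt_wronsk (hX : ContDiff ℝ ∞ X) (hY : ContDiff ℝ ∞ Y) (x : ℝ) :
    HasDerivAt (wronsk X Y) (wronsk X (deriv Y) x + wronsk (deriv X) Y x) x := by
  convert! ((hX.hasDerivAt_infty x).mul (hY.deriv_infty.hasDerivAt_infty x)).sub
    ((hX.deriv_infty.hasDerivAt_infty x).mul (hY.hasDerivAt_infty x)) using 1
  simp only [wronsk]
  ring

theorem deriv_wronsk_eq (x : ℝ) : wronsk X (deriv Y) x + wronsk (deriv X) Y x =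
    X x * deriv (deriv Y) x - deriv (deriv X) x * Y x := by
  simp only [wronsk]; ring

theorem hasDerivAt_variationComp (hs : IsHillSolution q b b') (hX : ContDiff ℝ ∞ X) (x : ℝ) :
    HasDerivAt (variationComp b b' X)
      (deriv X x / 2 * b' x + (X x * q x - deriv (deriv X) x / 2) * b x) x := by
  convert! ((hX.hasDerivAt_infty x).mul (hs.deriv' x)).sub
    (((hX.deriv_infty.hasDerivAt_infty x).div_const 2).mul (hs.deriv x)) using 1
  ring

theorem eq_zero_of_variationComp_eq_zero {x : ℝ} (hb' : b' x ≠ 0) (hb : b x = 0)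
    (h : variationComp b b' X x = 0) : X x = 0 := by
  rw [variationComp, hb, mul_zero, sub_zero] at h
  exact (mul_eq_zero.1 h).resolve_right hb'

theorem HillBasis.snd'_ne_zero (h : HillBasis q a b a' b') {x : ℝ} (hb : b x = 0) : b' x ≠ 0 := by
  intro h0
  have := h.wronskian x
  rw [hb, h0] at this
  norm_num at this

/-- A sign change over a period gives a zero. Two zeros of b at distance less than T would make the
kernel vanish there. -/
theorem HillBasis.exists_zero (h : HillBasis q a b a' b') (hT : 0 < T)
    (hb : ∀ x, b (x + T) = -b x) (hpos : ∀ x y, x < y → y < x + T → 0 < kernel a b x y) :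
    ∃ x₀, b x₀ = 0 ∧ ∀ x, b x = 0 → ∃ k : ℤ, x = x₀ + k * T := by
  obtain ⟨x₀, h0⟩ : ∃ x₀, b x₀ = 0 := by
    have h1 := hb 0
    rw [zero_add] at h1
    rcases le_total (b 0) 0 with h2 | h2
    · obtain ⟨x, -, hx⟩ := intermediate_value_Icc hT.le h.continuous_snd.continuousOn
        (show (0 : ℝ) ∈ Set.Icc (b 0) (b T) from ⟨h2, by linarith⟩)
      exact ⟨x, hx⟩
    · obtain ⟨x, -, hx⟩ := intermediate_value_Icc' hT.le h.continuous_snd.continuousOn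
        (show (0 : ℝ) ∈ Set.Icc (b T) (b 0) from ⟨by linarith, h2⟩)
      exact ⟨x, hx⟩
  refine ⟨x₀, h0, fun x hx => ⟨⌊(x - x₀) / T⌋, ?_⟩⟩
  set k := ⌊(x - x₀) / T⌋
  have per : Function.Periodic (fun x => b x ^ 2) T := fun x => by simp only [hb, neg_sq]
  have e : b (x - k * T) ^ 2 = 0 := by
    have := per.sub_int_mul_eq (x := x) k
    rw [this, hx]
    norm_num
  have e0 : b (x - k * T) = 0 := by simpa using e
  have h1 := Int.floor_le ((x - x₀) / T)
  have h2 := Int.lt_floor_add_one ((x - x₀) / T)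
  rw [le_div_iff₀ hT] at h1
  rw [div_lt_iff₀ hT] at h2
  change (k : ℝ) * T ≤ _ at h1
  change _ < ((k : ℝ) + 1) * T at h2
  rcases h1.lt_or_eq with h3 | h3
  · have := hpos x₀ (x - k * T) (by linarith) (by linarith)
    simp [kernel, h0, e0] at this
  · linarith

/-- The square of a solution, as a vector field, does not change the potential. -/
theorem HillBasis.exists_representative (h : HillBasis q a b a' b') (hT : 0 < T)
    (ha : ∀ x, a (x + T) = -a x) (hb : ∀ x, b (x + T) = -b x)
    (hpos : ∀ x y, x < y → y < x + T → 0 < kernel a b x y) (hX : IsVectorField T X) :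
    ∃ X₀, IsVectorField T X₀ ∧ (∀ x, b x = 0 → variationComp b b' X₀ x = 0) ∧
      ∀ x, hillVar q X₀ x = hillVar q X x := by
  obtain ⟨x₀, h0, hz⟩ := h.exists_zero hT hb hpos
  have ha0 : a x₀ ≠ 0 := by
    intro h1
    have := h.wronskian x₀
    rw [h0, h1] at this
    norm_num at this
  -- This multiple of a² cancels X at x₀, where a ≠ 0; the other zeros of b are translates by
  -- multiples of T.
  set m := X x₀ / a x₀ ^ 2 with hm
  set X₀ : ℝ → ℝ := fun x => X x - m * a x ^ 2 with hX₀
  have smooth : IsVectorField T X₀ :=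
    ⟨hX.smooth.sub (contDiff_const.mul (h.contDiff_fst.pow 2)), fun x => by
      simp only [hX₀, hX.periodic, ha, neg_sq]⟩
  refine ⟨X₀, smooth, fun x hx => ?_, fun x => ?_⟩
  · obtain ⟨k, rfl⟩ := hz x hx
    have e : X₀ (x₀ + k * T) = 0 := by
      have := (show Function.Periodic X₀ T from smooth.periodic).int_mul k x₀
      rw [this]
      simp only [hX₀, hm]
      field_simp
      ring
    rw [variationComp, e, hx]
    ring
  · have d1 : deriv X₀ = fun x => deriv X x - m * (2 * (a x * a' x)) := funext fun x => by
      refine HasDerivAt.deriv ?_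
      convert! (hX.smooth.hasDerivAt_infty x).sub (((h.fst x).pow 2).const_mul m) using 1
      push_cast
      ring
    have d2 : deriv (fun x => deriv X x - m * (2 * (a x * a' x))) =
        fun x => deriv (deriv X) x - m * (2 * (a' x * a' x + a x * (q x * a x))) :=
      funext fun x => HasDerivAt.deriv ((hX.deriv.smooth.hasDerivAt_infty x).sub
        ((((h.fst x).mul (h.fst' x)).const_mul 2).const_mul m))
    have d3 : deriv (fun x => deriv (deriv X) x -
        m * (2 * (a' x * a' x + a x * (q x * a x)))) x = deriv (deriv (deriv X)) x -
        m * (2 * (q x * a x * a' x + a' x * (q x * a x) + (a' x * (q x * a x) +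
          a x * (deriv q x * a x + q x * a' x)))) :=
      HasDerivAt.deriv ((hX.deriv.deriv.smooth.hasDerivAt_infty x).sub
        (((((h.fst' x).mul (h.fst' x)).add ((h.fst x).mul
          ((h.smooth.hasDerivAt_infty x).mul (h.fst x)))).const_mul 2).const_mul m))
    simp only [hillVar]
    rw [d1, d2, d3]
    simp only [hX₀]
    ring

/-- The integral of the density for vector fields that vanish at the zeros of `b`. -/
theorem HillBasis.integral_density (h : HillBasis q a b a' b') (hT : 0 < T)
    (hb : ∀ x, b (x + T) = -b x)
    (hpos : ∀ x y, x < y → y < x + T → 0 < kernel a b x y)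
    (hX : IsVectorField T X) (hY : IsVectorField T Y) (hX0 : ∀ x, b x = 0 → X x = 0)
    (hY0 : ∀ x, b x = 0 → Y x = 0) {D : ℝ → ℝ}
    (hD : ∀ x, b x ≠ 0 → D x = (variationComp b b' X x * deriv (variationComp b b' Y) x -
      deriv (variationComp b b' X) x * variationComp b b' Y x) / b x ^ 2) :
    IntervalIntegrable D MeasureTheory.volume 0 T ∧ ∫ x in (0 : ℝ)..T, D x =
      (∫ x in (0 : ℝ)..T, q x * (X x * deriv Y x - deriv X x * Y x)) +
        1 / 2 * ∫ x in (0 : ℝ)..T, deriv X x * deriv (deriv Y) x := by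
  obtain ⟨x₀, -, hz⟩ := h.exists_zero hT hb hpos
  have hcount : {x | b x = 0}.Countable :=
    (Set.countable_range fun k : ℤ => x₀ + k * T).mono fun x hx => by
      obtain ⟨k, hk⟩ := hz x hx
      exact ⟨k, hk.symm⟩
  have sX := hX.smooth
  have sY := hY.smooth
  have cb := h.continuous_snd
  have cb' := h.continuous_snd'
  have cq := h.smooth.continuous
  have cX := sX.continuous
  have cY := sY.continuous
  have cX1 := sX.deriv_infty.continuous
  have cY1 := sY.deriv_infty.continuous
  have cX2 := sX.deriv_infty.deriv_infty.continuous
  have cY2 := sY.deriv_infty.deriv_infty.continuous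
  have cw : Continuous (wronsk X Y) := by unfold wronsk; fun_prop
  set W : ℝ → ℝ := fun x => X x * deriv (deriv Y) x - deriv (deriv X) x * Y x with hW
  have cW : Continuous W := by fun_prop
  have dw : ∀ x, HasDerivAt (wronsk X Y) (W x) x := fun x => by
    have := hasDerivAt_wronsk sX sY x
    rwa [deriv_wronsk_eq] at this
  have w0 : ∀ x, b x = 0 → wronsk X Y x = 0 := fun x hx => by
    simp only [wronsk, hX0 x hx, hY0 x hx]; ring
  have W0 : ∀ x, b x = 0 → W x = 0 := fun x hx => by
    simp only [hW, hX0 x hx, hY0 x hx]; ring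
  have dW : ∀ x, ∃ W', HasDerivAt W W' x := fun x =>
    ⟨_, ((sX.hasDerivAt_infty x).mul (sY.deriv_infty.deriv_infty.hasDerivAt_infty x)).sub
      ((sX.deriv_infty.deriv_infty.hasDerivAt_infty x).mul (sY.hasDerivAt_infty x))⟩
  have limS : ∀ x, ∃ l, Tendsto (fun y => W y / b y) (𝓝[≠] x) (𝓝 l) := fun x => by
    by_cases hx : b x = 0
    · obtain ⟨W', hW'⟩ := dW x
      exact ⟨_, tendsto_div_of_zero hW' (h.snd x) (W0 x hx) hx (h.snd'_ne_zero hx)⟩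
    · exact ⟨_, ((cW.tendsto x).div (cb.tendsto x) hx).mono_left nhdsWithin_le_nhds⟩
  -- At a zero of b both XY' - X'Y and its derivative W vanish, while b has a simple zero;
  -- l'Hôpital's rule reduces the quotient to W/b.
  have limR : ∀ x, ∃ l, Tendsto (fun y => wronsk X Y y / b y ^ 2) (𝓝[≠] x) (𝓝 l) := fun x => by
    by_cases hx : b x = 0
    · have hx' := h.snd'_ne_zero hx
      obtain ⟨l, hl⟩ := limS x
      have c' : Tendsto (fun y => 2 * b' y) (𝓝[≠] x) (𝓝 (2 * b' x)) :=
        ((cb'.tendsto x).const_mul 2).mono_left nhdsWithin_le_nhds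
      refine ⟨_, HasDerivAt.lhopital_zero_nhdsNE (f' := W) (g' := fun y => 2 * (b y * b' y))
        (Eventually.of_forall dw) (Eventually.of_forall fun y => ?_) ?_ ?_ ?_
        ((hl.div c' (by simpa using hx')).congr fun y => ?_)⟩
      · convert! (h.snd y).pow 2 using 1
        push_cast
        ring
      · filter_upwards [(h.snd x).eventually_ne (c := 0) hx',
          (cb'.continuousAt.eventually_ne hx').filter_mono nhdsWithin_le_nhds] with y h1 h2
        simp [h1, h2]
      · rw [← w0 x hx]
        exact (cw.tendsto x).mono_left nhdsWithin_le_nhds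
      · have := ((cb.pow 2).tendsto x).mono_left (nhdsWithin_le_nhds (s := {x}ᶜ))
        rwa [Pi.pow_apply, hx, zero_pow two_ne_zero] at this
      · rw [Pi.div_apply, div_div]
        congr 1
        ring
    · exact ⟨_, ((cw.tendsto x).div ((cb.tendsto x).pow 2)
        (pow_ne_zero 2 hx)).mono_left nhdsWithin_le_nhds⟩
  -- This quotient carries the singular part of the density. With the value 0 that division gives at
  -- zeros of b it is continuous and T-periodic, so its derivative `G` has integral zero.
  set g : ℝ → ℝ := fun x => b' x * wronsk X Y x / b x with hg
  set G : ℝ → ℝ := fun x => q x * wronsk X Y x + b' x * (W x / b x) -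
    b' x ^ 2 * (wronsk X Y x / b x ^ 2) with hG
  have iG : IntervalIntegrable G MeasureTheory.volume 0 T := by
    refine intervalIntegrable_of_tendsto_nhdsNE ?_ (fun x => ?_) 0 T
    · exact ((cq.measurable.mul cw.measurable).add (cb'.measurable.mul
        (cW.measurable.div cb.measurable))).sub
        ((cb'.measurable.pow_const 2).mul (cw.measurable.div (cb.measurable.pow_const 2)))
    · obtain ⟨l1, h1⟩ := limS x
      obtain ⟨l2, h2⟩ := limR x
      exact ⟨_, ((((cq.mul cw).tendsto x).mono_left nhdsWithin_le_nhds).add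
        (((cb'.tendsto x).mono_left nhdsWithin_le_nhds).mul h1)).sub
        ((((cb'.pow 2).tendsto x).mono_left nhdsWithin_le_nhds).mul h2)⟩
  have cg : Continuous g := by
    refine continuous_iff_continuousAt.2 fun x => ?_
    by_cases hx : b x = 0
    · rw [continuousAt_iff_punctured_nhds]
      have h1 := tendsto_div_of_zero (dw x) (h.snd x) (w0 x hx) hx (h.snd'_ne_zero hx)
      have h2 := ((cb'.tendsto x).mono_left (nhdsWithin_le_nhds (s := {x}ᶜ))).mul h1
      have e : g x = b' x * (W x / b' x) := by simp only [hg, hx, W0 x hx]; simp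
      rw [e]
      exact h2.congr fun y => (mul_div_assoc _ _ _).symm
    · exact (cb'.mul cw).continuousAt.div cb.continuousAt hx
  have dg : ∀ x, b x ≠ 0 → HasDerivAt g (G x) x := fun x hx => by
    convert! ((h.snd' x).mul (dw x)).div (h.snd x) hx using 1
    simp only [hG, Pi.mul_apply]
    field_simp
  have gT : g T = g 0 := by
    have e1 := hX.periodic 0
    have e2 := hY.periodic 0
    have e3 := hX.deriv.periodic 0
    have e4 := hY.deriv.periodic 0
    have e5 := hb 0
    have e6 := deriv_antiperiodic hb h.snd 0
    rw [zero_add] at *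
    simp only [hg, wronsk, e1, e2, e3, e4, e5, e6]
    rw [neg_mul, neg_div_neg_eq]
  have intG : ∫ x in (0 : ℝ)..T, G x = 0 := by
    rw [MeasureTheory.integral_eq_of_hasDerivAt_off_countable g G hcount cg.continuousOn
      (fun x hx => dg x hx.2) iG, gT, sub_self]
  have i1 : IntervalIntegrable (fun x => q x * (X x * deriv Y x - deriv X x * Y x))
      MeasureTheory.volume 0 T := Continuous.intervalIntegrable (by fun_prop) _ _
  have i2 : IntervalIntegrable (fun x => deriv X x * deriv (deriv Y) x)
      MeasureTheory.volume 0 T := Continuous.intervalIntegrable (by fun_prop) _ _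
  have i3 : IntervalIntegrable (fun x => deriv (deriv X) x * deriv Y x + deriv X x *
      deriv (deriv Y) x) MeasureTheory.volume 0 T := Continuous.intervalIntegrable (by fun_prop) _ _
  have intp : ∫ x in (0 : ℝ)..T, (deriv (deriv X) x * deriv Y x + deriv X x *
      deriv (deriv Y) x) = 0 := by
    rw [intervalIntegral.integral_eq_sub_of_hasDerivAt (fun x _ =>
      (sX.deriv_infty.hasDerivAt_infty x).mul (sY.deriv_infty.hasDerivAt_infty x)) i3]
    have e3 := hX.deriv.periodic 0
    have e4 := hY.deriv.periodic 0
    rw [zero_add] at e3 e4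
    simp only [Pi.mul_apply, e3, e4, sub_self]
  -- Off the zeros of b the density is -g'/2 + q(XY' - X'Y) + X'Y''/2 - (X'Y')'/4; the first and
  -- last terms integrate to zero.
  set D' : ℝ → ℝ := fun x => -(1 / 2) * G x + q x * (X x * deriv Y x - deriv X x * Y x) +
    1 / 2 * (deriv X x * deriv (deriv Y) x) - 1 / 4 *
      (deriv (deriv X) x * deriv Y x + deriv X x * deriv (deriv Y) x) with hD'
  have iD' : IntervalIntegrable D' MeasureTheory.volume 0 T :=
    (((iG.const_mul _).add i1).add (i2.const_mul _)).sub (i3.const_mul _)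
  have eD : ∀ x, b x ≠ 0 → D x = D' x := fun x hx => by
    rw [hD x hx, (hasDerivAt_variationComp h.sol_snd sX x).deriv,
      (hasDerivAt_variationComp h.sol_snd sY x).deriv]
    simp only [variationComp, hD', hG, hW, wronsk]
    field_simp
    ring
  have ae : ∀ᵐ x, D' x = D x := by
    filter_upwards [hcount.ae_notMem MeasureTheory.volume] with x hx
    exact (eD x hx).symm
  refine ⟨iD'.congr_ae (MeasureTheory.ae_restrict_of_ae ae), ?_⟩
  rw [← intervalIntegral.integral_congr_ae (ae.mono fun x hx _ => hx)]
  simp only [hD']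
  rw [intervalIntegral.integral_sub (((iG.const_mul _).add i1).add (i2.const_mul _))
    (i3.const_mul _), intervalIntegral.integral_add ((iG.const_mul _).add i1) (i2.const_mul _),
    intervalIntegral.integral_add (iG.const_mul _) i1]
  simp only [intervalIntegral.integral_const_mul, intG, intp]
  ring

end Density

/-! ### Projective curves -/

namespace ProjCurve

variable {T c : ℝ}

theorem isVectorField_hill (γ : ProjCurve T) : IsVectorField T γ.hill :=
  γ.hillBasis.isVectorField γ.lift_zero_add γ.lift_one_add

theorem potential_smul (γ : ProjCurve T) (hc : c ≠ 0) (x : ℝ) :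
    -(1 / (2 * c)) * γ.potential c x = γ.hill x := by
  rw [potential_eq]
  field_simp

theorem coadjoint_eq (γ : ProjCurve T) (X : ℝ → ℝ) (x : ℝ) :
    coadjoint c (γ.potential c) X x = -(2 * c) * hillVar γ.hill X x := by
  rw [potential_eq]
  simp only [coadjoint, hillVar]
  rw [((γ.contDiff_hill.hasDerivAt_infty x).const_mul (-(2 * c))).deriv]
  ring

theorem coadjoint_smul (γ : ProjCurve T) (hc : c ≠ 0) (X : ℝ → ℝ) (x : ℝ) :
    -(1 / (2 * c)) * coadjoint c (γ.potential c) X x = hillVar γ.hill X x := by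
  rw [coadjoint_eq]
  field_simp

theorem kirillov_smul (γ : ProjCurve T) (hc : c ≠ 0) (X Y : ℝ → ℝ) :
    -(1 / (2 * c)) * kirillov T c (γ.potential c) X Y =
      (∫ x in (0 : ℝ)..T, γ.hill x * (X x * deriv Y x - deriv X x * Y x)) +
        1 / 2 * ∫ x in (0 : ℝ)..T, deriv X x * deriv (deriv Y) x := by
  rw [potential_eq]
  simp only [kirillov, mul_assoc, intervalIntegral.integral_const_mul]
  field_simp
  ring

theorem liftDensity_eq (γ : ProjCurve T) (X Y : ℝ → ℝ) (x : ℝ) :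
    liftDensity γ X Y x =
      (variationComp (fun x => γ.lift x 1) (fun x => deriv γ.lift x 1) X x *
        deriv (variationComp (fun x => γ.lift x 1) (fun x => deriv γ.lift x 1) Y) x -
      deriv (variationComp (fun x => γ.lift x 1) (fun x => deriv γ.lift x 1) X) x *
        variationComp (fun x => γ.lift x 1) (fun x => deriv γ.lift x 1) Y x) /
      γ.lift x 1 ^ 2 := rfl

theorem deriv_affine (γ : ProjCurve T) {x : ℝ} (hx : γ.lift x 1 ≠ 0) :
    deriv γ.affine x = -1 / γ.lift x 1 ^ 2 := by
  refine HasDerivAt.deriv ?_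
  convert! (γ.hasDerivAt_lift x 0).div (γ.hasDerivAt_lift x 1) hx using 1
  rw [← γ.wronskian_lift x]
  ring

theorem eventually_lift_ne_zero (γ : ProjCurve T) {x : ℝ} (hx : γ.lift x 1 ≠ 0) :
    ∀ᶠ y in 𝓝 x, γ.lift y 1 ≠ 0 :=
  γ.hillBasis.continuous_snd.continuousAt.eventually_ne hx

theorem deriv_affineVariation (γ : ProjCurve T) {X : ℝ → ℝ} (hX : ContDiff ℝ ∞ X) {x : ℝ}
    (hx : γ.lift x 1 ≠ 0) :
    deriv (γ.affineVariation X) x = 2 * γ.variation X x 1 / γ.lift x 1 ^ 3 := by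
  have e : γ.affineVariation X =ᶠ[𝓝 x] fun y => X y * (-1 / γ.lift y 1 ^ 2) := by
    filter_upwards [γ.eventually_lift_ne_zero hx] with y hy
    rw [affineVariation, γ.deriv_affine hy]
  rw [e.deriv_eq, variation]
  refine HasDerivAt.deriv ?_
  convert! (hX.hasDerivAt_infty x).mul (((hasDerivAt_const x (-1 : ℝ)).div
    ((γ.hasDerivAt_lift x 1).pow 2) (pow_ne_zero 2 hx))) using 1
  simp only [Pi.sub_apply, Pi.smul_apply, smul_eq_mul, Pi.pow_apply, Pi.div_apply]
  push_cast
  field_simp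
  ring

theorem deriv_deriv_affineVariation (γ : ProjCurve T) {X : ℝ → ℝ} (hX : ContDiff ℝ ∞ X) {x : ℝ}
    (hx : γ.lift x 1 ≠ 0) : deriv (deriv (γ.affineVariation X)) x =
      2 * deriv (fun t => γ.variation X t 1) x / γ.lift x 1 ^ 3 -
        6 * γ.variation X x 1 * deriv γ.lift x 1 / γ.lift x 1 ^ 4 := by
  have e : deriv (γ.affineVariation X) =ᶠ[𝓝 x]
      fun y => 2 * γ.variation X y 1 / γ.lift y 1 ^ 3 := by
    filter_upwards [γ.eventually_lift_ne_zero hx] with y hy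
    exact γ.deriv_affineVariation hX hy
  have d : HasDerivAt (fun t => γ.variation X t 1) (deriv (fun t => γ.variation X t 1) x) x :=
    (hasDerivAt_variationComp γ.hillBasis.sol_snd hX x).differentiableAt.hasDerivAt
  rw [e.deriv_eq]
  refine HasDerivAt.deriv ?_
  convert! (d.const_mul 2).div ((γ.hasDerivAt_lift x 1).pow 3) (pow_ne_zero 3 hx) using 1
  push_cast
  simp only [Pi.pow_apply]
  field_simp
  ring

/-- Since (Xf')' = 2ξ₂/Γ₂³, the numerator is the Wronskian of ξ₂ and η₂ times (2/Γ₂³)²; dividing by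
(f')² = 1/Γ₂⁴ leaves 4/Γ₂². -/
theorem curveDensity_eq (γ : ProjCurve T) {X Y : ℝ → ℝ} (hX : ContDiff ℝ ∞ X)
    (hY : ContDiff ℝ ∞ Y) {x : ℝ} (hx : γ.lift x 1 ≠ 0) :
    curveDensity γ X Y x = 4 * liftDensity γ X Y x := by
  rw [curveDensity, liftDensity, γ.deriv_affine hx, γ.deriv_affineVariation hX hx,
    γ.deriv_affineVariation hY hx, γ.deriv_deriv_affineVariation hX hx,
    γ.deriv_deriv_affineVariation hY hx]
  field_simp
  ring

theorem ae_curveDensity_eq (γ : ProjCurve T) (hT : 0 < T) {X Y : ℝ → ℝ} (hX : ContDiff ℝ ∞ X)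
    (hY : ContDiff ℝ ∞ Y) : ∀ᵐ x, curveDensity γ X Y x = 4 * liftDensity γ X Y x := by
  obtain ⟨x₀, -, hz⟩ := γ.hillBasis.exists_zero hT γ.lift_one_add fun _ _ => γ.frieze_pos
  have hcount : {x | γ.lift x 1 = 0}.Countable :=
    (Set.countable_range fun k : ℤ => x₀ + k * T).mono fun x hx => by
      obtain ⟨k, hk⟩ := hz x hx
      exact ⟨k, hk.symm⟩
  filter_upwards [hcount.ae_notMem MeasureTheory.volume] with x hx
  exact γ.curveDensity_eq hX hY hx

/-- The integral formulas for the limit form. -/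
theorem integral_density (γ : ProjCurve T) (hT : 0 < T) (hc : c ≠ 0) {X Y : ℝ → ℝ}
    (hX : IsVectorField T X) (hY : IsVectorField T Y)
    (hX0 : ∀ x, γ.lift x 1 = 0 → γ.variation X x 1 = 0)
    (hY0 : ∀ x, γ.lift x 1 = 0 → γ.variation Y x 1 = 0) :
    IntervalIntegrable (liftDensity γ X Y) MeasureTheory.volume 0 T ∧
      IntervalIntegrable (curveDensity γ X Y) MeasureTheory.volume 0 T ∧
      (∫ x in (0 : ℝ)..T, liftDensity γ X Y x) =
        -(1 / (2 * c)) * kirillov T c (γ.potential c) X Y ∧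
      (∫ x in (0 : ℝ)..T, liftDensity γ X Y x) =
        -(1 / (4 * c)) * (-c * ∫ x in (0 : ℝ)..T, curveDensity γ X Y x) := by
  have h := γ.hillBasis
  obtain ⟨i1, e1⟩ := h.integral_density hT γ.lift_one_add (fun _ _ => γ.frieze_pos) hX hY
    (fun x hx => eq_zero_of_variationComp_eq_zero (b := fun x => γ.lift x 1)
      (b' := fun x => deriv γ.lift x 1) (h.snd'_ne_zero hx) hx (hX0 x hx))
    (fun x hx => eq_zero_of_variationComp_eq_zero (b := fun x => γ.lift x 1)
      (b' := fun x => deriv γ.lift x 1) (h.snd'_ne_zero hx) hx (hY0 x hx))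
    (D := liftDensity γ X Y) fun x _ => γ.liftDensity_eq X Y x
  have ae := γ.ae_curveDensity_eq hT hX.smooth hY.smooth
  refine ⟨i1, (i1.const_mul 4).congr_ae (MeasureTheory.ae_restrict_of_ae
    (ae.mono fun x hx => hx.symm)), e1.trans (γ.kirillov_smul hc X Y).symm, ?_⟩
  rw [intervalIntegral.integral_congr_ae (ae.mono fun x hx _ => hx),
    intervalIntegral.integral_const_mul]
  field_simp

end ProjCurve

end FriezeLimit

end

/-! ### The theorem from its parts -/

open FriezeLimit in
theorem theorem1 (T c : ℝ) (hT : 0 < T) (hc : c ≠ 0) :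
    -- `γ ↦ F = [Γ, Γ]` identifies `Diff₊(S¹)/PSL₂(ℝ)` with the closed continuous friezes
    (∃ Φ : VirasoroOrbit T ≃ {F : ℝ → ℝ → ℝ // IsClosedContFrieze T F},
      ∀ γ : ProjCurve T, (Φ (Quotient.mk _ γ)).1 = γ.frieze) ∧
    -- smooth limits of positive closed Coxeter friezes belong to `Diff₊(S¹)/PSL₂(ℝ)`
    (∀ (v : ℕ → ℤ → ℤ → ℝ) (q : ℝ → ℝ),
      (∀ᶠ n in atTop, IsClosedFrieze n (v n) ∧ IsPositiveFrieze n (v n)) →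
      ContDiff ℝ ∞ q → FriezeConverges T v q →
      ∃ γ : ProjCurve T, ∀ x, q x = -(1 / (2 * c)) * γ.potential c x) ∧
    -- every point and every tangent vector of `Diff₊(S¹)/PSL₂(ℝ)` is a limit
    (∀ γ : ProjCurve T, ∃ v : ℕ → ℤ → ℤ → ℝ,
      (∀ᶠ n in atTop, IsClosedFrieze n (v n)) ∧
      FriezeConverges T v (fun x => -(1 / (2 * c)) * γ.potential c x) ∧
      ∀ X : ℝ → ℝ, IsVectorField T X → ∃ w : ℕ → ℤ → ℤ → ℝ,
        (∀ᶠ n in atTop, IsFriezeTangent n (v n) (w n)) ∧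
        TangentConverges T w (fun x => -(1 / (2 * c)) * coadjoint c (γ.potential c) X x)) ∧
    -- convergence of the entries
    (∀ (γ : ProjCurve T) (v : ℕ → ℤ → ℤ → ℝ),
      (∀ᶠ n in atTop, IsClosedFrieze n (v n)) →
      FriezeConverges T v (fun x => -(1 / (2 * c)) * γ.potential c x) →
      (∀ᶠ n in atTop, IsPositiveFrieze n (v n)) ∧
      EntriesConverge T v γ.frieze ∧
      -- smooth limits of tangent vectors are tangent vectors
      (∀ (w : ℕ → ℤ → ℤ → ℝ) (r : ℝ → ℝ),
        (∀ᶠ n in atTop, IsFriezeTangent n (v n) (w n)) →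
        ContDiff ℝ ∞ r → TangentConverges T w r →
        ∃ X : ℝ → ℝ, IsVectorField T X ∧
          ∀ x, r x = -(1 / (2 * c)) * coadjoint c (γ.potential c) X x) ∧
      (∀ (w : ℕ → ℤ → ℤ → ℝ) (X : ℝ → ℝ), IsVectorField T X →
        (∀ᶠ n in atTop, IsFriezeTangent n (v n) (w n)) →
        TangentConverges T w (fun x => -(1 / (2 * c)) * coadjoint c (γ.potential c) X x) →
        EntriesConverge T w (fun x y =>
          bracket (γ.variation X x) (γ.lift y) + bracket (γ.lift x) (γ.variation X y))) ∧
      -- the limit of the cluster form is a multiple of Kirillov's form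
      (∀ (w w' : ℕ → ℤ → ℤ → ℝ) (X Y : ℝ → ℝ), IsVectorField T X → IsVectorField T Y →
        (∀ᶠ n in atTop, IsFriezeTangent n (v n) (w n)) →
        (∀ᶠ n in atTop, IsFriezeTangent n (v n) (w' n)) →
        TangentConverges T w (fun x => -(1 / (2 * c)) * coadjoint c (γ.potential c) X x) →
        TangentConverges T w' (fun x => -(1 / (2 * c)) * coadjoint c (γ.potential c) Y x) →
        ∀ m : ℤ, Tendsto (fun n => clusterForm n m (v n) (w n) (w' n)) atTop
          (𝓝 (-(1 / (2 * c)) * kirillov T c (γ.potential c) X Y)))) ∧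
    -- every tangent vector has a representative whose variation of `Γ₂` vanishes where `Γ₂` does
    (∀ (γ : ProjCurve T) (X : ℝ → ℝ), IsVectorField T X →
      ∃ X₀ : ℝ → ℝ, IsVectorField T X₀ ∧
        (∀ x, γ.lift x 1 = 0 → γ.variation X₀ x 1 = 0) ∧
        ∀ x, coadjoint c (γ.potential c) X₀ x = coadjoint c (γ.potential c) X x) ∧
    -- on such representatives, the limit form is given by the integral formulas
    (∀ (γ : ProjCurve T) (X Y : ℝ → ℝ), IsVectorField T X → IsVectorField T Y →
      (∀ x, γ.lift x 1 = 0 → γ.variation X x 1 = 0) →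
      (∀ x, γ.lift x 1 = 0 → γ.variation Y x 1 = 0) →
      IntervalIntegrable (liftDensity γ X Y) MeasureTheory.volume 0 T ∧
      IntervalIntegrable (curveDensity γ X Y) MeasureTheory.volume 0 T ∧
      (∫ x in (0 : ℝ)..T, liftDensity γ X Y x) =
        -(1 / (2 * c)) * kirillov T c (γ.potential c) X Y ∧
      (∫ x in (0 : ℝ)..T, liftDensity γ X Y x) =
        -(1 / (4 * c)) * (-c * ∫ x in (0 : ℝ)..T, curveDensity γ X Y x)) := by
  refine ⟨exists_equiv_closedContFrieze hT, fun v q hv hqs hq => ?_, fun γ => ?_,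
    fun γ v hv hq => ?_, fun γ X hX => ?_, fun γ X Y hX hY hX0 hY0 =>
      γ.integral_density hT hc hX hY hX0 hY0⟩
  · obtain ⟨γ, rfl⟩ := hq.exists_projCurve hT hv hqs
    exact ⟨γ, fun x => (γ.potential_smul hc x).symm⟩
  · have h := γ.hillBasis
    obtain ⟨v, hv, hvq⟩ := h.exists_friezes hT γ.lift_zero_add γ.lift_one_add
    have hpos : ∀ x y, x < y → y < x + T → 0 < γ.frieze x y := fun _ _ => γ.frieze_pos
    simp only [γ.potential_smul hc, γ.coadjoint_smul hc]
    exact ⟨v, hv, hvq, fun X hX => exists_tangents h hT γ.lift_zero_add γ.lift_one_add hpos hv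
      (hvq.eventually_positive hT h hpos hv)
      (hvq.entriesConverge hT h γ.lift_zero_add γ.lift_one_add hv) hX⟩
  · have h := γ.hillBasis
    have hpos : ∀ x y, x < y → y < x + T → 0 < γ.frieze x y := fun _ _ => γ.frieze_pos
    -- This removes c: what remains concerns only y'' = qy and the variations of q.
    simp only [γ.potential_smul hc, γ.coadjoint_smul hc, γ.kirillov_smul hc] at hq ⊢
    have hp := FriezeConverges.eventually_positive hT h hpos hv hq
    have he := FriezeConverges.entriesConverge hT h γ.lift_zero_add γ.lift_one_add hv hq
    refine ⟨hp, he, fun w r hw hr hwr => ?_, fun w X hX hw hwr => ?_,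
      fun w w' X Y hX hY hw hw' hwr hwr' m => ?_⟩
    · exact hwr.exists_vectorField hT h γ.lift_zero_add γ.lift_one_add he
        (hw.mono fun n hn => hn.isLinearTangent) hr
    · exact TangentConverges.entriesConverge hT h γ.lift_zero_add γ.lift_one_add he
        (hw.mono fun n hn => hn.isLinearTangent) hX hwr
    · have := tendsto_clusterForm hT h γ.lift_zero_add γ.lift_one_add he hp
        (hw.mono fun n hn => hn.isLinearTangent) (hw'.mono fun n hn => hn.isLinearTangent)
        (continuous_hillVar γ.contDiff_hill hX.smooth) (continuous_hillVar γ.contDiff_hill hY.smooth)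
        hwr hwr' m
      rwa [h.integral_integral_hillVar γ.isVectorField_hill γ.lift_zero_add γ.lift_one_add
        hX hY] at this
  · obtain ⟨X₀, h1, h2, h3⟩ := γ.hillBasis.exists_representative hT γ.lift_zero_add γ.lift_one_add
      (fun _ _ => γ.frieze_pos) hX
    exact ⟨X₀, h1, h2, fun x => by rw [γ.coadjoint_eq, γ.coadjoint_eq, h3]⟩
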